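/- Let $G$ be either (a) a finite-dimensional Lie group, smooth ($\mathbb K=\mathbb R$ or $\mathbb C$) or analytic over a complete nontrivially normed field $\mathbb K$ of characteristic zero, or (b) an affine algebraic group over a field $\mathbb K$ of characteristic zero. "Admissible" means smooth, analytic or algebraic, accordingly. Let $\mathfrak g$ be the Lie algebra of left invariant vector fields on $G$ and $\mathcal H\in\mathfrak g\otimes\mathfrak g$ any $\mathrm{Ad}$-invariant symmetric $2$-tensor, not necessarily non-degenerate. Conventions. For $X\in\mathfrak g$ put $X^L_q=\frac{d}{dt}\big|_{0}\,q\exp(tX)$ and $X^R_q=\frac{d}{dt}\big|_{0}\exp(tX)q$; if a group $K$ with Lie algebra $\mathfrak k$ acts on $M$ from the left, $\mathrm{fund}_M(X)_q=X_{M,q}=\frac{d}{dt}\big|_{0}\exp(-tX)q$ for $X\in\mathfrak k$. Multivector fields are totally antisymmetric tensors, with $u\wedge v=u\otimes v-v\otimes u$ and $u\wedge v\wedge w$ the signed sum over all six permutations, and $[\cdot,\cdot]$ is the Schouten bracket that extends the Lie bracket of vector fields as a Gerstenhaber bracket, so that for the bracket $\{f,h\}=P(df,dh)$ of a bivector field $P$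 one has $[P,P](df,dg,dh)=2\left(\{f,\{g,h\}\}+\{g,\{h,f\}\}+\{h,\{f,g\}\}\right)$. For a symmetric $\mathrm{Ad}$-invariant tensor $\mathcal H'\in\mathfrak k\otimes\mathfrak k$, let $\phi_{\mathcal H'}=-\tfrac12(\mathrm{Id}\otimes[\cdot,\cdot]\otimes\mathrm{Id})(\mathcal H'\otimes\mathcal H')\in\mathfrak k^{\otimes3}$. A $K$-quasi Poisson structure on $M$ relative to $\mathcal H'$ is a $K$-invariant admissible bivector field $P$ on $M$ such that $[P,P]$ is the image of $\phi_{\mathcal H'}$ under the infinitesimal action. A $K$-momentum mapping for $P$ relative to $\mathcal H'$ is an admissible map $\Phi\colon M\to K$, equivariant with respect to conjugation on $K$, such that at each point $$(d\Phi\otimes\mathrm{Id})(P)=\left(\tfrac12(L_\Phi+R_\Phi)\otimes\mathrm{fund}_M\right)(\mathcal H'),$$ where $L_\Phi(X)=X^L_{\Phi}$ and $R_\Phi(X)=X^R_{\Phi}$. Statement. The rule $(x,y)\cdot(q_1,q_2)=(xq_1y^{-1},\,yq_2x^{-1})$ is an admissible left action of $G\times G$ on $G\times G$. With respect to this action, the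 bivector field $$P^\times_{\mathcal H}=\tfrac12\left(L^1\wedge R^2+R^1\wedge L^2\right)(\mathcal H)$$ on $G\times G$, where $L^j$ and $R^j$ are $X\mapsto X^L$ and $X\mapsto X^R$ on the $j$-th factor and $(S\wedge T)(\mathcal H)=(S\otimes T)(\mathcal H)-(T\otimes S)(\mathcal H)$, is a $(G\times G)$-quasi Poisson structure relative to $\mathcal H+\widetilde{\mathcal H}$, the sum in $(\mathfrak g\oplus\mathfrak g)\otimes(\mathfrak g\oplus\mathfrak g)$ of the copies of $\mathcal H$ in the first and in the second summand. Moreover, the map $(\mathrm{mult},\widetilde{\mathrm{mult}})\colon G\times G\to G\times G$, $(q_1,q_2)\mapsto(q_1q_2,\;q_1^{-1}q_2^{-1})$, is a $(G\times G)$-momentum mapping for $P^\times_{\mathcal H}$ relative to $\mathcal H+\widetilde{\mathcal H}$. -/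

import Mathlib

open scoped TensorProduct Manifold ContDiff

noncomputable section

namespace QuasiPoisson

/-! ### The Cartan element of a symmetric 2-tensor -/

section Cartan

variable {K : Type*} [Field K] {L : Type*} [LieRing L] [LieAlgebra K L]

/-- The Lie bracket as a linear map `L ⊗ L → L`. -/
def bracketMap (K : Type*) [Field K] (L : Type*) [LieRing L] [LieAlgebra K L] :
    L ⊗[K] L →ₗ[K] L :=
  TensorProduct.lift (LieModule.toEnd K L L : L →ₗ[K] Module.End K L)

/-- The map `Id ⊗ [·,·] ⊗ Id`, sending `(a ⊗ b) ⊗ (c ⊗ d)` to `a ⊗ [b, c] ⊗ d`. -/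
def middleBracket (K : Type*) [Field K] (L : Type*) [LieRing L] [LieAlgebra K L] :
    (L ⊗[K] L) ⊗[K] (L ⊗[K] L) →ₗ[K] L ⊗[K] (L ⊗[K] L) :=
  (LinearMap.lTensor L
      (LinearMap.rTensor L (bracketMap K L) ∘ₗ
        (TensorProduct.assoc K L L L).symm.toLinearMap)) ∘ₗ
    (TensorProduct.assoc K L L (L ⊗[K] L)).toLinearMap

/-- The Cartan element `φ_H = -½ (Id ⊗ [·,·] ⊗ Id)(H ⊗ H)`. If `H = ∑ eᵢ ⊗ eᵢ` for an orthonormal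
basis of an invariant form `•`, this is `½ ∑ (eₐ • [e_b, e_c]) eₐ ⊗ e_b ⊗ e_c`, that is,
`1/12 ∑ (eₐ • [e_b, e_c]) eₐ ∧ e_b ∧ e_c`. -/
def cartanElement (H : L ⊗[K] L) : L ⊗[K] (L ⊗[K] L) :=
  -((1 / 2 : K) • middleBracket K L (H ⊗ₜ[K] H))

end Cartan

/-! ### Smooth and analytic manifolds -/

section Manifold

variable {𝕜 : Type*} [NontriviallyNormedField 𝕜]
  {EG : Type*} [NormedAddCommGroup EG] [NormedSpace 𝕜 EG]
  {HG : Type*} [TopologicalSpace HG] {J : ModelWithCorners 𝕜 EG HG}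
  {G : Type*} [TopologicalSpace G] [ChartedSpace HG G] [Group G]
  {EM : Type*} [NormedAddCommGroup EM] [NormedSpace 𝕜 EM]
  {HM : Type*} [TopologicalSpace HM] {I : ModelWithCorners 𝕜 EM HM}
  {M : Type*} [TopologicalSpace M] [ChartedSpace HM M]

/-- `X ↦ X^L_q = d/dt (q exp (tX))`, the derivative at the identity of left multiplication by
`q`. -/
def leftMap (J : ModelWithCorners 𝕜 EG HG) (q : G) :
    GroupLieAlgebra J G →ₗ[𝕜] TangentSpace J q :=
  (mfderiv J J (fun g : G => q * g) 1 : EG →L[𝕜] EG).toLinearMap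

/-- `X ↦ X^R_q = d/dt (exp (tX) q)`, the derivative at the identity of right multiplication by
`q`. -/
def rightMap (J : ModelWithCorners 𝕜 EG HG) (q : G) :
    GroupLieAlgebra J G →ₗ[𝕜] TangentSpace J q :=
  (mfderiv J J (fun g : G => g * q) 1 : EG →L[𝕜] EG).toLinearMap

/-- The adjoint action of `q`, the derivative at the identity of conjugation by `q`. -/
def adMap (J : ModelWithCorners 𝕜 EG HG) (q : G) :
    GroupLieAlgebra J G →ₗ[𝕜] GroupLieAlgebra J G :=
  (mfderiv J J (fun g : G => q * g * q⁻¹) 1 : EG →L[𝕜] EG).toLinearMap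

/-- `H` is a symmetric `Ad`-invariant 2-tensor. -/
structure IsAdInvSymm (J : ModelWithCorners 𝕜 EG HG)
    (H : GroupLieAlgebra J G ⊗[𝕜] GroupLieAlgebra J G) : Prop where
  symm : TensorProduct.comm 𝕜 _ _ H = H
  ad_inv : ∀ q : G, TensorProduct.map (adMap J q) (adMap J q) H = H

/-- `act` is a left action of the Lie group `G` on the manifold `M`, of class `C^n`. -/
structure IsManifoldAction (J : ModelWithCorners 𝕜 EG HG) (I : ModelWithCorners 𝕜 EM HM)
    (n : WithTop ℕ∞) (act : G → M → M) : Prop where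
  one_act : ∀ x, act 1 x = x
  mul_act : ∀ g h x, act (g * h) x = act g (act h x)
  contMDiff : ContMDiff (J.prod I) I n (fun p : G × M => act p.1 p.2)

/-- The fundamental vector fields `X ↦ X_{M,x} = d/dt (exp (-tX) x)` of an action. -/
def fund (J : ModelWithCorners 𝕜 EG HG) (I : ModelWithCorners 𝕜 EM HM)
    (act : G → M → M) (x : M) : GroupLieAlgebra J G →ₗ[𝕜] TangentSpace I x :=
  -(mfderiv J I (fun g : G => act g x) 1 : EG →L[𝕜] EM).toLinearMap

/-- The differential at `x` of a scalar function. -/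
def diff (I : ModelWithCorners 𝕜 EM HM) (f : M → 𝕜) (x : M) :
    Module.Dual 𝕜 (TangentSpace I x) :=
  (mfderiv I 𝓘(𝕜, 𝕜) f x : EM →L[𝕜] 𝕜).toLinearMap

/-- The differential of a map, as a linear map between tangent spaces. -/
def dmap (I : ModelWithCorners 𝕜 EM HM) (J : ModelWithCorners 𝕜 EG HG) (Φ : M → G) (x : M) :
    TangentSpace I x →ₗ[𝕜] TangentSpace J (Φ x) :=
  (mfderiv I J Φ x).toLinearMap

/-- A field of 2-tensors, i.e. a (not necessarily continuous) section of `T M ⊗ T M`. -/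
abbrev TensorField₂ (I : ModelWithCorners 𝕜 EM HM) (M : Type*) [TopologicalSpace M]
    [ChartedSpace HM M] : Type _ :=
  ∀ x : M, TangentSpace I x ⊗[𝕜] TangentSpace I x

/-- The bidifferential operator `{f, h}(x) = P_x(df, dh)` given by a field of 2-tensors. -/
def bidiff (P : TensorField₂ I M) (f h : M → 𝕜) (x : M) : 𝕜 :=
  TensorProduct.dualDistrib 𝕜 _ _ (diff I f x ⊗ₜ[𝕜] diff I h x) (P x)

/-- The tridifferential operator given by a tangent 3-tensor at `x`. -/
def tridiffAt (x : M)
    (T : TangentSpace I x ⊗[𝕜] (TangentSpace I x ⊗[𝕜] TangentSpace I x)) (f g h : M → 𝕜) : 𝕜 :=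
  TensorProduct.dualDistrib 𝕜 _ _
    (diff I f x ⊗ₜ[𝕜] TensorProduct.dualDistrib 𝕜 _ _ (diff I g x ⊗ₜ[𝕜] diff I h x)) T

/-- `P` is a bivector field of class `C^n`: it is skew, and it sends germs of `C^n` functions to
germs of `C^n` functions. -/
structure IsBivectorField (n : WithTop ℕ∞) (P : TensorField₂ I M) : Prop where
  skew : ∀ x, TensorProduct.comm 𝕜 _ _ (P x) = -P x
  admissible : ∀ x (f h : M → 𝕜), ContMDiffAt I 𝓘(𝕜, 𝕜) n f x → ContMDiffAt I 𝓘(𝕜, 𝕜) n h x →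
    ContMDiffAt I 𝓘(𝕜, 𝕜) n (bidiff P f h) x

/-- The Schouten bracket `[P, Q]` of two bivector fields, as a tridifferential operator. The
normalization is that of the Gerstenhaber bracket which extends the Lie bracket of vector fields,
where `X ∧ Y = X ⊗ Y - Y ⊗ X` and `X ∧ Y ∧ Z` is the signed sum over all permutations; thus
`[X ∧ Y, X ∧ Y] = 2 X ∧ Y ∧ [X, Y]`, and `[P, P](f, g, h) = 2 ({f,{g,h}} + {g,{h,f}} + {h,{f,g}})`. -/
def schouten (P Q : TensorField₂ I M) (f g h : M → 𝕜) (x : M) : 𝕜 :=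
  bidiff P f (bidiff Q g h) x + bidiff P g (bidiff Q h f) x + bidiff P h (bidiff Q f g) x +
  (bidiff Q f (bidiff P g h) x + bidiff Q g (bidiff P h f) x + bidiff Q h (bidiff P f g) x)

/-- `P` is invariant under the action. -/
def IsInvariant (act : G → M → M) (P : TensorField₂ I M) : Prop :=
  ∀ (g : G) (x : M),
    TensorProduct.map (mfderiv I I (act g) x).toLinearMap (mfderiv I I (act g) x).toLinearMap (P x)
      = P (act g x)

/-- `P` is a `G`-quasi Poisson structure relative to `H`, for the action `act`: a `G`-invariant
bivector field of class `C^n` such that `[P, P]` is the image of the Cartan element of `H` under the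
infinitesimal action. -/
structure IsQuasiPoisson [CompleteSpace EG] [LieGroup J (minSmoothness 𝕜 3) G]
    (n : WithTop ℕ∞) (act : G → M → M) (H : GroupLieAlgebra J G ⊗[𝕜] GroupLieAlgebra J G)
    (P : TensorField₂ I M) : Prop where
  bivector : IsBivectorField n P
  invariant : IsInvariant act P
  schouten_eq : ∀ (x : M) (f g h : M → 𝕜), ContMDiffAt I 𝓘(𝕜, 𝕜) n f x →
    ContMDiffAt I 𝓘(𝕜, 𝕜) n g x → ContMDiffAt I 𝓘(𝕜, 𝕜) n h x →
    schouten P P f g h x =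
      tridiffAt x (TensorProduct.map (fund J I act x)
        (TensorProduct.map (fund J I act x) (fund J I act x)) (cartanElement H)) f g h

/-- `Φ` is a `G`-momentum mapping for `P` relative to `H`: it is of class `C^n`, equivariant for
conjugation, and `(dΦ ⊗ Id) P = (½ (L_Φ + R_Φ) ⊗ fund) H`. -/
structure IsMomentumMap (n : WithTop ℕ∞) (act : G → M → M)
    (H : GroupLieAlgebra J G ⊗[𝕜] GroupLieAlgebra J G) (P : TensorField₂ I M) (Φ : M → G) :
    Prop where
  contMDiff : ContMDiff I J n Φ
  equivariant : ∀ g x, Φ (act g x) = g * Φ x * g⁻¹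
  momentum : ∀ x, TensorProduct.map (dmap I J Φ x) LinearMap.id (P x) =
    TensorProduct.map ((1 / 2 : 𝕜) • (leftMap J (Φ x) + rightMap J (Φ x))) (fund J I act x) H

/-- The inclusion of the first summand into `T (G × G) = T G ⊕ T G`. -/
def inl (J : ModelWithCorners 𝕜 EG HG) (q : G × G) :
    TangentSpace J q.1 →ₗ[𝕜] TangentSpace (J.prod J) q :=
  LinearMap.inl 𝕜 EG EG

/-- The inclusion of the second summand into `T (G × G) = T G ⊕ T G`. -/
def inr (J : ModelWithCorners 𝕜 EG HG) (q : G × G) :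
    TangentSpace J q.2 →ₗ[𝕜] TangentSpace (J.prod J) q :=
  LinearMap.inr 𝕜 EG EG

/-- The 2-tensor `H + H̃` in `(𝔤 ⊕ 𝔤) ⊗ (𝔤 ⊕ 𝔤)`. -/
def doubleTensor (H : GroupLieAlgebra J G ⊗[𝕜] GroupLieAlgebra J G) :
    GroupLieAlgebra (J.prod J) (G × G) ⊗[𝕜] GroupLieAlgebra (J.prod J) (G × G) :=
  TensorProduct.map (inl J (1 : G × G)) (inl J (1 : G × G)) H +
    TensorProduct.map (inr J (1 : G × G)) (inr J (1 : G × G)) H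

/-- The action `(x, y) · (q₁, q₂) = (x q₁ y⁻¹, y q₂ x⁻¹)` of `G × G` on `G × G`. -/
def doubleAct (p q : G × G) : G × G := (p.1 * q.1 * p.2⁻¹, p.2 * q.2 * p.1⁻¹)

/-- The map `(mult, mult~) : (q₁, q₂) ↦ (q₁ q₂, q₁⁻¹ q₂⁻¹)`. -/
def doubleMoment (q : G × G) : G × G := (q.1 * q.2, q.1⁻¹ * q.2⁻¹)

/-- The bivector field `½ (L¹ ∧ R² + R¹ ∧ L²)(H)` on `G × G`. -/
def doubleBivector (H : GroupLieAlgebra J G ⊗[𝕜] GroupLieAlgebra J G) :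
    TensorField₂ (J.prod J) (G × G) := fun q =>
  let L₁ := inl J q ∘ₗ leftMap J q.1
  let R₁ := inl J q ∘ₗ rightMap J q.1
  let L₂ := inr J q ∘ₗ leftMap J q.2
  let R₂ := inr J q ∘ₗ rightMap J q.2
  (1 / 2 : 𝕜) • ((TensorProduct.map L₁ R₂ H - TensorProduct.map R₂ L₁ H) +
    (TensorProduct.map R₁ L₂ H - TensorProduct.map L₂ R₁ H))

end Manifold

/-! ### Affine algebraic groups, given by their coordinate Hopf algebras -/

namespace Algebraic

section Operators

variable {K : Type*} [Field K] {L L' B B' C : Type*}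
  [AddCommGroup L] [Module K L] [AddCommGroup L'] [Module K L']
  [CommRing B] [Algebra K B] [CommRing B'] [Algebra K B'] [CommRing C] [Algebra K C]

/-- For linear families of operators `X ↦ S X : B → C` and `Y ↦ T Y : B' → C`, the image of a
2-tensor under `X ⊗ Y ↦ ((f, h) ↦ (S X f) (T Y h))`. -/
def biop (S : L →ₗ[K] B →ₗ[K] C) (T : L' →ₗ[K] B' →ₗ[K] C) (H : L ⊗[K] L') :
    B →ₗ[K] B' →ₗ[K] C :=
  LinearMap.mk₂ K
    (fun f h => LinearMap.mul' K C (TensorProduct.map (S.flip f) (T.flip h) H))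
    (fun f f' h => by simp [TensorProduct.map_add_left])
    (fun c f h => by simp [TensorProduct.map_smul_left])
    (fun f h h' => by simp [TensorProduct.map_add_right])
    (fun c f h => by simp [TensorProduct.map_smul_right])

/-- The image of a 3-tensor under `X ⊗ Y ⊗ Z ↦ ((f, g, h) ↦ (S X f) (S Y g) (S Z h))`. -/
def triop (S : L →ₗ[K] B →ₗ[K] C) (φ : L ⊗[K] (L ⊗[K] L)) (f g h : B) : C :=
  LinearMap.mul' K C (TensorProduct.map (S.flip f)
    (LinearMap.mul' K C ∘ₗ TensorProduct.map (S.flip g) (S.flip h)) φ)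

end Operators

section Group

variable {K : Type*} [Field K] {A : Type*} [CommRing A] [HopfAlgebra K A]
  {B : Type*} [CommRing B] [Algebra K B]

/-- The Lie algebra of left invariant vector fields on the group with coordinate ring `A`: the
derivations `D` of `A` such that `Δ ∘ D = (Id ⊗ D) ∘ Δ`. -/
def lieAlg (K : Type*) [Field K] (A : Type*) [CommRing A] [HopfAlgebra K A] :
    LieSubalgebra K (Derivation K A A) where
  carrier := {D | ∀ a : A, Coalgebra.comul (R := K) (D a) =
    LinearMap.lTensor A (D : A →ₗ[K] A) (Coalgebra.comul (R := K) a)}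
  add_mem' := by
    intro D D' hD hD' a
    simp only [Set.mem_ofPred_eq] at hD hD'
    simp [hD a, hD' a, LinearMap.lTensor_add]
  zero_mem' := by
    intro a
    simp
  smul_mem' := by
    intro c D hD a
    simp only [Set.mem_ofPred_eq] at hD
    simp [hD a, LinearMap.lTensor_smul]
  lie_mem' := by
    intro D D' hD hD' a
    simp only [Set.mem_ofPred_eq] at hD hD'
    have h : ((⁅D, D'⁆ : Derivation K A A) : A →ₗ[K] A) =
        (D : A →ₗ[K] A) ∘ₗ (D' : A →ₗ[K] A) - (D' : A →ₗ[K] A) ∘ₗ (D : A →ₗ[K] A) := by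
      ext x
      rfl
    rw [h, Derivation.commutator_apply, map_sub, hD (D' a), hD' a, hD' (D a), hD a,
      LinearMap.lTensor_sub, LinearMap.lTensor_comp, LinearMap.lTensor_comp]
    rfl

/-- The tangent vector `X_e = ε ∘ X` at the identity of a left invariant vector field. -/
def tangent : lieAlg K A →ₗ[K] A →ₗ[K] K :=
  LinearMap.mk₂ K (fun X a => Coalgebra.counit (R := K) ((X : Derivation K A A) a))
    (by simp) (by simp) (by simp) (by simp)

/-- The vector fields `X^L = X`, as operators on functions. -/
def leftOp : lieAlg K A →ₗ[K] A →ₗ[K] A :=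
  LinearMap.mk₂ K (fun X a => (X : Derivation K A A) a)
    (by simp) (by simp) (by simp) (by simp)

/-- The vector fields `X^R`, as operators on functions: `(X^R a)(q) = d/dt a(exp (tX) q)`. -/
def rightOp : lieAlg K A →ₗ[K] A →ₗ[K] A :=
  LinearMap.mk₂ K
    (fun X a => TensorProduct.lid K A
      (LinearMap.rTensor A (tangent X) (Coalgebra.comul (R := K) a)))
    (by simp [LinearMap.rTensor_add]) (by simp [LinearMap.rTensor_smul]) (by simp) (by simp)

/-- The product of two `R`-valued points of the group with coordinate ring `A`. -/
def ptMul {R : Type*} [CommRing R] [Algebra K R] (f g : A →ₐ[K] R) : A →ₐ[K] R :=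
  (Algebra.TensorProduct.lift f g (fun _ _ => Commute.all _ _)).comp (Bialgebra.comulAlgHom K A)

/-- The inverse of an `R`-valued point of the group with coordinate ring `A`. -/
def ptInv {R : Type*} [CommRing R] [Algebra K R] (f : A →ₐ[K] R) : A →ₐ[K] R :=
  f.comp (HopfAlgebra.antipodeAlgHom K A)

/-- Conjugation `(g, x) ↦ g x g⁻¹`, on functions. -/
def conj (K : Type*) [Field K] (A : Type*) [CommRing A] [HopfAlgebra K A] : A →ₐ[K] A ⊗[K] A :=
  let g : A →ₐ[K] A ⊗[K] A := Algebra.TensorProduct.includeLeft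
  let x : A →ₐ[K] A ⊗[K] A := Algebra.TensorProduct.includeRight
  ptMul (ptMul g x) (ptInv g)

/-- The adjoint action: `adOp X a` is the function `g ↦ (Ad_g X)_e a`. -/
def adOp : lieAlg K A →ₗ[K] A →ₗ[K] A :=
  LinearMap.mk₂ K
    (fun X a => TensorProduct.rid K A (LinearMap.lTensor A (tangent X) (conj K A a)))
    (by simp [LinearMap.lTensor_add]) (by simp [LinearMap.lTensor_smul]) (by simp) (by simp)

/-- `H` is a symmetric `Ad`-invariant 2-tensor: `(Ad_g ⊗ Ad_g) H = H` for the generic point `g`. -/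
structure IsAdInvSymm (H : lieAlg K A ⊗[K] lieAlg K A) : Prop where
  symm : TensorProduct.comm K _ _ H = H
  ad_inv : ∀ a b : A, biop adOp adOp H a b = algebraMap K A (biop tangent tangent H a b)

/-- `ρ` is a left action, on functions, of the group with coordinate ring `A` on the variety with
coordinate ring `B`. -/
structure IsAction (ρ : B →ₐ[K] A ⊗[K] B) : Prop where
  counit : ∀ b, TensorProduct.lid K B
    (LinearMap.rTensor B (Coalgebra.counit (R := K) (A := A)) (ρ b)) = b
  coassoc : ∀ b, TensorProduct.assoc K A A B
      (LinearMap.rTensor B (Coalgebra.comul (R := K) (A := A)) (ρ b)) =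
    LinearMap.lTensor A ρ.toLinearMap (ρ b)

/-- The fundamental vector fields of an action, as operators on functions:
`(X_M b)(q) = d/dt b(exp (-tX) q)`. -/
def fund (ρ : B →ₐ[K] A ⊗[K] B) : lieAlg K A →ₗ[K] B →ₗ[K] B :=
  -LinearMap.mk₂ K (fun X b => TensorProduct.lid K B (LinearMap.rTensor B (tangent X) (ρ b)))
    (by simp [LinearMap.rTensor_add]) (by simp [LinearMap.rTensor_smul]) (by simp) (by simp)

/-- `P` is a bivector field, i.e. a skew bidifferential operator of order one in each variable. -/
structure IsBivectorField (P : B →ₗ[K] B →ₗ[K] B) : Prop where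
  skew : ∀ f h, P f h = -P h f
  leibniz : ∀ f h k, P f (h * k) = P f h * k + h * P f k

/-- The `A`-bilinear extension of `P` to `A ⊗ B`, sending `(a ⊗ f, a' ⊗ h)` to `a a' ⊗ P(f, h)`. -/
def extend (A : Type*) [CommRing A] [Algebra K A] (P : B →ₗ[K] B →ₗ[K] B) (u v : A ⊗[K] B) :
    A ⊗[K] B :=
  TensorProduct.map (LinearMap.mul' K A) (TensorProduct.lift P)
    (TensorProduct.tensorTensorTensorComm K A B A B (u ⊗ₜ[K] v))

/-- `P` is invariant under the action: `P(f ∘ g, h ∘ g) = P(f, h) ∘ g` for the generic point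
`g`. -/
def IsInvariant (ρ : B →ₐ[K] A ⊗[K] B) (P : B →ₗ[K] B →ₗ[K] B) : Prop :=
  ∀ f h, extend A P (ρ f) (ρ h) = ρ (P f h)

/-- The Schouten bracket of two bivector fields, as a tridifferential operator, with the same
normalization as in the case of manifolds. -/
def schouten (P Q : B →ₗ[K] B →ₗ[K] B) (f g h : B) : B :=
  P f (Q g h) + P g (Q h f) + P h (Q f g) + (Q f (P g h) + Q g (P h f) + Q h (P f g))

/-- `P` is a quasi Poisson structure relative to `H`, for the action `ρ`: an invariant bivector
field such that `[P, P]` is the image of the Cartan element of `H` under the infinitesimal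
action. -/
structure IsQuasiPoisson (ρ : B →ₐ[K] A ⊗[K] B) (H : lieAlg K A ⊗[K] lieAlg K A)
    (P : B →ₗ[K] B →ₗ[K] B) : Prop where
  bivector : IsBivectorField P
  invariant : IsInvariant ρ P
  schouten_eq : ∀ f g h, schouten P P f g h = triop (fund ρ) (cartanElement H) f g h

/-- The morphism of varieties with comorphism `Φ` is a momentum mapping for `P` relative to `H`: it
is equivariant for conjugation, and `(dΦ ⊗ Id) P = (½ (L_Φ + R_Φ) ⊗ fund) H`. -/
structure IsMomentumMap (ρ : B →ₐ[K] A ⊗[K] B) (H : lieAlg K A ⊗[K] lieAlg K A)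
    (P : B →ₗ[K] B →ₗ[K] B) (Φ : A →ₐ[K] B) : Prop where
  equivariant : ∀ a, ρ (Φ a) = LinearMap.lTensor A Φ.toLinearMap (conj K A a)
  momentum : ∀ (a : A) (b : B), P (Φ a) b =
    biop ((1 / 2 : K) • (LinearMap.llcomp K A A B Φ.toLinearMap ∘ₗ (leftOp + rightOp)))
      (fund ρ) H a b

theorem rTensor_leibniz (D : Derivation K A A) (u v : A ⊗[K] A) :
    LinearMap.rTensor A (D : A →ₗ[K] A) (u * v) =
      u • LinearMap.rTensor A (D : A →ₗ[K] A) v + v • LinearMap.rTensor A (D : A →ₗ[K] A) u := by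
  induction u with
  | zero => simp
  | add u u' hu hu' => simp only [add_mul, map_add, add_smul, smul_add, hu, hu']; abel
  | tmul a b =>
    induction v with
    | zero => simp
    | add v v' hv hv' => simp only [mul_add, map_add, add_smul, smul_add, hv, hv']; abel
    | tmul c d => simp [TensorProduct.add_tmul, mul_comm]

theorem lTensor_leibniz (D : Derivation K A A) (u v : A ⊗[K] A) :
    LinearMap.lTensor A (D : A →ₗ[K] A) (u * v) =
      u • LinearMap.lTensor A (D : A →ₗ[K] A) v + v • LinearMap.lTensor A (D : A →ₗ[K] A) u := by
  induction u with
  | zero => simp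
  | add u u' hu hu' => simp only [add_mul, map_add, add_smul, smul_add, hu, hu']; abel
  | tmul a b =>
    induction v with
    | zero => simp
    | add v v' hv hv' => simp only [mul_add, map_add, add_smul, smul_add, hv, hv']; abel
    | tmul c d => simp [TensorProduct.tmul_add, mul_comm]

theorem comul_rTensor (X : lieAlg K A) (u : A ⊗[K] A) :
    Coalgebra.comul (R := K)
        (LinearMap.rTensor A ((X : Derivation K A A) : A →ₗ[K] A) u) =
      LinearMap.lTensor (A ⊗[K] A)
        (LinearMap.rTensor A ((X : Derivation K A A) : A →ₗ[K] A)) (Coalgebra.comul (R := K) u) := by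
  induction u with
  | zero => simp
  | add u v hu hv => simp only [map_add, hu, hv]
  | tmul a b =>
    have hX := X.2 a
    rw [LinearMap.rTensor_tmul, TensorProduct.comul_tmul, TensorProduct.comul_tmul]
    erw [hX]
    generalize (Coalgebra.comul (R := K) a : A ⊗[K] A) = s
    generalize (Coalgebra.comul (R := K) b : A ⊗[K] A) = t
    induction s with
    | zero => simp
    | add s s' hs hs' => simp only [map_add, TensorProduct.add_tmul, hs, hs']
    | tmul c d =>
      induction t with
      | zero => simp
      | add t t' ht ht' => simp only [map_add, TensorProduct.tmul_add, ht, ht']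
      | tmul e f => simp

theorem comul_lTensor (X : lieAlg K A) (u : A ⊗[K] A) :
    Coalgebra.comul (R := K)
        (LinearMap.lTensor A ((X : Derivation K A A) : A →ₗ[K] A) u) =
      LinearMap.lTensor (A ⊗[K] A)
        (LinearMap.lTensor A ((X : Derivation K A A) : A →ₗ[K] A)) (Coalgebra.comul (R := K) u) := by
  induction u with
  | zero => simp
  | add u v hu hv => simp only [map_add, hu, hv]
  | tmul a b =>
    have hX := X.2 b
    rw [LinearMap.lTensor_tmul, TensorProduct.comul_tmul, TensorProduct.comul_tmul]
    erw [hX]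
    generalize (Coalgebra.comul (R := K) a : A ⊗[K] A) = s
    generalize (Coalgebra.comul (R := K) b : A ⊗[K] A) = t
    induction s with
    | zero => simp
    | add s s' hs hs' => simp only [map_add, TensorProduct.add_tmul, hs, hs']
    | tmul c d =>
      induction t with
      | zero => simp
      | add t t' ht ht' => simp only [map_add, TensorProduct.tmul_add, ht, ht']
      | tmul e f => simp

/-- The inclusion of the first summand into the Lie algebra `𝔤 ⊕ 𝔤` of the product group,
`X ↦ X ⊗ Id`. -/
def inl : lieAlg K A →ₗ[K] lieAlg K (A ⊗[K] A) where
  toFun X := ⟨Derivation.mk' (LinearMap.rTensor A ((X : Derivation K A A) : A →ₗ[K] A)) (rTensor_leibniz _),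
    comul_rTensor X⟩
  map_add' X Y := by
    ext u
    simp [LinearMap.rTensor_add]
  map_smul' c X := by
    ext u
    simp [LinearMap.rTensor_smul]

/-- The inclusion of the second summand into the Lie algebra `𝔤 ⊕ 𝔤` of the product group,
`X ↦ Id ⊗ X`. -/
def inr : lieAlg K A →ₗ[K] lieAlg K (A ⊗[K] A) where
  toFun X := ⟨Derivation.mk' (LinearMap.lTensor A ((X : Derivation K A A) : A →ₗ[K] A)) (lTensor_leibniz _),
    comul_lTensor X⟩
  map_add' X Y := by
    ext u
    simp [LinearMap.lTensor_add]
  map_smul' c X := by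
    ext u
    simp [LinearMap.lTensor_smul]

/-- The 2-tensor `H + H̃` in `(𝔤 ⊕ 𝔤) ⊗ (𝔤 ⊕ 𝔤)`. -/
def doubleTensor (H : lieAlg K A ⊗[K] lieAlg K A) :
    lieAlg K (A ⊗[K] A) ⊗[K] lieAlg K (A ⊗[K] A) :=
  TensorProduct.map inl inl H + TensorProduct.map inr inr H

/-- The action `(x, y) · (q₁, q₂) = (x q₁ y⁻¹, y q₂ x⁻¹)` of `G × G` on `G × G`, on functions. -/
def doubleAct (K : Type*) [Field K] (A : Type*) [CommRing A] [HopfAlgebra K A] :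
    A ⊗[K] A →ₐ[K] (A ⊗[K] A) ⊗[K] (A ⊗[K] A) :=
  let i₁ : A →ₐ[K] A ⊗[K] A := Algebra.TensorProduct.includeLeft
  let i₂ : A →ₐ[K] A ⊗[K] A := Algebra.TensorProduct.includeRight
  let j₁ : A ⊗[K] A →ₐ[K] (A ⊗[K] A) ⊗[K] (A ⊗[K] A) := Algebra.TensorProduct.includeLeft
  let j₂ : A ⊗[K] A →ₐ[K] (A ⊗[K] A) ⊗[K] (A ⊗[K] A) := Algebra.TensorProduct.includeRight
  let x := j₁.comp i₁
  let y := j₁.comp i₂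
  let q₁ := j₂.comp i₁
  let q₂ := j₂.comp i₂
  Algebra.TensorProduct.lift (ptMul (ptMul x q₁) (ptInv y)) (ptMul (ptMul y q₂) (ptInv x))
    (fun _ _ => Commute.all _ _)

/-- The map `(mult, mult~) : (q₁, q₂) ↦ (q₁ q₂, q₁⁻¹ q₂⁻¹)`, on functions. -/
def doubleMoment (K : Type*) [Field K] (A : Type*) [CommRing A] [HopfAlgebra K A] :
    A ⊗[K] A →ₐ[K] A ⊗[K] A :=
  let q₁ : A →ₐ[K] A ⊗[K] A := Algebra.TensorProduct.includeLeft
  let q₂ : A →ₐ[K] A ⊗[K] A := Algebra.TensorProduct.includeRight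
  Algebra.TensorProduct.lift (ptMul q₁ q₂) (ptMul (ptInv q₁) (ptInv q₂))
    (fun _ _ => Commute.all _ _)

/-- The bivector field `½ (L¹ ∧ R² + R¹ ∧ L²)(H)` on `G × G`. -/
def doubleBivector (H : lieAlg K A ⊗[K] lieAlg K A) :
    A ⊗[K] A →ₗ[K] A ⊗[K] A →ₗ[K] A ⊗[K] A :=
  let L₁ : lieAlg K A →ₗ[K] A ⊗[K] A →ₗ[K] A ⊗[K] A := LinearMap.rTensorHom A ∘ₗ leftOp
  let R₁ : lieAlg K A →ₗ[K] A ⊗[K] A →ₗ[K] A ⊗[K] A := LinearMap.rTensorHom A ∘ₗ rightOp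
  let L₂ : lieAlg K A →ₗ[K] A ⊗[K] A →ₗ[K] A ⊗[K] A := LinearMap.lTensorHom A ∘ₗ leftOp
  let R₂ : lieAlg K A →ₗ[K] A ⊗[K] A →ₗ[K] A ⊗[K] A := LinearMap.lTensorHom A ∘ₗ rightOp
  (1 / 2 : K) • ((biop L₁ R₂ H - biop R₂ L₁ H) + (biop R₁ L₂ H - biop L₂ R₁ H))

end Group

end Algebraic

end QuasiPoisson

end

noncomputable section

namespace QuasiPoisson.Algebraic

section Operators

variable {K : Type*} [Field K] {L : Type*} [LieRing L] [LieAlgebra K L]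
  {B : Type*} [CommRing B] [Algebra K B]

theorem biop_tmul {L L' B B' C : Type*} [AddCommGroup L] [Module K L] [AddCommGroup L']
    [Module K L'] [CommRing B] [Algebra K B] [CommRing B'] [Algebra K B'] [CommRing C]
    [Algebra K C] (S : L →ₗ[K] B →ₗ[K] C) (T : L' →ₗ[K] B' →ₗ[K] C) (x : L) (y : L')
    (f : B) (h : B') : biop S T (x ⊗ₜ y) f h = S x f * T y h := by
  simp [biop]

theorem biop_sum {L L' B B' C ι : Type*} [AddCommGroup L] [Module K L] [AddCommGroup L']
    [Module K L'] [CommRing B] [Algebra K B] [CommRing B'] [Algebra K B'] [CommRing C]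
    [Algebra K C] (S : L →ₗ[K] B →ₗ[K] C) (T : L' →ₗ[K] B' →ₗ[K] C) (s : Finset ι)
    (x : ι → L) (y : ι → L') (f : B) (h : B') :
    biop S T (∑ i ∈ s, x i ⊗ₜ y i) f h = ∑ i ∈ s, S (x i) f * T (y i) h := by
  simp [biop]

theorem biop_add {L L' B B' C : Type*} [AddCommGroup L] [Module K L] [AddCommGroup L']
    [Module K L'] [CommRing B] [Algebra K B] [CommRing B'] [Algebra K B'] [CommRing C]
    [Algebra K C] (S : L →ₗ[K] B →ₗ[K] C) (T : L' →ₗ[K] B' →ₗ[K] C) (H H' : L ⊗[K] L')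
    (f : B) (h : B') : biop S T (H + H') f h = biop S T H f h + biop S T H' f h := by
  simp [biop]

/-- An operator on functions satisfies the Leibniz rule. -/
def IsLeibniz (X : B →ₗ[K] B) : Prop := ∀ f h, X (f * h) = X f * h + f * X h

/-- The bidifferential operator `X ∧ Y = X ⊗ Y - Y ⊗ X`. -/
def wedge (X Y : B →ₗ[K] B) : B →ₗ[K] B →ₗ[K] B :=
  (LinearMap.mul K B).compl₁₂ X Y - (LinearMap.mul K B).compl₁₂ Y X

theorem wedge_apply (X Y : B →ₗ[K] B) (f h : B) : wedge X Y f h = X f * Y h - Y f * X h := by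
  simp [wedge]

/-- The tridifferential operator `X ∧ Y ∧ Z`. -/
def wedge₃ (X Y Z : B →ₗ[K] B) (f g h : B) : B :=
  X f * (Y g * Z h - Y h * Z g) + X g * (Y h * Z f - Y f * Z h) + X h * (Y f * Z g - Y g * Z f)

theorem schouten_wedge_wedge {X Y U V : B →ₗ[K] B} (hX : IsLeibniz X) (hY : IsLeibniz Y)
    (hU : IsLeibniz U) (hV : IsLeibniz V) (f g h : B) :
    schouten (wedge X Y) (wedge U V) f g h =
      wedge₃ (X ∘ₗ U - U ∘ₗ X) Y V f g h - wedge₃ (X ∘ₗ V - V ∘ₗ X) Y U f g h -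
        wedge₃ (Y ∘ₗ U - U ∘ₗ Y) X V f g h + wedge₃ (Y ∘ₗ V - V ∘ₗ Y) X U f g h := by
  unfold IsLeibniz at *
  simp only [schouten, wedge_apply, wedge₃, map_sub, hX, hY, hU, hV, LinearMap.sub_apply,
    LinearMap.comp_apply]
  ring

theorem schouten_wedge_wedge_of_commute {X Y U V : B →ₗ[K] B} (hX : IsLeibniz X)
    (hY : IsLeibniz Y) (hU : IsLeibniz U) (hV : IsLeibniz V)
    (hXU : X ∘ₗ U = U ∘ₗ X) (hXV : X ∘ₗ V = V ∘ₗ X) (hYU : Y ∘ₗ U = U ∘ₗ Y)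
    (hYV : Y ∘ₗ V = V ∘ₗ Y) (f g h : B) : schouten (wedge X Y) (wedge U V) f g h = 0 := by
  simp [schouten_wedge_wedge hX hY hU hV, hXU, hXV, hYU, hYV, wedge₃]

theorem schouten_add_add (P P' Q Q' : B →ₗ[K] B →ₗ[K] B) (f g h : B) :
    schouten (P + P') (Q + Q') f g h = schouten P Q f g h + schouten P Q' f g h +
      schouten P' Q f g h + schouten P' Q' f g h := by
  simp only [schouten, LinearMap.add_apply, map_add]
  ring

theorem schouten_smul_smul (c d : K) (P Q : B →ₗ[K] B →ₗ[K] B) (f g h : B) :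
    schouten (c • P) (d • Q) f g h = (c * d) • schouten P Q f g h := by
  simp only [schouten, LinearMap.smul_apply, map_smul, smul_smul, smul_add, mul_comm d c]

theorem schouten_sum_sum {ι : Type*} (s : Finset ι) (P Q : ι → B →ₗ[K] B →ₗ[K] B) (f g h : B) :
    schouten (∑ i ∈ s, P i) (∑ j ∈ s, Q j) f g h =
      ∑ i ∈ s, ∑ j ∈ s, schouten (P i) (Q j) f g h := by
  simp only [schouten, LinearMap.sum_apply, map_sum, Finset.sum_add_distrib]
  congr 1
  congr 1
  · congr 1 <;> exact Finset.sum_comm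
  · exact Finset.sum_comm

end Operators

section Contraction

variable {K : Type*} [Field K] {L : Type*} [LieRing L] [LieAlgebra K L]
  {B : Type*} [CommRing B] [Algebra K B] {ι : Type*}

/-- The map `X ↦ [X, Z]`. -/
def lieRight (K : Type*) [Field K] {L : Type*} [LieRing L] [LieAlgebra K L] (Z : L) : L →ₗ[K] L :=
  -(LieModule.toEnd K L L Z)

@[simp]
theorem lieRight_apply (Z X : L) : lieRight K Z X = ⁅X, Z⁆ := by
  simp [lieRight]

/-- The tridifferential operator `∑ U xᵢ ⊗ V [yᵢ, xⱼ] ⊗ W yⱼ`. -/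
def contract (s : Finset ι) (x y : ι → L) (U V W : L →ₗ[K] B →ₗ[K] B) (f g h : B) : B :=
  ∑ i ∈ s, ∑ j ∈ s, U (x i) f * (V ⁅y i, x j⁆ g * W (y j) h)

theorem triop_cartanElement (s : Finset ι) (x y : ι → L) (S : L →ₗ[K] B →ₗ[K] B) (f g h : B) :
    triop S (cartanElement (∑ i ∈ s, x i ⊗ₜ[K] y i)) f g h =
      -((1 / 2 : K) • contract s x y S S S f g h) := by
  simp only [cartanElement, middleBracket, bracketMap, contract, triop, TensorProduct.sum_tmul,
    TensorProduct.tmul_sum, map_sum, map_neg, map_smul, LinearMap.comp_apply,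
    LinearEquiv.coe_coe, TensorProduct.assoc_tmul, LinearMap.lTensor_tmul,
    TensorProduct.assoc_symm_tmul, LinearMap.rTensor_tmul, TensorProduct.lift.tmul,
    LieHom.coe_toLinearMap, LieModule.toEnd_apply_apply, TensorProduct.map_tmul,
    LinearMap.flip_apply, LinearMap.mul'_apply]
  rw [Finset.sum_comm]

variable {s : Finset ι} {x y : ι → L}

/-- Exchanging the two factors of a symmetric 2-tensor. -/
theorem sum_symm {N : Type*} [AddCommGroup N] [Module K N]
    (hH : TensorProduct.comm K L L (∑ i ∈ s, x i ⊗ₜ[K] y i) = ∑ i ∈ s, x i ⊗ₜ[K] y i)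
    (Φ : L →ₗ[K] L →ₗ[K] N) : ∑ i ∈ s, Φ (x i) (y i) = ∑ i ∈ s, Φ (y i) (x i) := by
  have := congrArg (TensorProduct.lift Φ) hH
  simpa using this.symm

theorem sum_symm_mul
    (hH : TensorProduct.comm K L L (∑ i ∈ s, x i ⊗ₜ[K] y i) = ∑ i ∈ s, x i ⊗ₜ[K] y i)
    (S T : L →ₗ[K] B) : ∑ i ∈ s, S (x i) * T (y i) = ∑ i ∈ s, S (y i) * T (x i) := by
  simpa using sum_symm hH ((LinearMap.mul K B).compl₁₂ S T)

/-- `∑ U xᵢ ⊗ V yᵢ` is annihilated by the derivations extending the inner derivations of the Lie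
algebra. -/
def IsAdInvariant (s : Finset ι) (x y : ι → L) (U V : L →ₗ[K] B →ₗ[K] B) : Prop :=
  ∀ (X : L) (f h : B), ∑ i ∈ s, (U ⁅X, x i⁆ f * V (y i) h + U (x i) f * V ⁅X, y i⁆ h) = 0

theorem contract_swap_left {U V : L →ₗ[K] B →ₗ[K] B} (W : L →ₗ[K] B →ₗ[K] B)
    (hUV : IsAdInvariant s x y U V)
    (hH : TensorProduct.comm K L L (∑ i ∈ s, x i ⊗ₜ[K] y i) = ∑ i ∈ s, x i ⊗ₜ[K] y i)
    (f g h : B) : contract s x y U V W f g h = -contract s x y V U W g f h := by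
  unfold contract
  rw [Finset.sum_comm, Finset.sum_comm (f := fun i j => V (x i) g * _), ← Finset.sum_neg_distrib]
  refine Finset.sum_congr rfl fun j _ => ?_
  have h1 := hUV (x j) f g
  have h2 : ∑ i ∈ s, U ⁅x j, x i⁆ f * V (y i) g = ∑ i ∈ s, U ⁅x j, y i⁆ f * V (x i) g := by
    simpa using sum_symm_mul (B := B) hH (U.flip f ∘ₗ (LieModule.toEnd K L L (x j))) (V.flip g)
  rw [Finset.sum_add_distrib, h2] at h1
  have h3 : ∀ a b : L, ⁅a, b⁆ = -⁅b, a⁆ := fun a b => (lie_skew a b).symm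
  simp only [h3 (y _) (x _), map_neg, LinearMap.neg_apply]
  have h4 : ∑ i ∈ s, U (x i) f * (-V ⁅x j, y i⁆ g * W (y j) h) +
      ∑ i ∈ s, V (x i) g * (-U ⁅x j, y i⁆ f * W (y j) h) =
      -(∑ i ∈ s, U ⁅x j, y i⁆ f * V (x i) g + ∑ i ∈ s, U (x i) f * V ⁅x j, y i⁆ g) *
        W (y j) h := by
    rw [← Finset.sum_add_distrib, ← Finset.sum_add_distrib, ← Finset.sum_neg_distrib,
      Finset.sum_mul]
    exact Finset.sum_congr rfl fun i _ => by ring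
  rw [h1] at h4
  rw [eq_neg_iff_add_eq_zero, h4]
  simp

theorem contract_comm (U V W : L →ₗ[K] B →ₗ[K] B)
    (hH : TensorProduct.comm K L L (∑ i ∈ s, x i ⊗ₜ[K] y i) = ∑ i ∈ s, x i ⊗ₜ[K] y i)
    (f g h : B) : contract s x y U V W f g h = contract s y x U V W f g h := by
  unfold contract
  have h1 : ∀ j, ∑ i ∈ s, U (x i) f * (V ⁅y i, x j⁆ g * W (y j) h) =
      ∑ i ∈ s, U (y i) f * (V ⁅x i, x j⁆ g * W (y j) h) := fun j => by
    simpa using sum_symm_mul (B := B) hH (U.flip f)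
      (LinearMap.mulRight K (W (y j) h) ∘ₗ V.flip g ∘ₗ lieRight K (x j))
  rw [Finset.sum_comm, Finset.sum_congr rfl fun j _ => h1 j, Finset.sum_comm]
  refine Finset.sum_congr rfl fun i _ => ?_
  have := sum_symm_mul (B := B) hH (LinearMap.mulLeft K (U (y i) f) ∘ₗ V.flip g ∘ₗ
    (LieModule.toEnd K L L (x i))) (W.flip h)
  simpa [mul_assoc] using this

theorem contract_swap_ends (U V W : L →ₗ[K] B →ₗ[K] B)
    (hH : TensorProduct.comm K L L (∑ i ∈ s, x i ⊗ₜ[K] y i) = ∑ i ∈ s, x i ⊗ₜ[K] y i)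
    (f g h : B) : contract s x y U V W f g h = -contract s x y W V U h g f := by
  rw [contract_comm U V W hH]
  unfold contract
  rw [Finset.sum_comm, ← Finset.sum_neg_distrib]
  refine Finset.sum_congr rfl fun j _ => ?_
  rw [← Finset.sum_neg_distrib]
  refine Finset.sum_congr rfl fun i _ => ?_
  rw [← lie_skew (y j) (x i)]
  simp only [map_neg, LinearMap.neg_apply]
  ring

theorem contract_swap_right {V W : L →ₗ[K] B →ₗ[K] B} (U : L →ₗ[K] B →ₗ[K] B)
    (hWV : IsAdInvariant s x y W V)
    (hH : TensorProduct.comm K L L (∑ i ∈ s, x i ⊗ₜ[K] y i) = ∑ i ∈ s, x i ⊗ₜ[K] y i)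
    (f g h : B) : contract s x y U V W f g h = -contract s x y U W V f h g := by
  rw [contract_swap_ends U V W hH, contract_swap_left U hWV hH, contract_swap_ends U W V hH]

theorem sum_wedge₃_lie (S T : L →ₗ[K] B →ₗ[K] B)
    (hH : TensorProduct.comm K L L (∑ i ∈ s, x i ⊗ₜ[K] y i) = ∑ i ∈ s, x i ⊗ₜ[K] y i)
    (hTS : IsAdInvariant s x y T S) (f g h : B) :
    ∑ i ∈ s, ∑ j ∈ s, wedge₃ (S ⁅x i, x j⁆) (T (y i)) (T (y j)) f g h =
      -2 * (contract s x y S T T f g h + contract s x y T S T f g h +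
        contract s x y T T S f g h) := by
  have key : ∀ f g h : B, ∑ i ∈ s, ∑ j ∈ s, S ⁅x i, x j⁆ g * (T (y i) f * T (y j) h) =
      contract s x y T S T f g h := fun f g h => by
    rw [contract, Finset.sum_comm, Finset.sum_comm (f := fun i j => T (x i) f * _)]
    refine Finset.sum_congr rfl fun j _ => ?_
    have := sum_symm_mul (B := B) hH (S.flip g ∘ₗ lieRight K (x j))
      (LinearMap.mulRight K (T (y j) h) ∘ₗ T.flip f)
    simp only [LinearMap.comp_apply, lieRight_apply, LinearMap.flip_apply,
      LinearMap.mulRight_apply] at this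
    rw [this]
    exact Finset.sum_congr rfl fun i _ => by ring
  have h1 : ∑ i ∈ s, ∑ j ∈ s, wedge₃ (S ⁅x i, x j⁆) (T (y i)) (T (y j)) f g h =
      contract s x y T S T g f h - contract s x y T S T h f g + (contract s x y T S T h g f -
        contract s x y T S T f g h) + (contract s x y T S T f h g - contract s x y T S T g h f) := by
    simp only [← key, ← Finset.sum_add_distrib, ← Finset.sum_sub_distrib]
    refine Finset.sum_congr rfl fun i _ => Finset.sum_congr rfl fun j _ => ?_
    simp only [wedge₃]
    ring
  have e := fun f g h : B => contract_swap_ends (x := x) (y := y) T S T hH f g h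
  have l := fun f g h : B => contract_swap_left T hTS hH f g h
  have r := fun f g h : B => contract_swap_right T hTS hH f g h
  rw [h1]
  linear_combination -e h f g + 2 * l g f h + e h g f - e g h f + 2 * r f h g

theorem contract_sub (S T : L →ₗ[K] B →ₗ[K] B) (f g h : B) :
    contract s x y (S - T) (S - T) (S - T) f g h = contract s x y S S S f g h -
      (contract s x y S S T f g h + contract s x y S T S f g h + contract s x y T S S f g h) +
      (contract s x y S T T f g h + contract s x y T S T f g h + contract s x y T T S f g h) -
      contract s x y T T T f g h := by
  simp only [contract, ← Finset.sum_add_distrib, ← Finset.sum_sub_distrib]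
  refine Finset.sum_congr rfl fun i _ => Finset.sum_congr rfl fun j _ => ?_
  simp only [LinearMap.sub_apply]
  ring

theorem biop_sub_biop_eq_sum_wedge (S T : L →ₗ[K] B →ₗ[K] B)
    (hH : TensorProduct.comm K L L (∑ i ∈ s, x i ⊗ₜ[K] y i) = ∑ i ∈ s, x i ⊗ₜ[K] y i) :
    biop S T (∑ i ∈ s, x i ⊗ₜ[K] y i) - biop T S (∑ i ∈ s, x i ⊗ₜ[K] y i) =
      ∑ i ∈ s, wedge (S (x i)) (T (y i)) := by
  ext f h
  simp only [LinearMap.sub_apply, biop_sum, LinearMap.sum_apply, wedge_apply,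
    Finset.sum_sub_distrib]
  congr 1
  have := sum_symm_mul (B := B) hH (T.flip f) (S.flip h)
  simpa using this

theorem IsAdInvariant.symm {U V : L →ₗ[K] B →ₗ[K] B} (hUV : IsAdInvariant s x y U V) :
    IsAdInvariant s y x V U := by
  intro X f h
  rw [← hUV X h f]
  exact Finset.sum_congr rfl fun i _ => by ring

/-- The Schouten square of `(S ∧ T)(H)`, for commuting actions `S` and `T` of a Lie algebra, from
the left and from the right. -/
theorem schouten_biop_sub_biop [CharZero K] {S T : L →ₗ[K] B →ₗ[K] B}
    (hS : ∀ X, IsLeibniz (S X)) (hT : ∀ X, IsLeibniz (T X))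
    (hSS : ∀ X Y, S X ∘ₗ S Y - S Y ∘ₗ S X = S ⁅X, Y⁆)
    (hTT : ∀ X Y, T X ∘ₗ T Y - T Y ∘ₗ T X = -T ⁅X, Y⁆)
    (hST : ∀ X Y, S X ∘ₗ T Y = T Y ∘ₗ S X)
    (hH : TensorProduct.comm K L L (∑ i ∈ s, x i ⊗ₜ[K] y i) = ∑ i ∈ s, x i ⊗ₜ[K] y i)
    (hinv : IsAdInvariant s x y T S) (f g h : B) :
    schouten (biop S T (∑ i ∈ s, x i ⊗ₜ[K] y i) - biop T S (∑ i ∈ s, x i ⊗ₜ[K] y i))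
        (biop S T (∑ i ∈ s, x i ⊗ₜ[K] y i) - biop T S (∑ i ∈ s, x i ⊗ₜ[K] y i)) f g h =
      4 * triop (S - T) (cartanElement (∑ i ∈ s, x i ⊗ₜ[K] y i)) f g h +
        2 * contract s x y S S S f g h - 2 * contract s x y T T T f g h := by
  have hH' : TensorProduct.comm K L L (∑ i ∈ s, y i ⊗ₜ[K] x i) = ∑ i ∈ s, y i ⊗ₜ[K] x i := by
    simp only [map_sum, TensorProduct.comm_tmul] at hH ⊢
    exact hH.symm
  rw [biop_sub_biop_eq_sum_wedge S T hH, schouten_sum_sum]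
  have h1 : ∀ i j, schouten (wedge (S (x i)) (T (y i))) (wedge (S (x j)) (T (y j))) f g h =
      wedge₃ (S ⁅x i, x j⁆) (T (y i)) (T (y j)) f g h -
        wedge₃ (T ⁅y i, y j⁆) (S (x i)) (S (x j)) f g h := by
    intro i j
    rw [schouten_wedge_wedge (hS _) (hT _) (hS _) (hT _), hSS, hTT, hST, hST]
    simp only [wedge₃, LinearMap.sub_apply, LinearMap.neg_apply]
    ring
  simp only [h1, Finset.sum_sub_distrib]
  rw [sum_wedge₃_lie S T hH hinv, sum_wedge₃_lie T S hH' hinv.symm, triop_cartanElement,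
    contract_sub, ← contract_comm T S S hH, ← contract_comm S T S hH, ← contract_comm S S T hH]
  have h2 : ∀ u : B, 4 * -((1 / 2 : K) • u) = -2 * u := fun u => by
    have : (4 : B) * ((1 / 2 : K) • u) = ((4 : K) * (1 / 2)) • u := by
      rw [mul_smul, Algebra.smul_def (4 : K), map_ofNat]
    rw [mul_neg, this, show (4 : K) * (1 / 2) = 2 by norm_num, Algebra.smul_def, map_ofNat]
    ring
  rw [h2]
  ring

/-- The invariant 3-tensor of an `Ad`-invariant 2-tensor has the same image under left and right
invariant vector fields. -/
theorem contract_eq_of_biop_eq {S T : L →ₗ[K] B →ₗ[K] B}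
    (hSS : ∀ X Y, S X ∘ₗ S Y - S Y ∘ₗ S X = S ⁅X, Y⁆)
    (hTT : ∀ X Y, T X ∘ₗ T Y - T Y ∘ₗ T X = -T ⁅X, Y⁆)
    (hST : ∀ X Y, S X ∘ₗ T Y = T Y ∘ₗ S X)
    (hbi : ∀ f h, biop S S (∑ i ∈ s, x i ⊗ₜ[K] y i) f h = biop T T (∑ i ∈ s, x i ⊗ₜ[K] y i) f h)
    (f g h : B) : contract s x y S S S f g h = contract s x y T T T f g h := by
  have hST' : ∀ X Y a, S X (T Y a) = T Y (S X a) := fun X Y a => LinearMap.congr_fun (hST X Y) a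
  have hbi' : ∀ f h, ∑ i ∈ s, S (x i) f * S (y i) h = ∑ i ∈ s, T (x i) f * T (y i) h := by
    simpa only [biop_sum] using hbi
  have e1 : ∑ i ∈ s, ∑ j ∈ s, S (x i) f * (S (y i) (S (x j) g) * S (y j) h) =
      ∑ i ∈ s, ∑ j ∈ s, T (x i) f * (T (x j) (T (y i) g) * T (y j) h) := by
    calc _ = ∑ j ∈ s, (∑ i ∈ s, S (x i) f * S (y i) (S (x j) g)) * S (y j) h := by
          rw [Finset.sum_comm]
          simp only [Finset.sum_mul, mul_assoc]
      _ = ∑ j ∈ s, (∑ i ∈ s, T (x i) f * T (y i) (S (x j) g)) * S (y j) h := by simp only [hbi']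
      _ = ∑ i ∈ s, T (x i) f * ∑ j ∈ s, S (x j) (T (y i) g) * S (y j) h := by
          simp only [Finset.sum_mul, Finset.mul_sum, mul_assoc, hST']
          rw [Finset.sum_comm]
      _ = _ := by simp only [hbi', Finset.mul_sum]
  have e2 : ∑ i ∈ s, ∑ j ∈ s, S (x i) f * (S (x j) (S (y i) g) * S (y j) h) =
      ∑ i ∈ s, ∑ j ∈ s, T (x i) f * (T (y i) (T (x j) g) * T (y j) h) := by
    calc _ = ∑ i ∈ s, S (x i) f * ∑ j ∈ s, S (x j) (S (y i) g) * S (y j) h := by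
          simp only [Finset.mul_sum]
      _ = ∑ i ∈ s, S (x i) f * ∑ j ∈ s, T (x j) (S (y i) g) * T (y j) h := by simp only [hbi']
      _ = ∑ j ∈ s, (∑ i ∈ s, S (x i) f * S (y i) (T (x j) g)) * T (y j) h := by
          simp only [Finset.sum_mul, Finset.mul_sum, mul_assoc, hST']
          rw [Finset.sum_comm]
      _ = _ := by
          simp only [hbi', Finset.sum_mul, mul_assoc]
          rw [Finset.sum_comm]
  have hSS' : ∀ X Y, S ⁅X, Y⁆ g = S X (S Y g) - S Y (S X g) := fun X Y => by
    rw [← hSS]; rfl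
  have hTT' : ∀ X Y, T ⁅X, Y⁆ g = T Y (T X g) - T X (T Y g) := fun X Y => by
    rw [← neg_neg (T ⁅X, Y⁆), ← hTT]; simp
  simp only [contract, hSS', hTT', sub_mul, mul_sub, Finset.sum_sub_distrib, e1, e2]

end Contraction

section Double

variable {K : Type*} [Field K] {L : Type*} [LieRing L] [LieAlgebra K L]
  {B : Type*} [CommRing B] [Algebra K B]

/-- Infinitesimal invariance of a 2-tensor, tested on the operators `U` and `V`. -/
def IsLieInvariant (U V : L →ₗ[K] B →ₗ[K] B) (H : L ⊗[K] L) : Prop :=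
  ∀ (X : L) (f h : B), biop (U ∘ₗ LieModule.toEnd K L L X) V H f h +
    biop U (V ∘ₗ LieModule.toEnd K L L X) H f h = 0

/-- The Schouten square of `½ (L¹ ∧ R² + R¹ ∧ L²)(H)`. -/
theorem schouten_double [CharZero K] {L₁ R₁ L₂ R₂ : L →ₗ[K] B →ₗ[K] B} {H : L ⊗[K] L}
    (hL₁ : ∀ X, IsLeibniz (L₁ X)) (hR₁ : ∀ X, IsLeibniz (R₁ X))
    (hL₂ : ∀ X, IsLeibniz (L₂ X)) (hR₂ : ∀ X, IsLeibniz (R₂ X))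
    (hLL₁ : ∀ X Y, L₁ X ∘ₗ L₁ Y - L₁ Y ∘ₗ L₁ X = L₁ ⁅X, Y⁆)
    (hRR₁ : ∀ X Y, R₁ X ∘ₗ R₁ Y - R₁ Y ∘ₗ R₁ X = -R₁ ⁅X, Y⁆)
    (hLL₂ : ∀ X Y, L₂ X ∘ₗ L₂ Y - L₂ Y ∘ₗ L₂ X = L₂ ⁅X, Y⁆)
    (hRR₂ : ∀ X Y, R₂ X ∘ₗ R₂ Y - R₂ Y ∘ₗ R₂ X = -R₂ ⁅X, Y⁆)
    (hLR₁ : ∀ X Y, L₁ X ∘ₗ R₁ Y = R₁ Y ∘ₗ L₁ X) (hLR₂ : ∀ X Y, L₂ X ∘ₗ R₂ Y = R₂ Y ∘ₗ L₂ X)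
    (hL₁L₂ : ∀ X Y, L₁ X ∘ₗ L₂ Y = L₂ Y ∘ₗ L₁ X) (hL₁R₂ : ∀ X Y, L₁ X ∘ₗ R₂ Y = R₂ Y ∘ₗ L₁ X)
    (hR₁L₂ : ∀ X Y, R₁ X ∘ₗ L₂ Y = L₂ Y ∘ₗ R₁ X) (hR₁R₂ : ∀ X Y, R₁ X ∘ₗ R₂ Y = R₂ Y ∘ₗ R₁ X)
    (hH : TensorProduct.comm K L L H = H)
    (hR₂L₁H : IsLieInvariant R₂ L₁ H) (hR₁L₂H : IsLieInvariant R₁ L₂ H)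
    (hbi₁ : ∀ f h, biop L₁ L₁ H f h = biop R₁ R₁ H f h)
    (hbi₂ : ∀ f h, biop L₂ L₂ H f h = biop R₂ R₂ H f h) (f g h : B) :
    schouten
        ((1 / 2 : K) • ((biop L₁ R₂ H - biop R₂ L₁ H) + (biop R₁ L₂ H - biop L₂ R₁ H)))
        ((1 / 2 : K) • ((biop L₁ R₂ H - biop R₂ L₁ H) + (biop R₁ L₂ H - biop L₂ R₁ H))) f g h =
      triop (L₂ - R₁) (cartanElement H) f g h + triop (L₁ - R₂) (cartanElement H) f g h := by
  obtain ⟨s, rfl⟩ := TensorProduct.exists_finset H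
  have inv : ∀ {U V : L →ₗ[K] B →ₗ[K] B}, IsLieInvariant U V (∑ i ∈ s, i.1 ⊗ₜ[K] i.2) →
      IsAdInvariant s Prod.fst Prod.snd U V := fun hUV X f h => by
    rw [← hUV X f h, biop_sum, biop_sum, ← Finset.sum_add_distrib]
    rfl
  have cross : ∀ f g h, schouten
      (biop L₁ R₂ (∑ i ∈ s, i.1 ⊗ₜ[K] i.2) - biop R₂ L₁ (∑ i ∈ s, i.1 ⊗ₜ[K] i.2))
      (biop R₁ L₂ (∑ i ∈ s, i.1 ⊗ₜ[K] i.2) - biop L₂ R₁ (∑ i ∈ s, i.1 ⊗ₜ[K] i.2)) f g h = 0 := by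
    intro f g h
    rw [biop_sub_biop_eq_sum_wedge L₁ R₂ hH, biop_sub_biop_eq_sum_wedge R₁ L₂ hH, schouten_sum_sum]
    refine Finset.sum_eq_zero fun i _ => Finset.sum_eq_zero fun j _ => ?_
    exact schouten_wedge_wedge_of_commute (hL₁ _) (hR₂ _) (hR₁ _) (hL₂ _) (hLR₁ _ _)
      (hL₁L₂ _ _) (hR₁R₂ _ _).symm (hLR₂ _ _).symm f g h
  have comm : ∀ P Q : B →ₗ[K] B →ₗ[K] B, schouten P Q f g h = schouten Q P f g h := fun P Q => by
    simp only [schouten]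
    ring
  have swap : ∀ P Q : B →ₗ[K] B →ₗ[K] B,
      schouten (P - Q) (P - Q) f g h = schouten (Q - P) (Q - P) f g h := fun P Q => by
    simp only [schouten, LinearMap.sub_apply, map_sub]
    ring
  rw [schouten_smul_smul, schouten_add_add, cross,
    comm (biop R₁ L₂ _ - _) (biop L₁ R₂ _ - _), cross,
    swap (biop R₁ L₂ _) (biop L₂ R₁ _),
    schouten_biop_sub_biop hL₁ hR₂ hLL₁ hRR₂ hL₁R₂ hH (inv hR₂L₁H),
    schouten_biop_sub_biop hL₂ hR₁ hLL₂ hRR₁ (fun X Y => (hR₁L₂ Y X).symm) hH (inv hR₁L₂H),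
    contract_eq_of_biop_eq hLL₁ hRR₁ hLR₁ hbi₁, contract_eq_of_biop_eq hLL₂ hRR₂ hLR₂ hbi₂]
  have h4 : ∀ u : B, ((1 / 2 : K) * (1 / 2)) • (4 * u) = u := fun u => by
    rw [show (4 : B) * u = (4 : K) • u by rw [Algebra.smul_def, map_ofNat], smul_smul]
    norm_num
  refine Eq.trans ?_ (h4 _)
  congr 1
  ring

end Double

end QuasiPoisson.Algebraic

end

noncomputable section

namespace QuasiPoisson.Algebraic

open WithConv

section Convolution

variable {K : Type*} [Field K] {A : Type*} [CommRing A] [HopfAlgebra K A]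
  {R R' : Type*} [CommRing R] [Algebra K R] [CommRing R'] [Algebra K R']

/-- A point of the group, as a unit of the convolution algebra. -/
def pt (f : A →ₐ[K] R) : (WithConv (A →ₗ[K] R))ˣ where
  val := toConv f.toLinearMap
  inv := toConv (ptInv f).toLinearMap
  val_inv := by
    have h := LinearMap.algHom_comp_convMul_distrib f (toConv (LinearMap.id (R := K) (M := A)))
      (toConv (HopfAlgebra.antipode K (A := A)))
    rw [LinearMap.id_mul_antipode] at h
    refine (congrArg toConv h).symm.trans ?_
    ext a
    simp
  inv_val := by
    have h := LinearMap.algHom_comp_convMul_distrib f (toConv (HopfAlgebra.antipode K (A := A)))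
      (toConv (LinearMap.id (R := K) (M := A)))
    rw [LinearMap.antipode_mul_id] at h
    refine (congrArg toConv h).symm.trans ?_
    ext a
    simp

@[simp]
theorem pt_apply (f : A →ₐ[K] R) (a : A) : (pt f : WithConv (A →ₗ[K] R)) a = f a := rfl

theorem pt_injective : Function.Injective (pt : (A →ₐ[K] R) → (WithConv (A →ₗ[K] R))ˣ) := by
  intro f g h
  ext a
  rw [← pt_apply f, h, pt_apply]

@[simp]
theorem pt_ptMul (f g : A →ₐ[K] R) : pt (ptMul f g) = pt f * pt g := by
  ext a
  change _ = ((toConv f * toConv g : WithConv (A →ₐ[K] R))) a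
  rw [AlgHom.convMul_apply]
  rfl

@[simp]
theorem pt_ptInv (f : A →ₐ[K] R) : pt (ptInv f) = (pt f)⁻¹ := by
  ext a
  rfl

/-- Composition with a linear map, on the convolution algebra. -/
def post (D : R →ₗ[K] R') : WithConv (A →ₗ[K] R) →ₗ[K] WithConv (A →ₗ[K] R') where
  toFun f := toConv (D ∘ₗ f.ofConv)
  map_add' f g := by
    ext a
    simp
  map_smul' c f := by
    ext a
    simp

@[simp]
theorem post_apply (D : R →ₗ[K] R') (f : WithConv (A →ₗ[K] R)) (a : A) :
    post D f a = D (f a) := rfl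

/-- A derivation along a homomorphism of algebras. -/
def IsDerivAlong (ψ : R →ₐ[K] R') (D : R →ₗ[K] R') : Prop :=
  ∀ f h, D (f * h) = ψ f * D h + D f * ψ h

theorem post_algHom_mul (ψ : R →ₐ[K] R') (f g : WithConv (A →ₗ[K] R)) :
    post ψ.toLinearMap (f * g) = post ψ.toLinearMap f * post ψ.toLinearMap g := by
  apply WithConv.ext
  exact LinearMap.algHom_comp_convMul_distrib ψ f g

theorem post_pt (ψ : R →ₐ[K] R') (f : A →ₐ[K] R) :
    post ψ.toLinearMap (pt f : WithConv (A →ₗ[K] R)) = pt (ψ.comp f) := rfl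

theorem post_pt_inv (ψ : R →ₐ[K] R') (f : A →ₐ[K] R) :
    post ψ.toLinearMap (pt f)⁻¹.val = (pt (ψ.comp f))⁻¹.val := rfl

theorem IsDerivAlong.post_mul {ψ : R →ₐ[K] R'} {D : R →ₗ[K] R'} (hD : IsDerivAlong ψ D)
    (f g : WithConv (A →ₗ[K] R)) :
    post D (f * g) = post ψ.toLinearMap f * post D g + post D f * post ψ.toLinearMap g := by
  ext a
  let r := Coalgebra.Repr.arbitrary K a
  simp only [post_apply, WithConv.ofConv_add, LinearMap.add_apply, r.convMul_apply, map_sum,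
    ← Finset.sum_add_distrib]
  exact Finset.sum_congr rfl fun i _ => hD _ _

theorem IsDerivAlong.map_one {ψ : R →ₐ[K] R'} {D : R →ₗ[K] R'} (hD : IsDerivAlong ψ D) :
    D 1 = 0 := by
  have h := hD 1 1
  simp only [mul_one, _root_.map_one, one_mul] at h
  simpa using h

theorem IsDerivAlong.map_algebraMap {ψ : R →ₐ[K] R'} {D : R →ₗ[K] R'} (hD : IsDerivAlong ψ D)
    (c : K) : D (algebraMap K R c) = 0 := by
  rw [Algebra.algebraMap_eq_smul_one, map_smul, hD.map_one, smul_zero]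

theorem IsDerivAlong.post_one {ψ : R →ₐ[K] R'} {D : R →ₗ[K] R'} (hD : IsDerivAlong ψ D) :
    post D (1 : WithConv (A →ₗ[K] R)) = 0 := by
  ext a
  simp [hD.map_algebraMap]

theorem IsDerivAlong.post_inv {ψ : R →ₐ[K] R'} {D : R →ₗ[K] R'} (hD : IsDerivAlong ψ D)
    (f : A →ₐ[K] R) :
    post D ((pt f)⁻¹ : (WithConv (A →ₗ[K] R))ˣ).val =
      -((pt (ψ.comp f))⁻¹.val * post D (pt f : WithConv (A →ₗ[K] R)) *
        (pt (ψ.comp f))⁻¹.val) := by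
  have h := hD.post_mul (pt f : WithConv (A →ₗ[K] R)) (pt f)⁻¹.val
  rw [Units.mul_inv, hD.post_one, post_pt, post_pt_inv] at h
  have h2 := congrArg (fun u => (pt (ψ.comp f))⁻¹.val * u) h
  simp only [mul_zero, mul_add, Units.inv_mul_cancel_left] at h2
  rw [eq_neg_iff_add_eq_zero, mul_assoc]
  exact h2.symm

theorem IsDerivAlong.comp_algHom {R'' : Type*} [CommRing R''] [Algebra K R''] {ψ : R →ₐ[K] R'}
    {D : R →ₗ[K] R'} (hD : IsDerivAlong ψ D) (χ : R'' →ₐ[K] R) :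
    IsDerivAlong (ψ.comp χ) (D ∘ₗ χ.toLinearMap) := fun f h => by
  simp [hD (χ f) (χ h)]

theorem IsDerivAlong.algHom_comp {R'' : Type*} [CommRing R''] [Algebra K R''] {ψ : R →ₐ[K] R'}
    {D : R →ₗ[K] R'} (hD : IsDerivAlong ψ D) (χ : R' →ₐ[K] R'') :
    IsDerivAlong (χ.comp ψ) (χ.toLinearMap ∘ₗ D) := fun f h => by
  simp [hD f h]

theorem IsDerivAlong.neg {ψ : R →ₐ[K] R'} {D : R →ₗ[K] R'} (hD : IsDerivAlong ψ D) :
    IsDerivAlong ψ (-D) := fun f h => by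
  simp only [LinearMap.neg_apply, hD f h]
  ring

theorem IsDerivAlong.add {ψ : R →ₐ[K] R'} {D D' : R →ₗ[K] R'} (hD : IsDerivAlong ψ D)
    (hD' : IsDerivAlong ψ D') : IsDerivAlong ψ (D + D') := fun f h => by
  simp only [LinearMap.add_apply, hD f h, hD' f h]
  ring

theorem IsDerivAlong.sub {ψ : R →ₐ[K] R'} {D D' : R →ₗ[K] R'} (hD : IsDerivAlong ψ D)
    (hD' : IsDerivAlong ψ D') : IsDerivAlong ψ (D - D') := fun f h => by
  simp only [LinearMap.sub_apply, hD f h, hD' f h]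
  ring

theorem IsDerivAlong.smul {ψ : R →ₐ[K] R'} {D : R →ₗ[K] R'} (hD : IsDerivAlong ψ D) (c : K) :
    IsDerivAlong ψ (c • D) := fun f h => by
  simp only [LinearMap.smul_apply, hD f h, smul_add, Algebra.mul_smul_comm, Algebra.smul_mul_assoc]

theorem IsDerivAlong.isLeibniz {D : R →ₗ[K] R} (hD : IsDerivAlong (AlgHom.id K R) D) :
    IsLeibniz D := fun f h => by
  rw [hD f h, AlgHom.id_apply, AlgHom.id_apply, add_comm]

/-- The tangent vector at the identity of a left invariant vector field, in the convolution
algebra. -/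
def tan (R : Type*) [CommRing R] [Algebra K R] : lieAlg K A →ₗ[K] WithConv (A →ₗ[K] R) where
  toFun X := toConv (Algebra.linearMap K R ∘ₗ tangent X)
  map_add' X Y := by
    ext a
    simp
  map_smul' c X := by
    ext a
    simp [← Algebra.smul_def]

theorem tan_apply (X : lieAlg K A) (a : A) :
    tan R X a = algebraMap K R (tangent X a) := rfl

theorem post_tan (ψ : R →ₐ[K] R') (X : lieAlg K A) :
    post ψ.toLinearMap (tan R X) = tan R' X := by
  ext a
  simp [tan_apply]

theorem IsDerivAlong.post_tan {ψ : R →ₐ[K] R'} {D : R →ₗ[K] R'} (hD : IsDerivAlong ψ D)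
    (X : lieAlg K A) : post D (tan R X) = 0 := by
  ext a
  simp [tan_apply, hD.map_algebraMap]

theorem tangent_mul (X : lieAlg K A) (a b : A) :
    tangent X (a * b) = Coalgebra.counit (R := K) a * tangent X b +
      tangent X a * Coalgebra.counit (R := K) b := by
  simp [tangent, mul_comm]

theorem isDerivAlong_tangent (X : lieAlg K A) :
    IsDerivAlong (Bialgebra.counitAlgHom K A) (tangent X) := fun a b => tangent_mul X a b

theorem toConv_leftOp (X : lieAlg K A) :
    toConv (leftOp X) = (pt (AlgHom.id K A) : WithConv (A →ₗ[K] A)) * tan A X := by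
  ext a
  have h2 := congrArg (TensorProduct.rid K A ∘
    LinearMap.lTensor A (Coalgebra.counit (R := K) (A := A))) (X.2 a)
  simp only [Function.comp_apply, Coalgebra.lTensor_counit_comul, TensorProduct.rid_tmul,
    one_smul] at h2
  refine h2.trans ?_
  rw [(Coalgebra.Repr.arbitrary K a).convMul_apply]
  conv_lhs => rw [← (Coalgebra.Repr.arbitrary K a).eq]
  simp only [map_sum, LinearMap.lTensor_tmul, TensorProduct.rid_tmul]
  refine Finset.sum_congr rfl fun i _ => ?_
  rw [tan_apply, mul_comm, ← Algebra.smul_def]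
  rfl

theorem toConv_rightOp (X : lieAlg K A) :
    toConv (rightOp X) = tan A X * (pt (AlgHom.id K A) : WithConv (A →ₗ[K] A)) := by
  ext a
  rw [(Coalgebra.Repr.arbitrary K a).convMul_apply]
  change TensorProduct.lid K A (LinearMap.rTensor A (tangent X) (Coalgebra.comul (R := K) a)) = _
  conv_lhs => rw [← (Coalgebra.Repr.arbitrary K a).eq]
  simp only [map_sum, LinearMap.rTensor_tmul, TensorProduct.lid_tmul]
  refine Finset.sum_congr rfl fun i _ => ?_
  rw [tan_apply, ← Algebra.smul_def]
  rfl

theorem isDerivAlong_leftOp (X : lieAlg K A) : IsDerivAlong (AlgHom.id K A) (leftOp X) :=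
  fun f h => by simp [leftOp, mul_comm]

/-- Evaluation of the first variable at the identity. -/
def counitLeft (K A B : Type*) [Field K] [CommRing A] [HopfAlgebra K A] [CommRing B] [Algebra K B] :
    A ⊗[K] B →ₐ[K] B :=
  Algebra.TensorProduct.lift ((Algebra.ofId K B).comp (Bialgebra.counitAlgHom K A))
    (AlgHom.id K B) (fun _ _ => Commute.all _ _)

/-- The derivative in the first variable at the identity. -/
def tangentLeft (B : Type*) [CommRing B] [Algebra K B] (X : lieAlg K A) : A ⊗[K] B →ₗ[K] B :=
  (TensorProduct.lid K B).toLinearMap ∘ₗ LinearMap.rTensor B (tangent X)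

/-- Evaluation of the second variable at the identity. -/
def counitRight (K A B : Type*) [Field K] [CommRing A] [HopfAlgebra K A] [CommRing B]
    [Algebra K B] : B ⊗[K] A →ₐ[K] B :=
  Algebra.TensorProduct.lift (AlgHom.id K B) ((Algebra.ofId K B).comp (Bialgebra.counitAlgHom K A))
    (fun _ _ => Commute.all _ _)

/-- The derivative in the second variable at the identity. -/
def tangentRight (B : Type*) [CommRing B] [Algebra K B] (X : lieAlg K A) : B ⊗[K] A →ₗ[K] B :=
  (TensorProduct.rid K B).toLinearMap ∘ₗ LinearMap.lTensor B (tangent X)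

theorem isDerivAlong_of_tmul {B C : Type*} [CommRing B] [Algebra K B] [CommRing C] [Algebra K C]
    {ψ : B ⊗[K] C →ₐ[K] R} {D : B ⊗[K] C →ₗ[K] R}
    (h : ∀ b c b' c', D ((b ⊗ₜ c) * (b' ⊗ₜ c')) =
      ψ (b ⊗ₜ c) * D (b' ⊗ₜ c') + D (b ⊗ₜ c) * ψ (b' ⊗ₜ c')) : IsDerivAlong ψ D := by
  intro u v
  induction u with
  | zero => simp
  | add u u' hu hu' =>
    simp only [add_mul, map_add, hu, hu']
    ring
  | tmul b c =>
    induction v with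
    | zero => simp
    | add v v' hv hv' =>
      simp only [mul_add, map_add, hv, hv']
      ring
    | tmul b' c' => exact h b c b' c'

theorem isDerivAlong_tangentLeft (X : lieAlg K A) :
    IsDerivAlong (counitLeft K A R) (tangentLeft R X) := by
  refine isDerivAlong_of_tmul fun a b a' b' => ?_
  simp only [tangentLeft, counitLeft, Algebra.TensorProduct.tmul_mul_tmul, LinearMap.comp_apply,
    LinearMap.rTensor_tmul, LinearEquiv.coe_coe, TensorProduct.lid_tmul, tangent_mul, map_add,
    Algebra.TensorProduct.lift_tmul, AlgHom.comp_apply, AlgHom.id_apply, Algebra.ofId_apply,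
    Bialgebra.counitAlgHom_apply, Algebra.smul_def, map_mul]
  ring

theorem isDerivAlong_tangentRight (X : lieAlg K A) :
    IsDerivAlong (counitRight K A R) (tangentRight R X) := by
  refine isDerivAlong_of_tmul fun a b a' b' => ?_
  simp only [tangentRight, counitRight, Algebra.TensorProduct.tmul_mul_tmul, LinearMap.comp_apply,
    LinearMap.lTensor_tmul, LinearEquiv.coe_coe, TensorProduct.rid_tmul, tangent_mul, map_add,
    Algebra.TensorProduct.lift_tmul, AlgHom.comp_apply, AlgHom.id_apply, Algebra.ofId_apply,
    Bialgebra.counitAlgHom_apply, Algebra.smul_def, map_mul]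
  ring

theorem isDerivAlong_rightOp (X : lieAlg K A) : IsDerivAlong (AlgHom.id K A) (rightOp X) := by
  have h := (isDerivAlong_tangentLeft (R := A) X).comp_algHom (Bialgebra.comulAlgHom K A)
  have h2 : (counitLeft K A A).comp (Bialgebra.comulAlgHom K A) = AlgHom.id K A := by
    ext a
    have := Coalgebra.rTensor_counit_comul (R := K) a
    have h3 : ∀ u, counitLeft K A A u =
        TensorProduct.lid K A (LinearMap.rTensor A (Coalgebra.counit (R := K)) u) := fun u => by
      induction u with
      | zero => simp
      | add u v hu hv => simp only [map_add, hu, hv]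
      | tmul a b => simp [counitLeft, Algebra.smul_def, Algebra.ofId_apply]
    simp [h3]
  rw [h2] at h
  exact h

theorem toConv_adOp (X : lieAlg K A) :
    toConv (adOp X) = (pt (AlgHom.id K A) : WithConv (A →ₗ[K] A)) * tan A X *
      (pt (AlgHom.id K A))⁻¹.val := by
  have hD := isDerivAlong_tangentRight (R := A) X
  have h : toConv (adOp X) =
      post (tangentRight A X) (pt (conj K A) : WithConv (A →ₗ[K] A ⊗[K] A)) := rfl
  have h1 : post (tangentRight A X)
      (pt (Algebra.TensorProduct.includeLeft : A →ₐ[K] A ⊗[K] A) : WithConv (A →ₗ[K] A ⊗[K] A)) =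
      0 := by
    ext a
    simpa [tangentRight] using Or.inl (isDerivAlong_tangent X).map_one
  have h2 : post (tangentRight A X)
      (pt (Algebra.TensorProduct.includeRight : A →ₐ[K] A ⊗[K] A) : WithConv (A →ₗ[K] A ⊗[K] A)) =
      tan A X := by
    ext a
    simp [tangentRight, tan_apply, Algebra.smul_def]
  have h3 : (counitRight K A A).comp Algebra.TensorProduct.includeLeft = AlgHom.id K A := by
    ext a
    simp [counitRight]
  have h4 : (pt ((counitRight K A A).comp Algebra.TensorProduct.includeRight) :
      WithConv (A →ₗ[K] A)) = 1 := by
    ext a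
    simp [counitRight, Algebra.ofId_apply]
  rw [h]
  simp only [conj, pt_ptMul, pt_ptInv, Units.val_mul, hD.post_mul, hD.post_inv, h1, h2, post_pt,
    post_pt_inv, h3, post_algHom_mul, h4]
  simp

theorem tan_lie (X Y : lieAlg K A) :
    tan R ⁅X, Y⁆ = tan R X * tan R Y - tan R Y * tan R X := by
  have key : ∀ X Y : lieAlg K A, post ((Algebra.ofId K R).comp
      (Bialgebra.counitAlgHom K A)).toLinearMap (toConv (leftOp X ∘ₗ leftOp Y)) =
        tan R X * tan R Y := by
    intro X Y
    have h : (toConv (leftOp X ∘ₗ leftOp Y) : WithConv (A →ₗ[K] A)) =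
        post (leftOp X) (toConv (leftOp Y)) := rfl
    rw [h, toConv_leftOp, (isDerivAlong_leftOp X).post_mul, (isDerivAlong_leftOp X).post_tan,
      mul_zero, zero_add]
    have h2 : post (leftOp X) (pt (AlgHom.id K A) : WithConv (A →ₗ[K] A)) = toConv (leftOp X) := rfl
    rw [h2, toConv_leftOp, post_algHom_mul, post_algHom_mul, post_tan, post_tan, post_tan, post_pt]
    have h3 : (pt (((Algebra.ofId K R).comp (Bialgebra.counitAlgHom K A)).comp
        (AlgHom.id K A)) : WithConv (A →ₗ[K] R)) = 1 := rfl
    rw [h3, one_mul]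
  rw [← key, ← key, ← map_sub]
  ext a
  simp [tan_apply, tangent, leftOp, Derivation.commutator_apply, Algebra.ofId_apply]

end Convolution

end QuasiPoisson.Algebraic

end

noncomputable section

namespace QuasiPoisson.Algebraic

open WithConv

section Pairing

variable {K : Type*} [Field K] {A : Type*} [CommRing A] [HopfAlgebra K A]
  {R : Type*} [CommRing R] [Algebra K R] {ι κ : Type*}

/-- The equality `∑ Uᵢ ⊗ Vᵢ = ∑ U'ⱼ ⊗ V'ⱼ` of bilinear maps. -/
def PairEq (s : Finset ι) (U V : ι → WithConv (A →ₗ[K] R)) (t : Finset κ)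
    (U' V' : κ → WithConv (A →ₗ[K] R)) : Prop :=
  ∀ a b, ∑ i ∈ s, U i a * V i b = ∑ j ∈ t, U' j a * V' j b

variable {s : Finset ι} {U V : ι → WithConv (A →ₗ[K] R)} {t : Finset κ}
  {U' V' : κ → WithConv (A →ₗ[K] R)}

theorem PairEq.swap (h : PairEq s U V t U' V') : PairEq s V U t V' U' := fun a b => by
  simpa only [mul_comm] using h b a

theorem PairEq.mul_left (h : PairEq s U V t U' V') (u : WithConv (A →ₗ[K] R)) :
    PairEq s (fun i => u * U i) V t (fun j => u * U' j) V' := fun a b => by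
  simp only [(Coalgebra.Repr.arbitrary K a).convMul_apply, Finset.sum_mul]
  rw [Finset.sum_comm, Finset.sum_comm (s := t)]
  refine Finset.sum_congr rfl fun k _ => ?_
  simp only [mul_assoc, ← Finset.mul_sum]
  rw [h]

theorem PairEq.mul_right (h : PairEq s U V t U' V') (u : WithConv (A →ₗ[K] R)) :
    PairEq s (fun i => U i * u) V t (fun j => U' j * u) V' := fun a b => by
  simp only [(Coalgebra.Repr.arbitrary K a).convMul_apply, Finset.sum_mul]
  rw [Finset.sum_comm, Finset.sum_comm (s := t)]
  refine Finset.sum_congr rfl fun k _ => ?_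
  simp only [mul_right_comm _ (u _), ← Finset.sum_mul]
  rw [h]

theorem PairEq.mul (h : PairEq s U V t U' V') (u v u' v' : WithConv (A →ₗ[K] R)) :
    PairEq s (fun i => u * U i * v) (fun i => u' * V i * v') t (fun j => u * U' j * v)
      (fun j => u' * V' j * v') :=
  ((((h.mul_left u).mul_right v).swap.mul_left u').mul_right v').swap

variable {x y : ι → lieAlg K A}

theorem IsAdInvSymm.pairEq (hH : IsAdInvSymm (∑ i ∈ s, x i ⊗ₜ[K] y i)) (p : A →ₐ[K] R) :
    PairEq s (fun i => (pt p : WithConv (A →ₗ[K] R)) * tan R (x i) * (pt p)⁻¹.val)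
      (fun i => (pt p : WithConv (A →ₗ[K] R)) * tan R (y i) * (pt p)⁻¹.val) s
      (fun i => tan R (x i)) (fun i => tan R (y i)) := fun a b => by
  have h := congrArg p (hH.ad_inv a b)
  simp only [biop_sum, map_sum, map_mul] at h
  have key : ∀ (X : lieAlg K A) (a : A),
      p (adOp X a) = ((pt p : WithConv (A →ₗ[K] R)) * tan R X * (pt p)⁻¹.val) a := by
    intro X a
    have h2 : p (adOp X a) = post p.toLinearMap (toConv (adOp X)) a := rfl
    rw [h2, toConv_adOp, post_algHom_mul, post_algHom_mul, post_tan, post_pt, post_pt_inv,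
      AlgHom.comp_id]
  simp only [← key, h, AlgHom.commutes, tan_apply]

/-- Moving a point across an `Ad`-invariant tensor. -/
theorem IsAdInvSymm.pairEq_mul (hH : IsAdInvSymm (∑ i ∈ s, x i ⊗ₜ[K] y i)) (p : A →ₐ[K] R)
    (u v u' v' : WithConv (A →ₗ[K] R)) :
    PairEq s (fun i => u * (pt p).val * tan R (x i) * v) (fun i => u' * (pt p).val * tan R (y i) * v') s
      (fun i => u * tan R (x i) * (pt p).val * v) (fun i => u' * tan R (y i) * (pt p).val * v') := by
  have h := (hH.pairEq p).mul u (pt p * v) u' (pt p * v')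
  simpa only [mul_assoc, Units.inv_mul_cancel_left] using h

theorem IsAdInvSymm.pairEq_lie (hH : IsAdInvSymm (∑ i ∈ s, x i ⊗ₜ[K] y i)) (X : lieAlg K A)
    (a b : A) : ∑ i ∈ s, (tan R ⁅X, x i⁆ a * tan R (y i) b + tan R (x i) a * tan R ⁅X, y i⁆ b) =
      0 := by
  have hD := (isDerivAlong_tangent X).algHom_comp (Algebra.ofId K R)
  set D : A →ₗ[K] R := (Algebra.ofId K R).toLinearMap ∘ₗ tangent X with hDdef
  set e : A →ₐ[K] R := (Algebra.ofId K R).comp (Bialgebra.counitAlgHom K A) with he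
  have h := congrArg D (hH.pairEq (AlgHom.id K A) a b)
  have e1 : ∀ (Y : lieAlg K A) (a : A), D (((pt (AlgHom.id K A) : WithConv (A →ₗ[K] A)) * tan A Y *
      (pt (AlgHom.id K A))⁻¹.val) a) = tan R ⁅X, Y⁆ a := by
    intro Y a
    rw [← post_apply]
    have h1 : post D (pt (AlgHom.id K A) : WithConv (A →ₗ[K] A)) = tan R X := rfl
    have h2 : pt (e.comp (AlgHom.id K A)) = 1 := by
      ext a
      rfl
    rw [hD.post_mul, hD.post_mul, hD.post_inv, hD.post_tan, post_algHom_mul, post_tan, post_pt,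
      post_pt_inv, h1, h2, tan_lie]
    congr 2
    simp only [inv_one, Units.val_one]
    noncomm_ring
  have e2 : ∀ (Y : lieAlg K A) (a : A), e (((pt (AlgHom.id K A) : WithConv (A →ₗ[K] A)) * tan A Y *
      (pt (AlgHom.id K A))⁻¹.val) a) = tan R Y a := by
    intro Y a
    have h0 : ∀ u : WithConv (A →ₗ[K] A), e (u a) = post e.toLinearMap u a := fun u => rfl
    have h2 : pt (e.comp (AlgHom.id K A)) = 1 := by
      ext a
      rfl
    rw [h0, post_algHom_mul, post_algHom_mul, post_tan, post_pt, post_pt_inv, h2]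
    simp
  have e3 : ∀ (Y : lieAlg K A) (a : A), D (tan A Y a) = 0 := fun Y a => by
    rw [← post_apply, hD.post_tan]
    rfl
  have hm : ∀ f g, D (f * g) = e f * D g + D f * e g := hD
  simp only [map_sum, hm, e1, e2, e3, mul_zero, zero_mul, add_zero, Finset.sum_const_zero] at h
  rw [← h]
  exact Finset.sum_congr rfl fun i _ => by ring

theorem IsAdInvSymm.pairEq_lie_mul (hH : IsAdInvSymm (∑ i ∈ s, x i ⊗ₜ[K] y i)) (X : lieAlg K A)
    (u v u' v' : WithConv (A →ₗ[K] R)) (a b : A) :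
    ∑ i ∈ s, (u * tan R ⁅X, x i⁆ * v) a * (u' * tan R (y i) * v') b +
      ∑ i ∈ s, (u * tan R (x i) * v) a * (u' * tan R ⁅X, y i⁆ * v') b = 0 := by
  have h : PairEq (s.disjSum s) (Sum.elim (fun i => tan R ⁅X, x i⁆) (fun i => tan R (x i)))
      (Sum.elim (fun i => tan R (y i)) (fun i => tan R ⁅X, y i⁆)) (∅ : Finset ι)
      (fun _ => 0) (fun _ => 0) := fun a b => by
    simpa [Finset.sum_disjSum, ← Finset.sum_add_distrib] using hH.pairEq_lie X a b
  simpa [Finset.sum_disjSum] using h.mul u v u' v' a b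

end Pairing

section Biderivation

variable {K : Type*} [Field K] {B B' R : Type*} [CommRing B] [Algebra K B] [CommRing B']
  [Algebra K B'] [CommRing R] [Algebra K R]

/-- A bilinear map which is a derivation along `ψ` in the first variable, and along `χ` in the
second one. -/
structure IsBideriv (ψ : B →ₐ[K] R) (χ : B' →ₐ[K] R) (Q : B →ₗ[K] B' →ₗ[K] R) : Prop where
  left : ∀ h, IsDerivAlong ψ (Q.flip h)
  right : ∀ f, IsDerivAlong χ (Q f)

variable {ψ : B →ₐ[K] R} {χ : B' →ₐ[K] R} {Q Q' : B →ₗ[K] B' →ₗ[K] R}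

theorem IsBideriv.add (hQ : IsBideriv ψ χ Q) (hQ' : IsBideriv ψ χ Q') : IsBideriv ψ χ (Q + Q') :=
  ⟨fun h => (hQ.left h).add (hQ'.left h), fun f => (hQ.right f).add (hQ'.right f)⟩

theorem IsBideriv.sub (hQ : IsBideriv ψ χ Q) (hQ' : IsBideriv ψ χ Q') : IsBideriv ψ χ (Q - Q') :=
  ⟨fun h => (hQ.left h).sub (hQ'.left h), fun f => (hQ.right f).sub (hQ'.right f)⟩

theorem IsBideriv.smul (hQ : IsBideriv ψ χ Q) (c : K) : IsBideriv ψ χ (c • Q) :=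
  ⟨fun h => (hQ.left h).smul c, fun f => (hQ.right f).smul c⟩

theorem isBideriv_zero : IsBideriv ψ χ 0 :=
  ⟨fun h f f' => by simp, fun f h h' => by simp⟩

theorem isBideriv_biop {L L' : Type*} [AddCommGroup L] [Module K L] [AddCommGroup L'] [Module K L']
    {S : L →ₗ[K] B →ₗ[K] R} {T : L' →ₗ[K] B' →ₗ[K] R} (hS : ∀ X, IsDerivAlong ψ (S X))
    (hT : ∀ Y, IsDerivAlong χ (T Y)) (H : L ⊗[K] L') : IsBideriv ψ χ (biop S T H) := by
  obtain ⟨s, rfl⟩ := TensorProduct.exists_finset H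
  constructor
  · intro h f f'
    simp only [LinearMap.flip_apply, biop_sum, Finset.mul_sum, Finset.sum_mul,
      ← Finset.sum_add_distrib]
    refine Finset.sum_congr rfl fun i _ => ?_
    rw [hS i.1 f f']
    ring
  · intro f h h'
    simp only [biop_sum, Finset.mul_sum, Finset.sum_mul, ← Finset.sum_add_distrib]
    refine Finset.sum_congr rfl fun i _ => ?_
    rw [hT i.2 h h']
    ring

theorem IsBideriv.comp {C C' : Type*} [CommRing C] [Algebra K C] [CommRing C'] [Algebra K C']
    (hQ : IsBideriv ψ χ Q) (α : C →ₐ[K] B) (β : C' →ₐ[K] B') :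
    IsBideriv (ψ.comp α) (χ.comp β) (Q.compl₁₂ α.toLinearMap β.toLinearMap) :=
  ⟨fun h f f' => by simpa using hQ.left (β h) (α f) (α f'),
    fun f h h' => by simpa using hQ.right (α f) (β h) (β h')⟩

theorem IsBideriv.algHom_comp {C : Type*} [CommRing C] [Algebra K C]
    (hQ : IsBideriv ψ χ Q) (α : R →ₐ[K] C) :
    IsBideriv (α.comp ψ) (α.comp χ) (Q.compr₂ α.toLinearMap) :=
  ⟨fun h f f' => by
    have := congrArg α (hQ.left h f f')
    simpa using this,
   fun f h h' => by simpa using congrArg α (hQ.right f h h')⟩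

section Ext

variable {A : Type*} [CommRing A] [HopfAlgebra K A]

/-- The first generic point of `G × G`. -/
abbrev q₁ (K A : Type*) [Field K] [CommRing A] [HopfAlgebra K A] : A →ₐ[K] A ⊗[K] A :=
  Algebra.TensorProduct.includeLeft

/-- The second generic point of `G × G`. -/
abbrev q₂ (K A : Type*) [Field K] [CommRing A] [HopfAlgebra K A] : A →ₐ[K] A ⊗[K] A :=
  Algebra.TensorProduct.includeRight

theorem IsDerivAlong.ext {ψ : A ⊗[K] A →ₐ[K] R} {D D' : A ⊗[K] A →ₗ[K] R}
    (hD : IsDerivAlong ψ D) (hD' : IsDerivAlong ψ D') (h₁ : ∀ a, D (q₁ K A a) = D' (q₁ K A a))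
    (h₂ : ∀ a, D (q₂ K A a) = D' (q₂ K A a)) : D = D' := by
  refine TensorProduct.ext' fun a b => ?_
  have h : a ⊗ₜ[K] b = q₁ K A a * q₂ K A b := by simp
  rw [h, hD, hD', h₁, h₂]

theorem IsBideriv.ext {ψ χ : A ⊗[K] A →ₐ[K] R} {Q Q' : A ⊗[K] A →ₗ[K] A ⊗[K] A →ₗ[K] R}
    (hQ : IsBideriv ψ χ Q) (hQ' : IsBideriv ψ χ Q')
    (h₁₁ : ∀ a b, Q (q₁ K A a) (q₁ K A b) = Q' (q₁ K A a) (q₁ K A b))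
    (h₁₂ : ∀ a b, Q (q₁ K A a) (q₂ K A b) = Q' (q₁ K A a) (q₂ K A b))
    (h₂₁ : ∀ a b, Q (q₂ K A a) (q₁ K A b) = Q' (q₂ K A a) (q₁ K A b))
    (h₂₂ : ∀ a b, Q (q₂ K A a) (q₂ K A b) = Q' (q₂ K A a) (q₂ K A b)) : Q = Q' := by
  have h₁ : ∀ a, Q (q₁ K A a) = Q' (q₁ K A a) := fun a =>
    (hQ.right _).ext (hQ'.right _) (h₁₁ a) (h₁₂ a)
  have h₂ : ∀ a, Q (q₂ K A a) = Q' (q₂ K A a) := fun a =>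
    (hQ.right _).ext (hQ'.right _) (h₂₁ a) (h₂₂ a)
  have h : ∀ h, Q.flip h = Q'.flip h := fun h =>
    (hQ.left h).ext (hQ'.left h) (fun a => LinearMap.congr_fun (h₁ a) h)
      (fun a => LinearMap.congr_fun (h₂ a) h)
  exact LinearMap.ext₂ fun f g => LinearMap.congr_fun (h g) f

end Ext

end Biderivation

end QuasiPoisson.Algebraic

end

noncomputable section

namespace QuasiPoisson

/-- The Cartan element of a sum of two commuting copies of a 2-tensor. -/
theorem cartanElement_map_add_map {K : Type*} [Field K] {L L' : Type*} [LieRing L] [LieAlgebra K L]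
    [LieRing L'] [LieAlgebra K L'] {i j : L →ₗ[K] L'} (hi : ∀ X Y, ⁅i X, i Y⁆ = i ⁅X, Y⁆)
    (hj : ∀ X Y, ⁅j X, j Y⁆ = j ⁅X, Y⁆) (hij : ∀ X Y, ⁅i X, j Y⁆ = 0) (H : L ⊗[K] L) :
    cartanElement (TensorProduct.map i i H + TensorProduct.map j j H) =
      TensorProduct.map i (TensorProduct.map i i) (cartanElement H) +
        TensorProduct.map j (TensorProduct.map j j) (cartanElement H) := by
  have hji : ∀ X Y, ⁅j X, i Y⁆ = 0 := fun X Y => by rw [← lie_skew, hij, neg_zero]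
  obtain ⟨s, rfl⟩ := TensorProduct.exists_finset H
  simp only [cartanElement, middleBracket, bracketMap, TensorProduct.sum_tmul,
    TensorProduct.tmul_sum, map_sum, map_neg, map_smul, LinearMap.comp_apply,
    LinearEquiv.coe_coe, TensorProduct.assoc_tmul, LinearMap.lTensor_tmul,
    TensorProduct.assoc_symm_tmul, LinearMap.rTensor_tmul, TensorProduct.lift.tmul,
    LieHom.coe_toLinearMap, LieModule.toEnd_apply_apply, TensorProduct.map_tmul, map_add,
    TensorProduct.add_tmul, TensorProduct.tmul_add, hi, hj, hij, hji, TensorProduct.zero_tmul,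
    TensorProduct.tmul_zero, Finset.sum_const_zero, add_zero, zero_add, smul_add, neg_add]

namespace Algebraic

open WithConv

section

variable {K : Type*} [Field K] {L L' B : Type*} [AddCommGroup L] [Module K L]
  [AddCommGroup L'] [Module K L'] [CommRing B] [Algebra K B]

theorem triop_map (S : L' →ₗ[K] B →ₗ[K] B) (i : L →ₗ[K] L') (φ : L ⊗[K] (L ⊗[K] L)) (f g h : B) :
    triop S (TensorProduct.map i (TensorProduct.map i i) φ) f g h = triop (S ∘ₗ i) φ f g h := by
  have h1 : ∀ u : L ⊗[K] L, TensorProduct.map (S.flip g) (S.flip h) (TensorProduct.map i i u) =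
      TensorProduct.map ((S ∘ₗ i).flip g) ((S ∘ₗ i).flip h) u := fun u => by
    induction u with
    | zero => simp
    | add u v hu hv => simp only [map_add, hu, hv]
    | tmul a b => simp
  induction φ with
  | zero => simp [triop]
  | add u v hu hv =>
    simp only [triop, map_add] at hu hv ⊢
    rw [hu, hv]
  | tmul a u => simp [triop, h1]

theorem triop_add_tensor (S : L →ₗ[K] B →ₗ[K] B) (φ φ' : L ⊗[K] (L ⊗[K] L)) (f g h : B) :
    triop S (φ + φ') f g h = triop S φ f g h + triop S φ' f g h := by
  simp [triop]

end

section Fields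

variable {K : Type*} [Field K] {A : Type*} [CommRing A] [HopfAlgebra K A]

/-- The left invariant vector fields on the first factor of `G × G`. -/
def leftOp₁ (K A : Type*) [Field K] [CommRing A] [HopfAlgebra K A] :
    lieAlg K A →ₗ[K] A ⊗[K] A →ₗ[K] A ⊗[K] A := LinearMap.rTensorHom A ∘ₗ leftOp

/-- The right invariant vector fields on the first factor of `G × G`. -/
def rightOp₁ (K A : Type*) [Field K] [CommRing A] [HopfAlgebra K A] :
    lieAlg K A →ₗ[K] A ⊗[K] A →ₗ[K] A ⊗[K] A := LinearMap.rTensorHom A ∘ₗ rightOp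

/-- The left invariant vector fields on the second factor of `G × G`. -/
def leftOp₂ (K A : Type*) [Field K] [CommRing A] [HopfAlgebra K A] :
    lieAlg K A →ₗ[K] A ⊗[K] A →ₗ[K] A ⊗[K] A := LinearMap.lTensorHom A ∘ₗ leftOp

/-- The right invariant vector fields on the second factor of `G × G`. -/
def rightOp₂ (K A : Type*) [Field K] [CommRing A] [HopfAlgebra K A] :
    lieAlg K A →ₗ[K] A ⊗[K] A →ₗ[K] A ⊗[K] A := LinearMap.lTensorHom A ∘ₗ rightOp

theorem doubleBivector_eq (H : lieAlg K A ⊗[K] lieAlg K A) :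
    doubleBivector H = (1 / 2 : K) •
      ((biop (leftOp₁ K A) (rightOp₂ K A) H - biop (rightOp₂ K A) (leftOp₁ K A) H) +
        (biop (rightOp₁ K A) (leftOp₂ K A) H - biop (leftOp₂ K A) (rightOp₁ K A) H)) := rfl

theorem IsDerivAlong.rTensor {B : Type*} [CommRing B] [Algebra K B] {D : A →ₗ[K] A}
    (hD : IsDerivAlong (AlgHom.id K A) D) : IsDerivAlong (AlgHom.id K (A ⊗[K] B)) (D.rTensor B) :=
  isDerivAlong_of_tmul fun a b a' b' => by
    simp [hD a a', TensorProduct.add_tmul]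

theorem IsDerivAlong.lTensor {B : Type*} [CommRing B] [Algebra K B] {D : A →ₗ[K] A}
    (hD : IsDerivAlong (AlgHom.id K A) D) : IsDerivAlong (AlgHom.id K (B ⊗[K] A)) (D.lTensor B) :=
  isDerivAlong_of_tmul fun a b a' b' => by
    simp [hD b b', TensorProduct.tmul_add]

theorem isDerivAlong_leftOp₁ (X : lieAlg K A) :
    IsDerivAlong (AlgHom.id K (A ⊗[K] A)) (leftOp₁ K A X) := (isDerivAlong_leftOp X).rTensor

theorem isDerivAlong_rightOp₁ (X : lieAlg K A) :
    IsDerivAlong (AlgHom.id K (A ⊗[K] A)) (rightOp₁ K A X) := (isDerivAlong_rightOp X).rTensor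

theorem isDerivAlong_leftOp₂ (X : lieAlg K A) :
    IsDerivAlong (AlgHom.id K (A ⊗[K] A)) (leftOp₂ K A X) := (isDerivAlong_leftOp X).lTensor

theorem isDerivAlong_rightOp₂ (X : lieAlg K A) :
    IsDerivAlong (AlgHom.id K (A ⊗[K] A)) (rightOp₂ K A X) := (isDerivAlong_rightOp X).lTensor

theorem leftOp_one (X : lieAlg K A) : leftOp X (1 : A) = 0 := (isDerivAlong_leftOp X).map_one

theorem rightOp_one (X : lieAlg K A) : rightOp X (1 : A) = 0 := (isDerivAlong_rightOp X).map_one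

theorem leftOp₁_q₁ (X : lieAlg K A) :
    post (leftOp₁ K A X) (pt (q₁ K A)).val = (pt (q₁ K A)).val * tan _ X := by
  have h := congrArg (post (q₁ K A).toLinearMap) (toConv_leftOp X)
  rw [post_algHom_mul, post_tan, post_pt, AlgHom.comp_id] at h
  exact h

theorem leftOp₁_q₂ (X : lieAlg K A) : post (leftOp₁ K A X) (pt (q₂ K A)).val = 0 := by
  ext a
  simp [leftOp₁, leftOp_one]

theorem rightOp₁_q₁ (X : lieAlg K A) :
    post (rightOp₁ K A X) (pt (q₁ K A)).val = tan _ X * (pt (q₁ K A)).val := by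
  have h := congrArg (post (q₁ K A).toLinearMap) (toConv_rightOp X)
  rw [post_algHom_mul, post_tan, post_pt, AlgHom.comp_id] at h
  exact h

theorem rightOp₁_q₂ (X : lieAlg K A) : post (rightOp₁ K A X) (pt (q₂ K A)).val = 0 := by
  ext a
  simp [rightOp₁, rightOp_one]

theorem leftOp₂_q₁ (X : lieAlg K A) : post (leftOp₂ K A X) (pt (q₁ K A)).val = 0 := by
  ext a
  simp [leftOp₂, leftOp_one]

theorem leftOp₂_q₂ (X : lieAlg K A) :
    post (leftOp₂ K A X) (pt (q₂ K A)).val = (pt (q₂ K A)).val * tan _ X := by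
  have h := congrArg (post (q₂ K A).toLinearMap) (toConv_leftOp X)
  rw [post_algHom_mul, post_tan, post_pt, AlgHom.comp_id] at h
  exact h

theorem rightOp₂_q₁ (X : lieAlg K A) : post (rightOp₂ K A X) (pt (q₁ K A)).val = 0 := by
  ext a
  simp [rightOp₂, rightOp_one]

theorem rightOp₂_q₂ (X : lieAlg K A) :
    post (rightOp₂ K A X) (pt (q₂ K A)).val = tan _ X * (pt (q₂ K A)).val := by
  have h := congrArg (post (q₂ K A).toLinearMap) (toConv_rightOp X)
  rw [post_algHom_mul, post_tan, post_pt, AlgHom.comp_id] at h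
  exact h

theorem isBideriv_doubleBivector (H : lieAlg K A ⊗[K] lieAlg K A) :
    IsBideriv (AlgHom.id K (A ⊗[K] A)) (AlgHom.id K (A ⊗[K] A)) (doubleBivector H) := by
  rw [doubleBivector_eq]
  exact ((((isBideriv_biop isDerivAlong_leftOp₁ isDerivAlong_rightOp₂ H).sub
    (isBideriv_biop isDerivAlong_rightOp₂ isDerivAlong_leftOp₁ H))).add
    ((isBideriv_biop isDerivAlong_rightOp₁ isDerivAlong_leftOp₂ H).sub
    (isBideriv_biop isDerivAlong_leftOp₂ isDerivAlong_rightOp₁ H))).smul _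

/-! ### Commutation relations -/

theorem leftOp_comp_sub (X Y : lieAlg K A) :
    leftOp X ∘ₗ leftOp Y - leftOp Y ∘ₗ leftOp X = (leftOp ⁅X, Y⁆ : A →ₗ[K] A) := by
  ext a
  simp [leftOp, Derivation.commutator_apply]

theorem toConv_rightOp_comp (X Y : lieAlg K A) : toConv (rightOp X ∘ₗ rightOp Y) =
    tan A Y * tan A X * (pt (AlgHom.id K A)).val := by
  have h : toConv (rightOp X ∘ₗ rightOp Y) = post (rightOp X) (toConv (rightOp (A := A) Y)) := rfl
  have h2 : post (rightOp X) (pt (AlgHom.id K A)).val = toConv (rightOp (A := A) X) := rfl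
  rw [h, toConv_rightOp, (isDerivAlong_rightOp X).post_mul, (isDerivAlong_rightOp X).post_tan,
    post_tan, h2, toConv_rightOp, zero_mul, add_zero, mul_assoc]

theorem rightOp_comp_sub (X Y : lieAlg K A) :
    rightOp X ∘ₗ rightOp Y - rightOp Y ∘ₗ rightOp X = (-rightOp ⁅X, Y⁆ : A →ₗ[K] A) := by
  apply toConv_injective
  rw [toConv_sub, toConv_rightOp_comp, toConv_rightOp_comp, toConv_neg, toConv_rightOp, tan_lie]
  noncomm_ring

theorem leftOp_comp_rightOp (X Y : lieAlg K A) :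
    leftOp X ∘ₗ rightOp Y = (rightOp Y ∘ₗ leftOp X : A →ₗ[K] A) := by
  apply toConv_injective
  have h : toConv (leftOp X ∘ₗ rightOp Y) = post (leftOp X) (toConv (rightOp (A := A) Y)) := rfl
  have h' : toConv (rightOp Y ∘ₗ leftOp X) = post (rightOp Y) (toConv (leftOp (A := A) X)) := rfl
  have h2 : post (leftOp X) (pt (AlgHom.id K A)).val = toConv (leftOp (A := A) X) := rfl
  have h2' : post (rightOp Y) (pt (AlgHom.id K A)).val = toConv (rightOp (A := A) Y) := rfl
  rw [h, h', toConv_rightOp, toConv_leftOp, (isDerivAlong_leftOp X).post_mul,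
    (isDerivAlong_rightOp Y).post_mul, (isDerivAlong_leftOp X).post_tan,
    (isDerivAlong_rightOp Y).post_tan, post_tan, post_tan, h2, h2', toConv_leftOp, toConv_rightOp,
    zero_mul, mul_zero, add_zero, zero_add, mul_assoc]

/-! ### The infinitesimal action -/

theorem tangent_inl (X : lieAlg K A) (a b : A) :
    tangent (inl X) (a ⊗ₜ[K] b) = tangent X a * Coalgebra.counit (R := K) b := by
  simp [tangent, inl, mul_comm]

theorem tangent_inr (X : lieAlg K A) (a b : A) :
    tangent (inr X) (a ⊗ₜ[K] b) = Coalgebra.counit (R := K) a * tangent X b := by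
  simp [tangent, inr, mul_comm]

theorem leftOp_inl (X : lieAlg K A) : leftOp (inl X) = leftOp₁ K A X := rfl

theorem leftOp_inr (X : lieAlg K A) : leftOp (inr X) = leftOp₂ K A X := rfl

theorem rightOp_inl (X : lieAlg K A) : rightOp (inl X) = rightOp₁ K A X := by
  refine TensorProduct.ext' fun a b => ?_
  have h : ∀ s t : A ⊗[K] A, TensorProduct.lid K (A ⊗[K] A)
      (LinearMap.rTensor (A ⊗[K] A) (tangent (inl X))
        (TensorProduct.tensorTensorTensorComm K A A A A (s ⊗ₜ t))) =
      (TensorProduct.lid K A (LinearMap.rTensor A (tangent X) s)) ⊗ₜ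
        (TensorProduct.lid K A (LinearMap.rTensor A (Coalgebra.counit (R := K)) t)) := by
    intro s t
    induction s with
    | zero => simp
    | add s s' hs hs' => simp only [TensorProduct.add_tmul, map_add, hs, hs']
    | tmul a a' =>
      induction t with
      | zero => simp
      | add t t' ht ht' => simp only [TensorProduct.tmul_add, map_add, ht, ht']
      | tmul b b' =>
        simp [tangent_inl, TensorProduct.smul_tmul', TensorProduct.tmul_smul, mul_smul,
          smul_comm (tangent X a)]
  refine (h (Coalgebra.comul a) (Coalgebra.comul b)).trans ?_
  rw [Coalgebra.rTensor_counit_comul]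
  simp [rightOp₁, rightOp]

theorem rightOp_inr (X : lieAlg K A) : rightOp (inr X) = rightOp₂ K A X := by
  refine TensorProduct.ext' fun a b => ?_
  have h : ∀ s t : A ⊗[K] A, TensorProduct.lid K (A ⊗[K] A)
      (LinearMap.rTensor (A ⊗[K] A) (tangent (inr X))
        (TensorProduct.tensorTensorTensorComm K A A A A (s ⊗ₜ t))) =
      (TensorProduct.lid K A (LinearMap.rTensor A (Coalgebra.counit (R := K)) s)) ⊗ₜ
        (TensorProduct.lid K A (LinearMap.rTensor A (tangent X) t)) := by
    intro s t
    induction s with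
    | zero => simp
    | add s s' hs hs' => simp only [TensorProduct.add_tmul, map_add, hs, hs']
    | tmul a a' =>
      induction t with
      | zero => simp
      | add t t' ht ht' => simp only [TensorProduct.tmul_add, map_add, ht, ht']
      | tmul b b' =>
        simp [tangent_inr, TensorProduct.smul_tmul', TensorProduct.tmul_smul, mul_smul,
          smul_comm (tangent X b)]
  refine (h (Coalgebra.comul a) (Coalgebra.comul b)).trans ?_
  rw [Coalgebra.rTensor_counit_comul]
  simp [rightOp₂, rightOp]

theorem lie_inl_inl (X Y : lieAlg K A) : ⁅inl X, inl Y⁆ = inl ⁅X, Y⁆ := by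
  ext u
  induction u with
  | zero => simp
  | add u v hu hv => simp only [map_add, hu, hv]
  | tmul a b =>
    simp only [inl, LieSubalgebra.coe_bracket, Derivation.commutator_apply]
    exact (TensorProduct.sub_tmul _ _ _).symm

theorem lie_inr_inr (X Y : lieAlg K A) : ⁅inr X, inr Y⁆ = inr ⁅X, Y⁆ := by
  ext u
  induction u with
  | zero => simp
  | add u v hu hv => simp only [map_add, hu, hv]
  | tmul a b =>
    simp only [inr, LieSubalgebra.coe_bracket, Derivation.commutator_apply]
    exact (TensorProduct.tmul_sub _ _ _).symm

theorem lie_inl_inr (X Y : lieAlg K A) : ⁅inl X, inr Y⁆ = 0 := by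
  ext u
  induction u with
  | zero => simp
  | add u v hu hv => simp only [map_add, hu, hv]
  | tmul a b => simp [inl, inr, Derivation.commutator_apply]

end Fields

end Algebraic

end QuasiPoisson

end

noncomputable section

namespace QuasiPoisson.Algebraic

open WithConv

section Action

variable {K : Type*} [Field K] {A : Type*} [CommRing A] [HopfAlgebra K A]
  {R R' : Type*} [CommRing R] [Algebra K R] [CommRing R'] [Algebra K R']

theorem comp_ptMul (ψ : R →ₐ[K] R') (f g : A →ₐ[K] R) :
    ψ.comp (ptMul f g) = ptMul (ψ.comp f) (ψ.comp g) := by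
  apply pt_injective
  ext1
  rw [pt_ptMul, ← post_pt, pt_ptMul, Units.val_mul, post_algHom_mul]
  rfl

theorem comp_ptInv (ψ : R →ₐ[K] R') (f : A →ₐ[K] R) :
    ψ.comp (ptInv f) = ptInv (ψ.comp f) := rfl

theorem ptMul_comp_q₁ (f g : A ⊗[K] A →ₐ[K] R) :
    (ptMul f g).comp (q₁ K A) = ptMul (f.comp (q₁ K A)) (g.comp (q₁ K A)) := by
  ext a
  have h : ∀ s : A ⊗[K] A, Algebra.TensorProduct.lift f g (fun _ _ => Commute.all _ _)
      (TensorProduct.tensorTensorTensorComm K A A A A (s ⊗ₜ (1 ⊗ₜ 1))) =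
      Algebra.TensorProduct.lift (f.comp (q₁ K A)) (g.comp (q₁ K A)) (fun _ _ => Commute.all _ _)
        s := fun s => by
    induction s with
    | zero => simp
    | add s s' hs hs' => simp only [TensorProduct.add_tmul, map_add, hs, hs']
    | tmul a b => simp
  have h1 : (Coalgebra.comul (1 : A) : A ⊗[K] A) = 1 ⊗ₜ 1 := Bialgebra.comul_one
  simp only [ptMul, AlgHom.comp_apply, Bialgebra.comulAlgHom_apply,
    Algebra.TensorProduct.includeLeft_apply, TensorProduct.comul_tmul, h1]
  exact h _

theorem ptMul_comp_q₂ (f g : A ⊗[K] A →ₐ[K] R) :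
    (ptMul f g).comp (q₂ K A) = ptMul (f.comp (q₂ K A)) (g.comp (q₂ K A)) := by
  ext a
  have h : ∀ s : A ⊗[K] A, Algebra.TensorProduct.lift f g (fun _ _ => Commute.all _ _)
      (TensorProduct.tensorTensorTensorComm K A A A A ((1 ⊗ₜ 1) ⊗ₜ s)) =
      Algebra.TensorProduct.lift (f.comp (q₂ K A)) (g.comp (q₂ K A)) (fun _ _ => Commute.all _ _)
        s := fun s => by
    induction s with
    | zero => simp
    | add s s' hs hs' => simp only [TensorProduct.tmul_add, map_add, hs, hs']
    | tmul a b => simp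
  have h1 : (Coalgebra.comul (1 : A) : A ⊗[K] A) = 1 ⊗ₜ 1 := Bialgebra.comul_one
  simp only [ptMul, AlgHom.comp_apply, Bialgebra.comulAlgHom_apply,
    Algebra.TensorProduct.includeRight_apply, TensorProduct.comul_tmul, h1]
  exact h _

theorem ptInv_comp_q₁ (f : A ⊗[K] A →ₐ[K] R) :
    (ptInv f).comp (q₁ K A) = ptInv (f.comp (q₁ K A)) := by
  ext a
  simp [ptInv, TensorProduct.antipode_def]

theorem ptInv_comp_q₂ (f : A ⊗[K] A →ₐ[K] R) :
    (ptInv f).comp (q₂ K A) = ptInv (f.comp (q₂ K A)) := by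
  ext a
  simp [ptInv, TensorProduct.antipode_def]

variable (K A)

/-- The generic point of `G × G` acting on `G × G`. -/
abbrev actPt : A ⊗[K] A →ₐ[K] (A ⊗[K] A) ⊗[K] (A ⊗[K] A) := Algebra.TensorProduct.includeLeft

/-- The generic point of `G × G` acted upon by `G × G`. -/
abbrev basePt : A ⊗[K] A →ₐ[K] (A ⊗[K] A) ⊗[K] (A ⊗[K] A) := Algebra.TensorProduct.includeRight

theorem doubleAct_comp_q₁ : (doubleAct K A).comp (q₁ K A) =
    ptMul (ptMul ((actPt K A).comp (q₁ K A)) ((basePt K A).comp (q₁ K A)))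
      (ptInv ((actPt K A).comp (q₂ K A))) :=
  Algebra.TensorProduct.lift_comp_includeLeft _ _ (fun _ _ => Commute.all _ _)

theorem doubleAct_comp_q₂ : (doubleAct K A).comp (q₂ K A) =
    ptMul (ptMul ((actPt K A).comp (q₂ K A)) ((basePt K A).comp (q₂ K A)))
      (ptInv ((actPt K A).comp (q₁ K A))) :=
  Algebra.TensorProduct.lift_comp_includeRight _ _ (fun _ _ => Commute.all _ _)

theorem doubleMoment_comp_q₁ : (doubleMoment K A).comp (q₁ K A) = ptMul (q₁ K A) (q₂ K A) :=
  Algebra.TensorProduct.lift_comp_includeLeft _ _ (fun _ _ => Commute.all _ _)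

theorem doubleMoment_comp_q₂ :
    (doubleMoment K A).comp (q₂ K A) = ptMul (ptInv (q₁ K A)) (ptInv (q₂ K A)) :=
  Algebra.TensorProduct.lift_comp_includeRight _ _ (fun _ _ => Commute.all _ _)

variable {K A}

theorem algHom_ext_q {f g : A ⊗[K] A →ₐ[K] R} (h₁ : pt (f.comp (q₁ K A)) = pt (g.comp (q₁ K A)))
    (h₂ : pt (f.comp (q₂ K A)) = pt (g.comp (q₂ K A))) : f = g :=
  Algebra.TensorProduct.ext (pt_injective h₁) (pt_injective h₂)

theorem counitLeft_comp_doubleAct :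
    (counitLeft K (A ⊗[K] A) (A ⊗[K] A)).comp (doubleAct K A) = AlgHom.id K _ := by
  have hx : pt ((counitLeft K (A ⊗[K] A) (A ⊗[K] A)).comp ((actPt K A).comp (q₁ K A))) = 1 := by
    ext a
    simp [counitLeft, Algebra.ofId_apply]
  have hy : pt ((counitLeft K (A ⊗[K] A) (A ⊗[K] A)).comp ((actPt K A).comp (q₂ K A))) = 1 := by
    ext a
    simp [counitLeft, Algebra.ofId_apply]
  have hq : (counitLeft K (A ⊗[K] A) (A ⊗[K] A)).comp (basePt K A) = AlgHom.id K _ := by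
    ext a <;> simp [counitLeft]
  refine algHom_ext_q ?_ ?_
  · rw [AlgHom.comp_assoc, doubleAct_comp_q₁]
    simp only [comp_ptMul, comp_ptInv, pt_ptMul, pt_ptInv, hx, hy, ← AlgHom.comp_assoc _ (basePt K A),
      hq, inv_one, one_mul, mul_one]
  · rw [AlgHom.comp_assoc, doubleAct_comp_q₂]
    simp only [comp_ptMul, comp_ptInv, pt_ptMul, pt_ptInv, hx, hy, ← AlgHom.comp_assoc _ (basePt K A),
      hq, inv_one, one_mul, mul_one]

theorem comp_doubleAct_eq (F F' e : (A ⊗[K] A) ⊗[K] (A ⊗[K] A) →ₐ[K] R) (g : A ⊗[K] A →ₐ[K] R)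
    (hF : F.comp (actPt K A) = ptMul g (e.comp (actPt K A)))
    (hFq : F.comp (basePt K A) = e.comp (basePt K A)) (hF' : F'.comp (actPt K A) = g)
    (hF'q : F'.comp (basePt K A) = e.comp (doubleAct K A)) :
    F.comp (doubleAct K A) = F'.comp (doubleAct K A) := by
  refine algHom_ext_q ?_ ?_
  · rw [AlgHom.comp_assoc, AlgHom.comp_assoc, doubleAct_comp_q₁]
    simp only [comp_ptMul, comp_ptInv, ← AlgHom.comp_assoc _ (basePt K A),
      ← AlgHom.comp_assoc _ (actPt K A), hF, hFq, hF', hF'q, ptMul_comp_q₁, ptMul_comp_q₂]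
    simp only [AlgHom.comp_assoc, doubleAct_comp_q₁, comp_ptMul, comp_ptInv, pt_ptMul, pt_ptInv]
    group
  · rw [AlgHom.comp_assoc, AlgHom.comp_assoc, doubleAct_comp_q₂]
    simp only [comp_ptMul, comp_ptInv, ← AlgHom.comp_assoc _ (basePt K A),
      ← AlgHom.comp_assoc _ (actPt K A), hF, hFq, hF', hF'q, ptMul_comp_q₁, ptMul_comp_q₂]
    simp only [AlgHom.comp_assoc, doubleAct_comp_q₂, comp_ptMul, comp_ptInv, pt_ptMul, pt_ptInv]
    group

theorem isAction_doubleAct : IsAction (doubleAct K A) where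
  counit b := by
    have h := DFunLike.congr_fun (counitLeft_comp_doubleAct (K := K) (A := A)) b
    refine Eq.trans ?_ h
    rw [AlgHom.comp_apply]
    generalize doubleAct K A b = u
    induction u with
    | zero => simp
    | add u v hu hv => simp only [map_add, hu, hv]
    | tmul u v => simp [counitLeft, Algebra.smul_def, Algebra.ofId_apply]
  coassoc b := by
    let F : (A ⊗[K] A) ⊗[K] (A ⊗[K] A) →ₐ[K] (A ⊗[K] A) ⊗[K] ((A ⊗[K] A) ⊗[K] (A ⊗[K] A)) :=
      (Algebra.TensorProduct.assoc K K K (A ⊗[K] A) (A ⊗[K] A) (A ⊗[K] A)).toAlgHom.comp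
        (Algebra.TensorProduct.map (Bialgebra.comulAlgHom K (A ⊗[K] A)) (AlgHom.id K (A ⊗[K] A)))
    let F' : (A ⊗[K] A) ⊗[K] (A ⊗[K] A) →ₐ[K] (A ⊗[K] A) ⊗[K] ((A ⊗[K] A) ⊗[K] (A ⊗[K] A)) :=
      Algebra.TensorProduct.map (AlgHom.id K (A ⊗[K] A)) (doubleAct K A)
    let g : A ⊗[K] A →ₐ[K] (A ⊗[K] A) ⊗[K] ((A ⊗[K] A) ⊗[K] (A ⊗[K] A)) :=
      Algebra.TensorProduct.includeLeft
    let e : (A ⊗[K] A) ⊗[K] (A ⊗[K] A) →ₐ[K] (A ⊗[K] A) ⊗[K] ((A ⊗[K] A) ⊗[K] (A ⊗[K] A)) :=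
      Algebra.TensorProduct.includeRight
    have hF : F.comp (actPt K A) = ptMul (K := K) (A := A ⊗[K] A)
        (R := (A ⊗[K] A) ⊗[K] ((A ⊗[K] A) ⊗[K] (A ⊗[K] A))) g (e.comp (actPt K A)) := by
      have : ∀ s : (A ⊗[K] A) ⊗[K] (A ⊗[K] A),
          Algebra.TensorProduct.assoc K K K (A ⊗[K] A) (A ⊗[K] A) (A ⊗[K] A) (s ⊗ₜ 1) =
          Algebra.TensorProduct.lift g (e.comp (actPt K A)) (fun u v => mul_comm (g u) _) s := by
        intro s
        induction s with
        | zero => simp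
        | add s s' hs hs' => simp only [TensorProduct.add_tmul, map_add, hs, hs']
        | tmul a b =>
          refine Eq.trans ?_ (Algebra.TensorProduct.lift_tmul g (e.comp (actPt K A)) _ a b).symm
          simp [g, e]
      refine AlgHom.ext fun u => ?_
      simp [F, ptMul, this]
    have hFq : F.comp (basePt K A) = e.comp (basePt K A) := by
      refine AlgHom.ext fun u => ?_
      simp only [F, e, AlgHom.comp_apply, Algebra.TensorProduct.includeRight_apply,
        Algebra.TensorProduct.map_tmul, map_one, AlgHom.id_apply]
      rfl
    have hF' : F'.comp (actPt K A) = g := by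
      refine AlgHom.ext fun u => ?_
      simp [F', g]
    have hF'q : F'.comp (basePt K A) = e.comp (doubleAct K A) := by
      refine AlgHom.ext fun u => ?_
      simp [F', e]
    exact DFunLike.congr_fun (comp_doubleAct_eq (K := K) (A := A)
      (R := (A ⊗[K] A) ⊗[K] ((A ⊗[K] A) ⊗[K] (A ⊗[K] A))) F F' e g hF hFq hF' hF'q) b

/-! ### The fundamental vector fields -/

theorem isDerivAlong_fund (X : lieAlg K (A ⊗[K] A)) :
    IsDerivAlong (AlgHom.id K (A ⊗[K] A)) (fund (doubleAct K A) X) := by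
  have h := ((isDerivAlong_tangentLeft (R := A ⊗[K] A) X).comp_algHom (doubleAct K A)).neg
  rw [counitLeft_comp_doubleAct] at h
  exact h

theorem post_fund (X : lieAlg K (A ⊗[K] A)) (f : A →ₐ[K] A ⊗[K] A) :
    post (fund (doubleAct K A) X) (pt f).val =
      -post (tangentLeft (A ⊗[K] A) X) (pt ((doubleAct K A).comp f)).val := rfl

theorem tangentLeft_basePt (X : lieAlg K (A ⊗[K] A)) (f : A →ₐ[K] A ⊗[K] A) :
    post (tangentLeft (A ⊗[K] A) X) (pt ((basePt K A).comp f)).val = 0 := by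
  ext a
  have := (isDerivAlong_tangent X).map_one
  simp [tangentLeft, this]

theorem tangentLeft_actPt (X : lieAlg K (A ⊗[K] A)) (f : A →ₐ[K] A ⊗[K] A) (a : A) :
    post (tangentLeft (A ⊗[K] A) X) (pt ((actPt K A).comp f)).val a =
      algebraMap K _ (tangent X (f a)) := by
  simp [tangentLeft, Algebra.algebraMap_eq_smul_one]

theorem counitLeft_comp_basePt :
    (counitLeft K (A ⊗[K] A) (A ⊗[K] A)).comp (basePt K A) = AlgHom.id K _ := by
  ext a <;> simp [counitLeft]

theorem counitLeft_comp_actPt (f : A →ₐ[K] A ⊗[K] A)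
    (hf : (Bialgebra.counitAlgHom K (A ⊗[K] A)).comp f = Bialgebra.counitAlgHom K A) :
    pt ((counitLeft K (A ⊗[K] A) (A ⊗[K] A)).comp ((actPt K A).comp f)) = 1 := by
  ext a
  have := DFunLike.congr_fun hf a
  simp only [AlgHom.comp_apply, Bialgebra.counitAlgHom_apply] at this
  simp [counitLeft, Algebra.ofId_apply, this]

theorem counit_comp_q₁ :
    (Bialgebra.counitAlgHom K (A ⊗[K] A)).comp (q₁ K A) = Bialgebra.counitAlgHom K A := by
  ext a
  simp

theorem counit_comp_q₂ :
    (Bialgebra.counitAlgHom K (A ⊗[K] A)).comp (q₂ K A) = Bialgebra.counitAlgHom K A := by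
  ext a
  simp

theorem tangent_inl_q₁ (X : lieAlg K A) :
    post (tangentLeft (A ⊗[K] A) (inl X)) (pt ((actPt K A).comp (q₁ K A))).val = tan _ X := by
  ext a
  rw [tangentLeft_actPt]
  simp [tangent_inl, tan_apply]

theorem tangent_inl_q₂ (X : lieAlg K A) :
    post (tangentLeft (A ⊗[K] A) (inl X)) (pt ((actPt K A).comp (q₂ K A))).val = 0 := by
  ext a
  rw [tangentLeft_actPt]
  simp [tangent_inl, (isDerivAlong_tangent X).map_one]

theorem tangent_inr_q₁ (X : lieAlg K A) :
    post (tangentLeft (A ⊗[K] A) (inr X)) (pt ((actPt K A).comp (q₁ K A))).val = 0 := by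
  ext a
  rw [tangentLeft_actPt]
  simp [tangent_inr, (isDerivAlong_tangent X).map_one]

theorem tangent_inr_q₂ (X : lieAlg K A) :
    post (tangentLeft (A ⊗[K] A) (inr X)) (pt ((actPt K A).comp (q₂ K A))).val = tan _ X := by
  ext a
  rw [tangentLeft_actPt]
  simp [tangent_inr, tan_apply]

theorem fund_inl (X : lieAlg K A) :
    fund (doubleAct K A) (inl X) = leftOp₂ K A X - rightOp₁ K A X := by
  have hD := isDerivAlong_tangentLeft (R := A ⊗[K] A) (inl X)
  refine (isDerivAlong_fund _).ext ((isDerivAlong_leftOp₂ X).sub (isDerivAlong_rightOp₁ X)) ?_ ?_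
  · suffices h : post (fund (doubleAct K A) (inl X)) (pt (q₁ K A)).val =
        post (leftOp₂ K A X) (pt (q₁ K A)).val - post (rightOp₁ K A X) (pt (q₁ K A)).val from
      fun a => DFunLike.congr_fun (congrArg ofConv h) a
    rw [leftOp₂_q₁, rightOp₁_q₁, post_fund, doubleAct_comp_q₁]
    simp only [pt_ptMul, pt_ptInv, Units.val_mul, hD.post_mul, hD.post_inv, post_pt, post_pt_inv,
      post_algHom_mul, tangentLeft_basePt, tangent_inl_q₁, tangent_inl_q₂,
      counitLeft_comp_actPt _ counit_comp_q₁, counitLeft_comp_actPt _ counit_comp_q₂,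
      ← AlgHom.comp_assoc _ (basePt K A), counitLeft_comp_basePt]
    simp
  · suffices h : post (fund (doubleAct K A) (inl X)) (pt (q₂ K A)).val =
        post (leftOp₂ K A X) (pt (q₂ K A)).val - post (rightOp₁ K A X) (pt (q₂ K A)).val from
      fun a => DFunLike.congr_fun (congrArg ofConv h) a
    rw [leftOp₂_q₂, rightOp₁_q₂, post_fund, doubleAct_comp_q₂]
    simp only [pt_ptMul, pt_ptInv, Units.val_mul, hD.post_mul, hD.post_inv, post_pt, post_pt_inv,
      post_algHom_mul, tangentLeft_basePt, tangent_inl_q₁, tangent_inl_q₂,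
      counitLeft_comp_actPt _ counit_comp_q₁, counitLeft_comp_actPt _ counit_comp_q₂,
      ← AlgHom.comp_assoc _ (basePt K A), counitLeft_comp_basePt]
    simp

theorem fund_inr (X : lieAlg K A) :
    fund (doubleAct K A) (inr X) = leftOp₁ K A X - rightOp₂ K A X := by
  have hD := isDerivAlong_tangentLeft (R := A ⊗[K] A) (inr X)
  refine (isDerivAlong_fund _).ext ((isDerivAlong_leftOp₁ X).sub (isDerivAlong_rightOp₂ X)) ?_ ?_
  · suffices h : post (fund (doubleAct K A) (inr X)) (pt (q₁ K A)).val =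
        post (leftOp₁ K A X) (pt (q₁ K A)).val - post (rightOp₂ K A X) (pt (q₁ K A)).val from
      fun a => DFunLike.congr_fun (congrArg ofConv h) a
    rw [leftOp₁_q₁, rightOp₂_q₁, post_fund, doubleAct_comp_q₁]
    simp only [pt_ptMul, pt_ptInv, Units.val_mul, hD.post_mul, hD.post_inv, post_pt, post_pt_inv,
      post_algHom_mul, tangentLeft_basePt, tangent_inr_q₁, tangent_inr_q₂,
      counitLeft_comp_actPt _ counit_comp_q₁, counitLeft_comp_actPt _ counit_comp_q₂,
      ← AlgHom.comp_assoc _ (basePt K A), counitLeft_comp_basePt]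
    simp
  · suffices h : post (fund (doubleAct K A) (inr X)) (pt (q₂ K A)).val =
        post (leftOp₁ K A X) (pt (q₂ K A)).val - post (rightOp₂ K A X) (pt (q₂ K A)).val from
      fun a => DFunLike.congr_fun (congrArg ofConv h) a
    rw [leftOp₁_q₂, rightOp₂_q₂, post_fund, doubleAct_comp_q₂]
    simp only [pt_ptMul, pt_ptInv, Units.val_mul, hD.post_mul, hD.post_inv, post_pt, post_pt_inv,
      post_algHom_mul, tangentLeft_basePt, tangent_inr_q₁, tangent_inr_q₂,
      counitLeft_comp_actPt _ counit_comp_q₁, counitLeft_comp_actPt _ counit_comp_q₂,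
      ← AlgHom.comp_assoc _ (basePt K A), counitLeft_comp_basePt]
    simp

end Action

end QuasiPoisson.Algebraic

end

noncomputable section

namespace QuasiPoisson.Algebraic

open WithConv

section Invariance

variable {K : Type*} [Field K] {A : Type*} [CommRing A] [HopfAlgebra K A]
  {R : Type*} [CommRing R] [Algebra K R]

theorem extend_biop {L C B : Type*} [AddCommGroup L] [Module K L] [CommRing C] [Algebra K C]
    [CommRing B] [Algebra K B] (S T : L →ₗ[K] B →ₗ[K] B) (H : L ⊗[K] L) (u v : C ⊗[K] B) :
    extend C (biop S T H) u v =
      biop (LinearMap.lTensorHom C ∘ₗ S) (LinearMap.lTensorHom C ∘ₗ T) H u v := by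
  obtain ⟨s, rfl⟩ := TensorProduct.exists_finset H
  rw [biop_sum]
  induction u with
  | zero => simp [extend]
  | add u u' hu hu' =>
    simp only [extend, TensorProduct.add_tmul, map_add, add_mul, Finset.sum_add_distrib] at hu hu' ⊢
    rw [hu, hu']
  | tmul c f =>
    induction v with
    | zero => simp [extend]
    | add v v' hv hv' =>
      simp only [extend, TensorProduct.tmul_add, map_add, mul_add, Finset.sum_add_distrib]
        at hv hv' ⊢
      rw [hv, hv']
    | tmul c' f' => simp [extend, biop_sum, TensorProduct.tmul_sum]

theorem extend_add {C B : Type*} [CommRing C] [Algebra K C] [CommRing B] [Algebra K B]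
    (P Q : B →ₗ[K] B →ₗ[K] B) (u v : C ⊗[K] B) :
    extend C (P + Q) u v = extend C P u v + extend C Q u v := by
  have h : TensorProduct.lift (P + Q) = TensorProduct.lift P + TensorProduct.lift Q :=
    TensorProduct.ext' fun f h => by simp
  simp [extend, h, TensorProduct.map_add_right]

theorem extend_smul {C B : Type*} [CommRing C] [Algebra K C] [CommRing B] [Algebra K B] (c : K)
    (P : B →ₗ[K] B →ₗ[K] B) (u v : C ⊗[K] B) : extend C (c • P) u v = c • extend C P u v := by
  have h : TensorProduct.lift (c • P) = c • TensorProduct.lift P :=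
    TensorProduct.ext' fun f h => by simp
  simp [extend, h, TensorProduct.map_smul_right]

theorem extend_sub {C B : Type*} [CommRing C] [Algebra K C] [CommRing B] [Algebra K B]
    (P Q : B →ₗ[K] B →ₗ[K] B) (u v : C ⊗[K] B) :
    extend C (P - Q) u v = extend C P u v - extend C Q u v := by
  have h : P - Q + Q = P := LinearMap.ext₂ fun f h => by simp
  rw [eq_sub_iff_add_eq, ← extend_add, h]

theorem biop_comm {L B : Type*} [AddCommGroup L] [Module K L] [CommRing B] [Algebra K B]
    {H : L ⊗[K] L} (hH : TensorProduct.comm K L L H = H) (S T : L →ₗ[K] B →ₗ[K] R) (f h : B) :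
    biop S T H f h = biop T S H h f := by
  conv_lhs => rw [← hH]
  obtain ⟨s, rfl⟩ := TensorProduct.exists_finset H
  simp only [map_sum, TensorProduct.comm_tmul, biop_sum, mul_comm]

theorem biop_pt {L L' B B' : Type*} [AddCommGroup L] [Module K L] [AddCommGroup L'] [Module K L']
    [CommRing B] [Algebra K B] [CommRing B'] [Algebra K B'] {ι : Type*}
    (S : L →ₗ[K] B →ₗ[K] R) (T : L' →ₗ[K] B' →ₗ[K] R) (s : Finset ι) (x : ι → L) (y : ι → L')
    (c : A →ₐ[K] B) (d : A →ₐ[K] B') (a b : A) : biop S T (∑ i ∈ s, x i ⊗ₜ y i) (c a) (d b) =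
      ∑ i ∈ s, post (S (x i)) (pt c).val a * post (T (y i)) (pt d).val b :=
  biop_sum _ _ _ _ _ _ _

end Invariance

section Double

variable {K : Type*} [Field K] {A : Type*} [CommRing A] [HopfAlgebra K A]

theorem lTensorHom_basePt (D : A ⊗[K] A →ₗ[K] A ⊗[K] A) (f : A →ₐ[K] A ⊗[K] A) :
    post (LinearMap.lTensorHom (A ⊗[K] A) D) (pt ((basePt K A).comp f)).val =
      post (basePt K A).toLinearMap (post D (pt f).val) := by
  ext a
  simp

theorem IsDerivAlong.lTensorHom_actPt {D : A ⊗[K] A →ₗ[K] A ⊗[K] A}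
    (hD : IsDerivAlong (AlgHom.id K _) D) (f : A →ₐ[K] A ⊗[K] A) :
    post (LinearMap.lTensorHom (A ⊗[K] A) D) (pt ((actPt K A).comp f)).val = 0 := by
  ext a
  simp [hD.map_one]

theorem IsDerivAlong.lTensorHom_doubleAct_q₁ {D : A ⊗[K] A →ₗ[K] A ⊗[K] A}
    (hD : IsDerivAlong (AlgHom.id K _) D) :
    post (LinearMap.lTensorHom (A ⊗[K] A) D) (pt ((doubleAct K A).comp (q₁ K A))).val =
      (pt ((actPt K A).comp (q₁ K A))).val *
        post (basePt K A).toLinearMap (post D (pt (q₁ K A)).val) *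
        (pt ((actPt K A).comp (q₂ K A)))⁻¹.val := by
  have hD' : IsDerivAlong (AlgHom.id K ((A ⊗[K] A) ⊗[K] (A ⊗[K] A)))
      (LinearMap.lTensorHom (A ⊗[K] A) D) :=
    isDerivAlong_of_tmul fun a b a' b' => by simp [hD b b', TensorProduct.tmul_add]
  rw [doubleAct_comp_q₁]
  simp only [pt_ptMul, pt_ptInv, Units.val_mul, hD'.post_mul, hD'.post_inv, hD.lTensorHom_actPt,
    lTensorHom_basePt, post_pt, post_pt_inv, AlgHom.id_comp]
  simp

theorem IsDerivAlong.lTensorHom_doubleAct_q₂ {D : A ⊗[K] A →ₗ[K] A ⊗[K] A}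
    (hD : IsDerivAlong (AlgHom.id K _) D) :
    post (LinearMap.lTensorHom (A ⊗[K] A) D) (pt ((doubleAct K A).comp (q₂ K A))).val =
      (pt ((actPt K A).comp (q₂ K A))).val *
        post (basePt K A).toLinearMap (post D (pt (q₂ K A)).val) *
        (pt ((actPt K A).comp (q₁ K A)))⁻¹.val := by
  have hD' : IsDerivAlong (AlgHom.id K ((A ⊗[K] A) ⊗[K] (A ⊗[K] A)))
      (LinearMap.lTensorHom (A ⊗[K] A) D) :=
    isDerivAlong_of_tmul fun a b a' b' => by simp [hD b b', TensorProduct.tmul_add]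
  rw [doubleAct_comp_q₂]
  simp only [pt_ptMul, pt_ptInv, Units.val_mul, hD'.post_mul, hD'.post_inv, hD.lTensorHom_actPt,
    lTensorHom_basePt, post_pt, post_pt_inv, AlgHom.id_comp]
  simp

theorem isDerivAlong_lTensorHom {D : A ⊗[K] A →ₗ[K] A ⊗[K] A}
    (hD : IsDerivAlong (AlgHom.id K _) D) : IsDerivAlong (AlgHom.id K _)
      (LinearMap.lTensorHom (A ⊗[K] A) D) :=
  isDerivAlong_of_tmul fun a b a' b' => by simp [hD b b', TensorProduct.tmul_add]

variable {H : lieAlg K A ⊗[K] lieAlg K A}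

theorem extend_biop_doubleAct {S T : lieAlg K A →ₗ[K] A ⊗[K] A →ₗ[K] A ⊗[K] A}
    (hS : ∀ X, IsDerivAlong (AlgHom.id K _) (S X)) (hT : ∀ X, IsDerivAlong (AlgHom.id K _) (T X))
    (hS₂ : ∀ X, post (S X) (pt (q₂ K A)).val = 0) (hT₁ : ∀ X, post (T X) (pt (q₁ K A)).val = 0)
    (h : ∀ a b, biop (LinearMap.lTensorHom (A ⊗[K] A) ∘ₗ S) (LinearMap.lTensorHom (A ⊗[K] A) ∘ₗ T) H
      ((doubleAct K A).comp (q₁ K A) a) ((doubleAct K A).comp (q₂ K A) b) =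
        doubleAct K A (biop S T H (q₁ K A a) (q₂ K A b))) (f g : A ⊗[K] A) :
    extend (A ⊗[K] A) (biop S T H) (doubleAct K A f) (doubleAct K A g) =
      doubleAct K A (biop S T H f g) := by
  rw [extend_biop]
  have h1 := (isBideriv_biop
      (S := LinearMap.lTensorHom (A ⊗[K] A) ∘ₗ S) (T := LinearMap.lTensorHom (A ⊗[K] A) ∘ₗ T)
      (fun X => isDerivAlong_lTensorHom (hS X)) (fun X => isDerivAlong_lTensorHom (hT X)) H).comp
      (doubleAct K A) (doubleAct K A)
  have h2 := (isBideriv_biop hS hT H).algHom_comp (doubleAct K A)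
  rw [AlgHom.id_comp] at h1
  rw [AlgHom.comp_id] at h2
  suffices key : (biop (LinearMap.lTensorHom (A ⊗[K] A) ∘ₗ S)
      (LinearMap.lTensorHom (A ⊗[K] A) ∘ₗ T) H).compl₁₂ (doubleAct K A).toLinearMap
        (doubleAct K A).toLinearMap = (biop S T H).compr₂ (doubleAct K A).toLinearMap from
    LinearMap.congr_fun (LinearMap.congr_fun key f) g
  have hS₂' : ∀ X a, S X (q₂ K A a) = 0 := fun X a =>
    DFunLike.congr_fun (congrArg ofConv (hS₂ X)) a
  have hT₁' : ∀ X a, T X (q₁ K A a) = 0 := fun X a =>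
    DFunLike.congr_fun (congrArg ofConv (hT₁ X)) a
  have hS₂'' : ∀ X a, LinearMap.lTensorHom (A ⊗[K] A) (S X) (doubleAct K A (q₂ K A a)) = 0 :=
    fun X a => by
      have e := (hS X).lTensorHom_doubleAct_q₂
      rw [hS₂] at e
      simpa using DFunLike.congr_fun (congrArg ofConv e) a
  have hT₁'' : ∀ X a, LinearMap.lTensorHom (A ⊗[K] A) (T X) (doubleAct K A (q₁ K A a)) = 0 :=
    fun X a => by
      have e := (hT X).lTensorHom_doubleAct_q₁
      rw [hT₁] at e
      simpa using DFunLike.congr_fun (congrArg ofConv e) a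
  refine h1.ext h2 (fun a b => ?_) (fun a b => ?_) (fun a b => ?_) (fun a b => ?_)
  pick_goal 2
  · exact h a b
  all_goals
    obtain ⟨s, rfl⟩ := TensorProduct.exists_finset H
    simp only [LinearMap.compl₁₂_apply, LinearMap.compr₂_apply, AlgHom.toLinearMap_apply,
      biop_sum, LinearMap.comp_apply, hS₂', hS₂'', hT₁', hT₁'',
      mul_zero, zero_mul, Finset.sum_const_zero, map_zero]

theorem map_sum_mul {ι : Type*} (s : Finset ι) (U V : ι → WithConv (A →ₗ[K] A ⊗[K] A)) (a b : A) :
    doubleAct K A (∑ i ∈ s, U i a * V i b) =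
      ∑ i ∈ s, post (doubleAct K A).toLinearMap (U i) a *
        post (doubleAct K A).toLinearMap (V i) b := by
  simp

theorem IsAdInvSymm.extend_left₁_right₂ (hH : IsAdInvSymm H) (f h : A ⊗[K] A) :
    extend (A ⊗[K] A) (biop (leftOp₁ K A) (rightOp₂ K A) H) (doubleAct K A f) (doubleAct K A h) =
      doubleAct K A (biop (leftOp₁ K A) (rightOp₂ K A) H f h) := by
  refine extend_biop_doubleAct isDerivAlong_leftOp₁ isDerivAlong_rightOp₂ leftOp₁_q₂ rightOp₂_q₁
    (fun a b => ?_) f h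
  obtain ⟨s, rfl⟩ := TensorProduct.exists_finset H
  rw [biop_pt, biop_pt, map_sum_mul]
  simp only [LinearMap.comp_apply, (isDerivAlong_leftOp₁ _).lTensorHom_doubleAct_q₁,
    (isDerivAlong_rightOp₂ _).lTensorHom_doubleAct_q₂, leftOp₁_q₁, rightOp₂_q₂, post_algHom_mul,
    post_pt, post_tan]
  simp only [doubleAct_comp_q₁, doubleAct_comp_q₂, pt_ptMul, pt_ptInv, Units.val_mul]
  have h := hH.pairEq_mul ((actPt K A).comp (q₂ K A))
    ((pt ((actPt K A).comp (q₁ K A))).val * (pt ((basePt K A).comp (q₁ K A))).val *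
      (pt ((actPt K A).comp (q₂ K A)))⁻¹.val) (pt ((actPt K A).comp (q₂ K A)))⁻¹.val
    1 ((pt ((basePt K A).comp (q₂ K A))).val * (pt ((actPt K A).comp (q₁ K A)))⁻¹.val) a b
  simpa only [mul_assoc, Units.inv_mul_cancel_left, Units.mul_inv, one_mul, mul_one] using h

theorem IsAdInvSymm.extend_right₁_left₂ (hH : IsAdInvSymm H) (f h : A ⊗[K] A) :
    extend (A ⊗[K] A) (biop (rightOp₁ K A) (leftOp₂ K A) H) (doubleAct K A f) (doubleAct K A h) =
      doubleAct K A (biop (rightOp₁ K A) (leftOp₂ K A) H f h) := by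
  refine extend_biop_doubleAct isDerivAlong_rightOp₁ isDerivAlong_leftOp₂ rightOp₁_q₂ leftOp₂_q₁
    (fun a b => ?_) f h
  obtain ⟨s, rfl⟩ := TensorProduct.exists_finset H
  rw [biop_pt, biop_pt, map_sum_mul]
  simp only [LinearMap.comp_apply, (isDerivAlong_rightOp₁ _).lTensorHom_doubleAct_q₁,
    (isDerivAlong_leftOp₂ _).lTensorHom_doubleAct_q₂, leftOp₂_q₂, rightOp₁_q₁, post_algHom_mul,
    post_pt, post_tan]
  simp only [doubleAct_comp_q₁, doubleAct_comp_q₂, pt_ptMul, pt_ptInv, Units.val_mul]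
  have h := hH.pairEq_mul ((actPt K A).comp (q₁ K A)) 1
    ((pt ((basePt K A).comp (q₁ K A))).val * (pt ((actPt K A).comp (q₂ K A)))⁻¹.val)
    ((pt ((actPt K A).comp (q₂ K A))).val * (pt ((basePt K A).comp (q₂ K A))).val *
      (pt ((actPt K A).comp (q₁ K A)))⁻¹.val) (pt ((actPt K A).comp (q₁ K A)))⁻¹.val a b
  simpa only [mul_assoc, Units.inv_mul_cancel_left, Units.mul_inv, one_mul, mul_one] using h

theorem IsAdInvSymm.isInvariant_doubleBivector (hH : IsAdInvSymm H) :
    IsInvariant (doubleAct K A) (doubleBivector H) := by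
  intro f h
  have e1 := hH.extend_left₁_right₂ h f
  have e2 := hH.extend_right₁_left₂ h f
  rw [extend_biop, biop_comm hH.symm, ← extend_biop, biop_comm hH.symm] at e1 e2
  simp only [doubleBivector_eq, extend_smul, extend_add, extend_sub, LinearMap.smul_apply,
    LinearMap.add_apply, LinearMap.sub_apply, map_smul, map_add, map_sub, hH.extend_left₁_right₂,
    hH.extend_right₁_left₂, e1, e2]

end Double

end QuasiPoisson.Algebraic

end

noncomputable section

namespace QuasiPoisson.Algebraic

open WithConv

section Double

variable {K : Type*} [Field K] {A : Type*} [CommRing A] [HopfAlgebra K A]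
  {H : lieAlg K A ⊗[K] lieAlg K A}

theorem apply_q_eq_zero {D : A ⊗[K] A →ₗ[K] A ⊗[K] A} {q : A →ₐ[K] A ⊗[K] A}
    (h : post D (pt q).val = 0) (a : A) : D (q a) = 0 :=
  DFunLike.congr_fun (congrArg ofConv h) a

theorem isLieInvariant_of_q₂_q₁ {U V : lieAlg K A →ₗ[K] A ⊗[K] A →ₗ[K] A ⊗[K] A}
    (hU : ∀ X, IsDerivAlong (AlgHom.id K _) (U X)) (hV : ∀ X, IsDerivAlong (AlgHom.id K _) (V X))
    (hU₁ : ∀ X, post (U X) (pt (q₁ K A)).val = 0) (hV₂ : ∀ X, post (V X) (pt (q₂ K A)).val = 0)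
    (h : ∀ X a b, biop (U ∘ₗ LieModule.toEnd K (lieAlg K A) (lieAlg K A) X) V H (q₂ K A a) (q₁ K A b) +
      biop U (V ∘ₗ LieModule.toEnd K (lieAlg K A) (lieAlg K A) X) H (q₂ K A a) (q₁ K A b) = 0) :
    IsLieInvariant U V H := by
  intro X f g
  have key : biop (U ∘ₗ LieModule.toEnd K (lieAlg K A) (lieAlg K A) X) V H + biop U (V ∘ₗ LieModule.toEnd K (lieAlg K A) (lieAlg K A) X) H =
      0 := by
    refine ((isBideriv_biop (S := U ∘ₗ LieModule.toEnd K (lieAlg K A) (lieAlg K A) X)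
      (fun Y => hU ⁅X, Y⁆) hV H).add
      (isBideriv_biop (T := V ∘ₗ LieModule.toEnd K (lieAlg K A) (lieAlg K A) X)
        hU (fun Y => hV ⁅X, Y⁆) H)).ext
      isBideriv_zero (fun a b => ?_) (fun a b => ?_) (fun a b => h X a b) (fun a b => ?_)
    all_goals
      obtain ⟨s, rfl⟩ := TensorProduct.exists_finset H
      simp only [LinearMap.add_apply, biop_sum, LinearMap.comp_apply,
        fun X a => apply_q_eq_zero (hU₁ X) a, fun X a => apply_q_eq_zero (hV₂ X) a, mul_zero,
        zero_mul, Finset.sum_const_zero, LinearMap.zero_apply, add_zero]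
  exact LinearMap.congr_fun (LinearMap.congr_fun key f) g

theorem isLieInvariant_of_q₁_q₂ {U V : lieAlg K A →ₗ[K] A ⊗[K] A →ₗ[K] A ⊗[K] A}
    (hU : ∀ X, IsDerivAlong (AlgHom.id K _) (U X)) (hV : ∀ X, IsDerivAlong (AlgHom.id K _) (V X))
    (hU₂ : ∀ X, post (U X) (pt (q₂ K A)).val = 0) (hV₁ : ∀ X, post (V X) (pt (q₁ K A)).val = 0)
    (h : ∀ X a b, biop (U ∘ₗ LieModule.toEnd K (lieAlg K A) (lieAlg K A) X) V H (q₁ K A a) (q₂ K A b) +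
      biop U (V ∘ₗ LieModule.toEnd K (lieAlg K A) (lieAlg K A) X) H (q₁ K A a) (q₂ K A b) = 0) :
    IsLieInvariant U V H := by
  intro X f g
  have key : biop (U ∘ₗ LieModule.toEnd K (lieAlg K A) (lieAlg K A) X) V H + biop U (V ∘ₗ LieModule.toEnd K (lieAlg K A) (lieAlg K A) X) H =
      0 := by
    refine ((isBideriv_biop (S := U ∘ₗ LieModule.toEnd K (lieAlg K A) (lieAlg K A) X)
      (fun Y => hU ⁅X, Y⁆) hV H).add
      (isBideriv_biop (T := V ∘ₗ LieModule.toEnd K (lieAlg K A) (lieAlg K A) X)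
        hU (fun Y => hV ⁅X, Y⁆) H)).ext
      isBideriv_zero (fun a b => ?_) (fun a b => h X a b) (fun a b => ?_) (fun a b => ?_)
    all_goals
      obtain ⟨s, rfl⟩ := TensorProduct.exists_finset H
      simp only [LinearMap.add_apply, biop_sum, LinearMap.comp_apply,
        fun X a => apply_q_eq_zero (hU₂ X) a, fun X a => apply_q_eq_zero (hV₁ X) a, mul_zero,
        zero_mul, Finset.sum_const_zero, LinearMap.zero_apply, add_zero]
  exact LinearMap.congr_fun (LinearMap.congr_fun key f) g

theorem IsAdInvSymm.isLieInvariant_right₂_left₁ (hH : IsAdInvSymm H) :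
    IsLieInvariant (rightOp₂ K A) (leftOp₁ K A) H := by
  refine isLieInvariant_of_q₂_q₁ isDerivAlong_rightOp₂ isDerivAlong_leftOp₁ rightOp₂_q₁ leftOp₁_q₂
    fun X a b => ?_
  obtain ⟨s, rfl⟩ := TensorProduct.exists_finset H
  simp only [biop_pt, LinearMap.comp_apply, rightOp₂_q₂, leftOp₁_q₁]
  simpa using hH.pairEq_lie_mul X 1 (pt (q₂ K A)).val (pt (q₁ K A)).val 1 a b

theorem IsAdInvSymm.isLieInvariant_right₁_left₂ (hH : IsAdInvSymm H) :
    IsLieInvariant (rightOp₁ K A) (leftOp₂ K A) H := by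
  refine isLieInvariant_of_q₁_q₂ isDerivAlong_rightOp₁ isDerivAlong_leftOp₂ rightOp₁_q₂ leftOp₂_q₁
    fun X a b => ?_
  obtain ⟨s, rfl⟩ := TensorProduct.exists_finset H
  simp only [biop_pt, LinearMap.comp_apply, rightOp₁_q₁, leftOp₂_q₂]
  simpa using hH.pairEq_lie_mul X 1 (pt (q₁ K A)).val (pt (q₂ K A)).val 1 a b

theorem IsAdInvSymm.biop_left₁_left₁ (hH : IsAdInvSymm H) (f g : A ⊗[K] A) :
    biop (leftOp₁ K A) (leftOp₁ K A) H f g = biop (rightOp₁ K A) (rightOp₁ K A) H f g := by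
  have key : biop (leftOp₁ K A) (leftOp₁ K A) H = biop (rightOp₁ K A) (rightOp₁ K A) H := by
    refine (isBideriv_biop isDerivAlong_leftOp₁ isDerivAlong_leftOp₁ H).ext
      (isBideriv_biop isDerivAlong_rightOp₁ isDerivAlong_rightOp₁ H)
      (fun a b => ?_) (fun a b => ?_) (fun a b => ?_) (fun a b => ?_)
    · obtain ⟨s, rfl⟩ := TensorProduct.exists_finset H
      simp only [biop_pt, leftOp₁_q₁, rightOp₁_q₁]
      simpa using hH.pairEq_mul (q₁ K A) 1 1 1 1 a b
    all_goals
      obtain ⟨s, rfl⟩ := TensorProduct.exists_finset H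
      simp only [biop_sum, fun X a => apply_q_eq_zero (leftOp₁_q₂ (A := A) X) a,
        fun X a => apply_q_eq_zero (rightOp₁_q₂ (A := A) X) a, mul_zero, zero_mul]
  exact LinearMap.congr_fun (LinearMap.congr_fun key f) g

theorem IsAdInvSymm.biop_left₂_left₂ (hH : IsAdInvSymm H) (f g : A ⊗[K] A) :
    biop (leftOp₂ K A) (leftOp₂ K A) H f g = biop (rightOp₂ K A) (rightOp₂ K A) H f g := by
  have key : biop (leftOp₂ K A) (leftOp₂ K A) H = biop (rightOp₂ K A) (rightOp₂ K A) H := by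
    refine (isBideriv_biop isDerivAlong_leftOp₂ isDerivAlong_leftOp₂ H).ext
      (isBideriv_biop isDerivAlong_rightOp₂ isDerivAlong_rightOp₂ H)
      (fun a b => ?_) (fun a b => ?_) (fun a b => ?_) (fun a b => ?_)
    pick_goal 4
    · obtain ⟨s, rfl⟩ := TensorProduct.exists_finset H
      simp only [biop_pt, leftOp₂_q₂, rightOp₂_q₂]
      simpa using hH.pairEq_mul (q₂ K A) 1 1 1 1 a b
    all_goals
      obtain ⟨s, rfl⟩ := TensorProduct.exists_finset H
      simp only [biop_sum, fun X a => apply_q_eq_zero (leftOp₂_q₁ (A := A) X) a,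
        fun X a => apply_q_eq_zero (rightOp₂_q₁ (A := A) X) a, mul_zero, zero_mul]
  exact LinearMap.congr_fun (LinearMap.congr_fun key f) g

theorem rTensorHom_comp_lTensorHom (D D' : A →ₗ[K] A) :
    LinearMap.rTensorHom A D ∘ₗ LinearMap.lTensorHom A D' =
      (LinearMap.lTensorHom A D' ∘ₗ LinearMap.rTensorHom A D :
        A ⊗[K] A →ₗ[K] A ⊗[K] A) :=
  TensorProduct.ext' fun a b => by simp

theorem triop_cartanElement_map_add_map {C : Type*} [CommRing C] [HopfAlgebra K C]
    {i j : lieAlg K A →ₗ[K] lieAlg K C} (hi : ∀ X Y, ⁅i X, i Y⁆ = i ⁅X, Y⁆)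
    (hj : ∀ X Y, ⁅j X, j Y⁆ = j ⁅X, Y⁆) (hij : ∀ X Y, ⁅i X, j Y⁆ = 0)
    (S : lieAlg K C →ₗ[K] C →ₗ[K] C) (f g h : C) :
    triop S (cartanElement (TensorProduct.map i i H + TensorProduct.map j j H)) f g h =
      triop (S ∘ₗ i) (cartanElement H) f g h + triop (S ∘ₗ j) (cartanElement H) f g h := by
  rw [cartanElement_map_add_map hi hj hij, triop_add_tensor, triop_map, triop_map]

theorem IsAdInvSymm.isQuasiPoisson_doubleBivector [CharZero K] (hH : IsAdInvSymm H) :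
    IsQuasiPoisson (doubleAct K A) (doubleTensor H) (doubleBivector H) where
  bivector :=
    { skew := fun f h => by
        simp only [doubleBivector_eq, LinearMap.smul_apply, LinearMap.add_apply,
          LinearMap.sub_apply, biop_comm hH.symm (rightOp₂ K A), biop_comm hH.symm (leftOp₂ K A),
          ← smul_neg]
        congr 1
        ring
      leibniz := fun f g h => by
        have := (isBideriv_doubleBivector H).right f g h
        rw [AlgHom.id_apply, AlgHom.id_apply] at this
        rw [this, add_comm, mul_comm] }
  invariant := hH.isInvariant_doubleBivector
  schouten_eq f g h := by
    refine Eq.trans ?_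
      (triop_cartanElement_map_add_map (C := A ⊗[K] A) lie_inl_inl lie_inr_inr lie_inl_inr
        (fund (doubleAct K A)) f g h).symm
    have e1 : fund (doubleAct K A) ∘ₗ inl = leftOp₂ K A - rightOp₁ K A :=
      LinearMap.ext fun X => fund_inl X
    have e2 : fund (doubleAct K A) ∘ₗ inr = leftOp₁ K A - rightOp₂ K A :=
      LinearMap.ext fun X => fund_inr X
    rw [e1, e2, doubleBivector_eq]
    refine schouten_double (fun X => (isDerivAlong_leftOp₁ X).isLeibniz)
      (fun X => (isDerivAlong_rightOp₁ X).isLeibniz) (fun X => (isDerivAlong_leftOp₂ X).isLeibniz)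
      (fun X => (isDerivAlong_rightOp₂ X).isLeibniz) (fun X Y => ?_) (fun X Y => ?_)
      (fun X Y => ?_) (fun X Y => ?_) (fun X Y => ?_) (fun X Y => ?_)
      (fun X Y => rTensorHom_comp_lTensorHom _ _) (fun X Y => rTensorHom_comp_lTensorHom _ _)
      (fun X Y => rTensorHom_comp_lTensorHom _ _) (fun X Y => rTensorHom_comp_lTensorHom _ _)
      hH.symm hH.isLieInvariant_right₂_left₁ hH.isLieInvariant_right₁_left₂ hH.biop_left₁_left₁
      hH.biop_left₂_left₂ f g h
    · simp only [leftOp₁, LinearMap.comp_apply, LinearMap.coe_rTensorHom, ← leftOp_comp_sub,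
        LinearMap.rTensor_sub, LinearMap.rTensor_comp]
    · simp only [rightOp₁, LinearMap.comp_apply, LinearMap.coe_rTensorHom, ← LinearMap.rTensor_neg,
        ← rightOp_comp_sub, LinearMap.rTensor_sub, LinearMap.rTensor_comp]
    · simp only [leftOp₂, LinearMap.comp_apply, LinearMap.coe_lTensorHom, ← leftOp_comp_sub,
        LinearMap.lTensor_sub, LinearMap.lTensor_comp]
    · simp only [rightOp₂, LinearMap.comp_apply, LinearMap.coe_lTensorHom, ← LinearMap.lTensor_neg,
        ← rightOp_comp_sub, LinearMap.lTensor_sub, LinearMap.lTensor_comp]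
    · simp only [leftOp₁, rightOp₁, LinearMap.comp_apply, LinearMap.coe_rTensorHom,
        ← LinearMap.rTensor_comp, leftOp_comp_rightOp]
    · simp only [leftOp₂, rightOp₂, LinearMap.comp_apply, LinearMap.coe_lTensorHom,
        ← LinearMap.lTensor_comp, leftOp_comp_rightOp]

end Double

end QuasiPoisson.Algebraic

end

noncomputable section

namespace QuasiPoisson.Algebraic

open WithConv

section Double

variable {K : Type*} [Field K] {A : Type*} [CommRing A] [HopfAlgebra K A]
  {H : lieAlg K A ⊗[K] lieAlg K A}

theorem doubleMoment_equivariant (u : A ⊗[K] A) : doubleAct K A (doubleMoment K A u) =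
    LinearMap.lTensor (A ⊗[K] A) (doubleMoment K A).toLinearMap (conj K (A ⊗[K] A) u) := by
  set ψ : (A ⊗[K] A) ⊗[K] (A ⊗[K] A) →ₐ[K] (A ⊗[K] A) ⊗[K] (A ⊗[K] A) :=
    Algebra.TensorProduct.map (AlgHom.id K (A ⊗[K] A)) (doubleMoment K A) with hψ
  have h₁ : ∀ f : A →ₐ[K] A ⊗[K] A, ψ.comp ((actPt K A).comp f) = (actPt K A).comp f :=
    fun f => by ext a; simp [hψ]
  have h₂ : ∀ f : A →ₐ[K] A ⊗[K] A, ψ.comp ((basePt K A).comp f) =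
    (basePt K A).comp ((doubleMoment K A).comp f) := fun f => by ext a; simp [hψ]
  have hc : conj K (A ⊗[K] A) = ptMul (ptMul (actPt K A) (basePt K A)) (ptInv (actPt K A)) := rfl
  have key : (doubleAct K A).comp (doubleMoment K A) = ψ.comp (conj K (A ⊗[K] A)) := by
    refine algHom_ext_q ?_ ?_
    · simp only [AlgHom.comp_assoc, doubleMoment_comp_q₁, hc, ptMul_comp_q₁, ptInv_comp_q₁,
        comp_ptMul, comp_ptInv, doubleAct_comp_q₁, doubleAct_comp_q₂, h₁, h₂, pt_ptMul, pt_ptInv]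
      group
    · simp only [AlgHom.comp_assoc, doubleMoment_comp_q₂, hc, ptMul_comp_q₂, ptInv_comp_q₂,
        comp_ptMul, comp_ptInv, doubleAct_comp_q₁, doubleAct_comp_q₂, h₁, h₂, pt_ptMul, pt_ptInv]
      group
  exact DFunLike.congr_fun key u

theorem biop_doubleTensor {C : Type*} [CommRing C] [Algebra K C]
    (S T : lieAlg K (A ⊗[K] A) →ₗ[K] A ⊗[K] A →ₗ[K] C) (u v : A ⊗[K] A) :
    biop S T (doubleTensor H) u v =
      biop (S ∘ₗ inl) (T ∘ₗ inl) H u v + biop (S ∘ₗ inr) (T ∘ₗ inr) H u v := by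
  rw [doubleTensor, biop_add]
  obtain ⟨s, rfl⟩ := TensorProduct.exists_finset H
  simp only [map_sum, TensorProduct.map_tmul, biop_sum, LinearMap.comp_apply]

section Pairs

variable {ι : Type*} (s : Finset ι) (x y : ι → lieAlg K A) (c d : A →ₐ[K] A ⊗[K] A) (a b : A)

theorem doubleBivector_pt : doubleBivector (∑ i ∈ s, x i ⊗ₜ y i) (doubleMoment K A (c a)) (d b) =
    (1 / 2 : K) • (∑ i ∈ s, post (leftOp₁ K A (x i)) (pt ((doubleMoment K A).comp c)).val a *
        post (rightOp₂ K A (y i)) (pt d).val b -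
      ∑ i ∈ s, post (rightOp₂ K A (x i)) (pt ((doubleMoment K A).comp c)).val a *
        post (leftOp₁ K A (y i)) (pt d).val b +
      (∑ i ∈ s, post (rightOp₁ K A (x i)) (pt ((doubleMoment K A).comp c)).val a *
        post (leftOp₂ K A (y i)) (pt d).val b -
      ∑ i ∈ s, post (leftOp₂ K A (x i)) (pt ((doubleMoment K A).comp c)).val a *
        post (rightOp₁ K A (y i)) (pt d).val b)) := by
  simp only [doubleBivector_eq, LinearMap.smul_apply, LinearMap.add_apply, LinearMap.sub_apply,
    biop_sum]
  rfl

theorem biop_fund_pt : biop ((1 / 2 : K) • (LinearMap.llcomp K (A ⊗[K] A) (A ⊗[K] A) (A ⊗[K] A)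
      (doubleMoment K A).toLinearMap ∘ₗ (leftOp + rightOp))) (fund (doubleAct K A))
      (doubleTensor (∑ i ∈ s, x i ⊗ₜ y i)) (c a) (d b) =
    (1 / 2 : K) • (∑ i ∈ s, post (doubleMoment K A).toLinearMap (post (leftOp₁ K A (x i)) (pt c).val +
        post (rightOp₁ K A (x i)) (pt c).val) a * (post (leftOp₂ K A (y i)) (pt d).val -
          post (rightOp₁ K A (y i)) (pt d).val) b +
      ∑ i ∈ s, post (doubleMoment K A).toLinearMap (post (leftOp₂ K A (x i)) (pt c).val +
        post (rightOp₂ K A (x i)) (pt c).val) a * (post (leftOp₁ K A (y i)) (pt d).val -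
          post (rightOp₂ K A (y i)) (pt d).val) b) := by
  rw [biop_doubleTensor, biop_sum, biop_sum, smul_add, Finset.smul_sum, Finset.smul_sum]
  simp only [LinearMap.comp_apply, LinearMap.smul_apply, LinearMap.add_apply, fund_inl, fund_inr,
    leftOp_inl, leftOp_inr, rightOp_inl, rightOp_inr, smul_mul_assoc]
  rfl

end Pairs

theorem IsDerivAlong.doubleMoment_q₁ {D : A ⊗[K] A →ₗ[K] A ⊗[K] A}
    (hD : IsDerivAlong (AlgHom.id K _) D) :
    post D (pt ((doubleMoment K A).comp (q₁ K A))).val =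
      (pt (q₁ K A)).val * post D (pt (q₂ K A)).val +
        post D (pt (q₁ K A)).val * (pt (q₂ K A)).val := by
  rw [doubleMoment_comp_q₁, pt_ptMul, Units.val_mul, hD.post_mul, post_pt, post_pt, AlgHom.id_comp,
    AlgHom.id_comp]

theorem IsDerivAlong.doubleMoment_q₂ {D : A ⊗[K] A →ₗ[K] A ⊗[K] A}
    (hD : IsDerivAlong (AlgHom.id K _) D) :
    post D (pt ((doubleMoment K A).comp (q₂ K A))).val =
      -((pt (q₁ K A))⁻¹.val * (pt (q₂ K A))⁻¹.val * post D (pt (q₂ K A)).val * (pt (q₂ K A))⁻¹.val) -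
        (pt (q₁ K A))⁻¹.val * post D (pt (q₁ K A)).val * (pt (q₁ K A))⁻¹.val *
          (pt (q₂ K A))⁻¹.val := by
  rw [doubleMoment_comp_q₂, pt_ptMul, pt_ptInv, pt_ptInv, Units.val_mul, hD.post_mul, hD.post_inv,
    hD.post_inv]
  simp only [post_pt_inv, AlgHom.id_comp]
  noncomm_ring

theorem post_doubleMoment_mul (f : A →ₐ[K] A ⊗[K] A) (X : lieAlg K A) :
    post (doubleMoment K A).toLinearMap ((pt f).val * tan _ X) =
      (pt ((doubleMoment K A).comp f)).val * tan _ X := by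
  rw [post_algHom_mul, post_pt, post_tan]

theorem post_doubleMoment_mul' (f : A →ₐ[K] A ⊗[K] A) (X : lieAlg K A) :
    post (doubleMoment K A).toLinearMap (tan _ X * (pt f).val) =
      tan _ X * (pt ((doubleMoment K A).comp f)).val := by
  rw [post_algHom_mul, post_pt, post_tan]

theorem pt_doubleMoment_q₁ : (pt ((doubleMoment K A).comp (q₁ K A))).val =
    (pt (q₁ K A)).val * (pt (q₂ K A)).val := by
  rw [doubleMoment_comp_q₁, pt_ptMul, Units.val_mul]

theorem pt_doubleMoment_q₂ : (pt ((doubleMoment K A).comp (q₂ K A))).val =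
    (pt (q₁ K A))⁻¹.val * (pt (q₂ K A))⁻¹.val := by
  rw [doubleMoment_comp_q₂, pt_ptMul, pt_ptInv, pt_ptInv, Units.val_mul]

set_option linter.unusedSimpArgs false in
theorem IsAdInvSymm.momentum_q₁_q₁ (hH : IsAdInvSymm H) (a b : A) :
    doubleBivector H (doubleMoment K A (q₁ K A a)) (q₁ K A b) =
      biop ((1 / 2 : K) • (LinearMap.llcomp K (A ⊗[K] A) (A ⊗[K] A) (A ⊗[K] A)
        (doubleMoment K A).toLinearMap ∘ₗ (leftOp + rightOp))) (fund (doubleAct K A))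
        (doubleTensor H) (q₁ K A a) (q₁ K A b) := by
  obtain ⟨s, rfl⟩ := TensorProduct.exists_finset H
  rw [doubleBivector_pt, biop_fund_pt]
  have h := hH.pairEq_mul (q₁ K A) 1 (pt (q₂ K A)).val 1 1 a b
  congr 1
  simp only [(isDerivAlong_leftOp₁ _).doubleMoment_q₁, (isDerivAlong_leftOp₂ _).doubleMoment_q₁,
    (isDerivAlong_rightOp₁ _).doubleMoment_q₁, (isDerivAlong_rightOp₂ _).doubleMoment_q₁,
    leftOp₁_q₁, leftOp₁_q₂, leftOp₂_q₁, leftOp₂_q₂, rightOp₁_q₁, rightOp₁_q₂, rightOp₂_q₁,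
    rightOp₂_q₂, map_add, map_zero, post_doubleMoment_mul, post_doubleMoment_mul']
  simp only [pt_doubleMoment_q₁, mul_zero, zero_mul, neg_zero, add_zero, zero_add, sub_zero, zero_sub,
    ofConv_zero, LinearMap.zero_apply, Finset.sum_const_zero, mul_assoc, one_mul, mul_one,
    Units.inv_mul_cancel_left, Units.mul_inv_cancel_left, Units.mul_inv, Units.inv_mul] at h ⊢
  simp only [ofConv_add, ofConv_neg, LinearMap.add_apply, LinearMap.neg_apply, add_mul, neg_mul, mul_neg,
    Finset.sum_add_distrib, Finset.sum_neg_distrib] at h ⊢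
  linear_combination -h

set_option linter.unusedSimpArgs false in
theorem IsAdInvSymm.momentum_q₁_q₂ (hH : IsAdInvSymm H) (a b : A) :
    doubleBivector H (doubleMoment K A (q₁ K A a)) (q₂ K A b) =
      biop ((1 / 2 : K) • (LinearMap.llcomp K (A ⊗[K] A) (A ⊗[K] A) (A ⊗[K] A)
        (doubleMoment K A).toLinearMap ∘ₗ (leftOp + rightOp))) (fund (doubleAct K A))
        (doubleTensor H) (q₁ K A a) (q₂ K A b) := by
  obtain ⟨s, rfl⟩ := TensorProduct.exists_finset H
  rw [doubleBivector_pt, biop_fund_pt]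
  have h := hH.pairEq_mul (q₂ K A) (pt (q₁ K A)).val 1 1 1 a b
  congr 1
  simp only [(isDerivAlong_leftOp₁ _).doubleMoment_q₁, (isDerivAlong_leftOp₂ _).doubleMoment_q₁,
    (isDerivAlong_rightOp₁ _).doubleMoment_q₁, (isDerivAlong_rightOp₂ _).doubleMoment_q₁,
    leftOp₁_q₁, leftOp₁_q₂, leftOp₂_q₁, leftOp₂_q₂, rightOp₁_q₁, rightOp₁_q₂, rightOp₂_q₁,
    rightOp₂_q₂, map_add, map_zero, post_doubleMoment_mul, post_doubleMoment_mul']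
  simp only [pt_doubleMoment_q₁, mul_zero, zero_mul, neg_zero, add_zero, zero_add, sub_zero, zero_sub,
    ofConv_zero, LinearMap.zero_apply, Finset.sum_const_zero, mul_assoc, one_mul, mul_one,
    Units.inv_mul_cancel_left, Units.mul_inv_cancel_left, Units.mul_inv, Units.inv_mul] at h ⊢
  simp only [ofConv_add, ofConv_neg, LinearMap.add_apply, LinearMap.neg_apply, add_mul, neg_mul, mul_neg,
    Finset.sum_add_distrib, Finset.sum_neg_distrib] at h ⊢
  linear_combination -h

set_option linter.unusedSimpArgs false in
theorem IsAdInvSymm.momentum_q₂_q₁ (hH : IsAdInvSymm H) (a b : A) :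
    doubleBivector H (doubleMoment K A (q₂ K A a)) (q₁ K A b) =
      biop ((1 / 2 : K) • (LinearMap.llcomp K (A ⊗[K] A) (A ⊗[K] A) (A ⊗[K] A)
        (doubleMoment K A).toLinearMap ∘ₗ (leftOp + rightOp))) (fund (doubleAct K A))
        (doubleTensor H) (q₂ K A a) (q₁ K A b) := by
  obtain ⟨s, rfl⟩ := TensorProduct.exists_finset H
  rw [doubleBivector_pt, biop_fund_pt]
  have h := hH.pairEq_mul (q₁ K A) (pt (q₁ K A))⁻¹.val
    ((pt (q₁ K A))⁻¹.val * (pt (q₂ K A))⁻¹.val) 1 1 a b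
  congr 1
  simp only [(isDerivAlong_leftOp₁ _).doubleMoment_q₂, (isDerivAlong_leftOp₂ _).doubleMoment_q₂,
    (isDerivAlong_rightOp₁ _).doubleMoment_q₂, (isDerivAlong_rightOp₂ _).doubleMoment_q₂,
    leftOp₁_q₁, leftOp₁_q₂, leftOp₂_q₁, leftOp₂_q₂, rightOp₁_q₁, rightOp₁_q₂, rightOp₂_q₁,
    rightOp₂_q₂, map_add, map_zero, post_doubleMoment_mul, post_doubleMoment_mul']
  simp only [pt_doubleMoment_q₂, mul_zero, zero_mul, neg_zero, add_zero, zero_add, sub_zero, zero_sub,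
    ofConv_zero, LinearMap.zero_apply, Finset.sum_const_zero, mul_assoc, one_mul, mul_one,
    Units.inv_mul_cancel_left, Units.mul_inv_cancel_left, Units.mul_inv, Units.inv_mul] at h ⊢
  simp only [ofConv_add, ofConv_neg, LinearMap.add_apply, LinearMap.neg_apply, add_mul, neg_mul, mul_neg,
    Finset.sum_add_distrib, Finset.sum_neg_distrib] at h ⊢
  linear_combination -h

set_option linter.unusedSimpArgs false in
theorem IsAdInvSymm.momentum_q₂_q₂ (hH : IsAdInvSymm H) (a b : A) :
    doubleBivector H (doubleMoment K A (q₂ K A a)) (q₂ K A b) =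
      biop ((1 / 2 : K) • (LinearMap.llcomp K (A ⊗[K] A) (A ⊗[K] A) (A ⊗[K] A)
        (doubleMoment K A).toLinearMap ∘ₗ (leftOp + rightOp))) (fund (doubleAct K A))
        (doubleTensor H) (q₂ K A a) (q₂ K A b) := by
  obtain ⟨s, rfl⟩ := TensorProduct.exists_finset H
  rw [doubleBivector_pt, biop_fund_pt]
  have h := hH.pairEq_mul (q₂ K A)
    ((pt (q₁ K A))⁻¹.val * (pt (q₂ K A))⁻¹.val) (pt (q₂ K A))⁻¹.val 1 1 a b
  congr 1
  simp only [(isDerivAlong_leftOp₁ _).doubleMoment_q₂, (isDerivAlong_leftOp₂ _).doubleMoment_q₂,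
    (isDerivAlong_rightOp₁ _).doubleMoment_q₂, (isDerivAlong_rightOp₂ _).doubleMoment_q₂,
    leftOp₁_q₁, leftOp₁_q₂, leftOp₂_q₁, leftOp₂_q₂, rightOp₁_q₁, rightOp₁_q₂, rightOp₂_q₁,
    rightOp₂_q₂, map_add, map_zero, post_doubleMoment_mul, post_doubleMoment_mul']
  simp only [pt_doubleMoment_q₂, mul_zero, zero_mul, neg_zero, add_zero, zero_add, sub_zero, zero_sub,
    ofConv_zero, LinearMap.zero_apply, Finset.sum_const_zero, mul_assoc, one_mul, mul_one,
    Units.inv_mul_cancel_left, Units.mul_inv_cancel_left, Units.mul_inv, Units.inv_mul] at h ⊢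
  simp only [ofConv_add, ofConv_neg, LinearMap.add_apply, LinearMap.neg_apply, add_mul, neg_mul, mul_neg,
    Finset.sum_add_distrib, Finset.sum_neg_distrib] at h ⊢
  linear_combination -h

theorem IsAdInvSymm.isMomentumMap_doubleMoment (hH : IsAdInvSymm H) :
    IsMomentumMap (doubleAct K A) (doubleTensor H) (doubleBivector H) (doubleMoment K A) where
  equivariant := doubleMoment_equivariant
  momentum a b := by
    have h1 := (isBideriv_doubleBivector H).comp (doubleMoment K A) (AlgHom.id K (A ⊗[K] A))
    have h2 := isBideriv_biop (S := (1 / 2 : K) • (LinearMap.llcomp K (A ⊗[K] A) (A ⊗[K] A)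
      (A ⊗[K] A) (doubleMoment K A).toLinearMap ∘ₗ (leftOp + rightOp))) (T := fund (doubleAct K A))
      (fun X => (((isDerivAlong_leftOp X).add (isDerivAlong_rightOp X)).algHom_comp
        (doubleMoment K A)).smul (1 / 2)) isDerivAlong_fund (doubleTensor H)
    rw [AlgHom.id_comp, AlgHom.id_comp] at h1
    rw [AlgHom.comp_id] at h2
    exact LinearMap.congr_fun (LinearMap.congr_fun
      (h1.ext h2 hH.momentum_q₁_q₁ hH.momentum_q₁_q₂ hH.momentum_q₂_q₁ hH.momentum_q₂_q₂) a) b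

end Double

end QuasiPoisson.Algebraic

end

noncomputable section

namespace QuasiPoisson

open Set Filter Topology

section Calculus

variable {𝕜 : Type*} [NontriviallyNormedField 𝕜]
  {E : Type*} [NormedAddCommGroup E] [NormedSpace 𝕜 E]
  {E' : Type*} [NormedAddCommGroup E'] [NormedSpace 𝕜 E']
  {F : Type*} [NormedAddCommGroup F] [NormedSpace 𝕜 F]
  {H : Type*} [TopologicalSpace H] {I : ModelWithCorners 𝕜 E H} [I.Boundaryless]
  {M : Type*} [TopologicalSpace M] [ChartedSpace H M]
  {H' : Type*} [TopologicalSpace H'] {I' : ModelWithCorners 𝕜 E' H'} [I'.Boundaryless]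
  {M' : Type*} [TopologicalSpace M'] [ChartedSpace H' M']
  {n : WithTop ℕ∞}

/-- The derivative of a vector valued map, as a continuous linear map on the model space. -/
def chartDeriv (I : ModelWithCorners 𝕜 E H) (f : M → F) (x : M) : E →L[𝕜] F :=
  mfderiv I 𝓘(𝕜, F) f x

theorem chartDeriv_eq_fderiv (f : M → F) (x : M) :
    chartDeriv I f x =
      fderiv 𝕜 (fun v => f ((extChartAt I x).symm v)) (extChartAt I x x) := by
  by_cases h : MDifferentiableAt I 𝓘(𝕜, F) f x
  · rw [chartDeriv, h.mfderiv]
    simp only [writtenInExtChartAt, mfld_simps, I.range_eq_univ, fderivWithin_univ]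
    rfl
  · rw [chartDeriv, mfderiv_zero_of_not_mdifferentiableAt h, fderiv_zero_of_not_differentiableAt]
    · rfl
    intro hd
    apply h
    rw [mdifferentiableAt_iff]
    refine ⟨?_, ?_⟩
    · have h1 := ContinuousAt.comp (f := extChartAt I x) (x := x) hd.continuousAt
        (continuousAt_extChartAt x)
      refine h1.congr ?_
      filter_upwards [extChartAt_source_mem_nhds (I := I) x] with y hy
      exact congrArg f ((extChartAt I x).left_inv hy)
    · simp only [writtenInExtChartAt, mfld_simps, I.range_eq_univ, differentiableWithinAt_univ]
      exact hd

theorem fderiv_fderiv_comm {f : E × E' → F} {x : E} {y : E'} (hf : ContDiffAt 𝕜 n f (x, y))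
    (hn : minSmoothness 𝕜 2 ≤ n) (X : E) (Y : E') :
    fderiv 𝕜 (fun u => fderiv 𝕜 (fun v => f (u, v)) y Y) x X =
      fderiv 𝕜 (fun v => fderiv 𝕜 (fun u => f (u, v)) x X) y Y := by
  have h2 : (2 : WithTop ℕ∞) ≤ n := le_minSmoothness.trans hn
  have hsymm := hf.isSymmSndFDerivAt hn
  have hd : ∀ᶠ p in 𝓝 (x, y), DifferentiableAt 𝕜 f p := by
    have := (hf.of_le (show (1 : WithTop ℕ∞) ≤ n from le_trans (by norm_num) h2)).eventually
      (by simp)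
    filter_upwards [this] with p hp using hp.differentiableAt (by simp)
  have hdd : DifferentiableAt 𝕜 (fderiv 𝕜 f) (x, y) :=
    (hf.fderiv_right (m := 1) (by rw [one_add_one_eq_two]; exact h2)).differentiableAt (by simp)
  have e1 : (fun u => fderiv 𝕜 (fun v => f (u, v)) y Y) =ᶠ[𝓝 x]
      fun u => fderiv 𝕜 f (u, y) (0, Y) := by
    have hc : Tendsto (fun u : E => (u, y)) (𝓝 x) (𝓝 (x, y)) :=
      (Continuous.prodMk_left y).continuousAt
    filter_upwards [hc.eventually hd] with u hu
    have := hu.hasFDerivAt.comp y (hasFDerivAt_prodMk_right u y)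
    rw [HasFDerivAt.fderiv (f := fun v => f (u, v)) this]
    simp
  have e2 : (fun v => fderiv 𝕜 (fun u => f (u, v)) x X) =ᶠ[𝓝 y]
      fun v => fderiv 𝕜 f (x, v) (X, 0) := by
    have hc : Tendsto (fun v : E' => (x, v)) (𝓝 y) (𝓝 (x, y)) :=
      (Continuous.prodMk_right x).continuousAt
    filter_upwards [hc.eventually hd] with v hv
    have := hv.hasFDerivAt.comp x (hasFDerivAt_prodMk_left (𝕜 := 𝕜) x v)
    rw [HasFDerivAt.fderiv (f := fun u => f (u, v)) this]
    simp
  rw [e1.fderiv_eq, e2.fderiv_eq]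
  have d1 := (hdd.hasFDerivAt.comp x (hasFDerivAt_prodMk_left (𝕜 := 𝕜) x y)).clm_apply
    (hasFDerivAt_const ((0, Y) : E × E') x)
  have d2 := (hdd.hasFDerivAt.comp y (hasFDerivAt_prodMk_right x y)).clm_apply
    (hasFDerivAt_const ((X, 0) : E × E') y)
  rw [HasFDerivAt.fderiv (f := fun u => fderiv 𝕜 f (u, y) (0, Y)) d1,
    HasFDerivAt.fderiv (f := fun v => fderiv 𝕜 f (x, v) (X, 0)) d2]
  simpa using hsymm (X, 0) (0, Y)

variable [IsManifold I n M] [IsManifold I' n M']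

theorem contMDiffAt_extChartAt_symm_self (x : M) :
    ContMDiffAt 𝓘(𝕜, E) I n (extChartAt I x).symm (extChartAt I x x) := by
  have h := contMDiffOn_extChartAt_symm (I := I) (n := n) x
  refine h.contMDiffAt ?_
  exact extChartAt_target_mem_nhds x

/-- Mixed partial derivatives on a product of manifolds commute. -/
theorem chartDeriv_chartDeriv_comm {f : M → M' → F} {x : M} {y : M'}
    (hf : ContMDiffAt (I.prod I') 𝓘(𝕜, F) n (fun p : M × M' => f p.1 p.2) (x, y))
    (hn : minSmoothness 𝕜 2 ≤ n) (X : E) (Y : E') :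
    chartDeriv I (fun u => chartDeriv I' (fun v => f u v) y Y) x X =
      chartDeriv I' (fun v => chartDeriv I (fun u => f u v) x X) y Y := by
  simp only [chartDeriv_eq_fderiv]
  refine fderiv_fderiv_comm (n := n) (f := fun p : E × E' =>
    f ((extChartAt I x).symm p.1) ((extChartAt I' y).symm p.2)) ?_ hn X Y
  rw [← contMDiffAt_iff_contDiffAt]
  have h1 : ContMDiffAt 𝓘(𝕜, E × E') (I.prod I') n (fun p : E × E' =>
      ((extChartAt I x).symm p.1, (extChartAt I' y).symm p.2))
      (extChartAt I x x, extChartAt I' y y) := by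
    refine ContMDiffAt.prodMk ?_ ?_
    · exact ContMDiffAt.comp (I' := 𝓘(𝕜, E)) (extChartAt I x x, extChartAt I' y y)
        (contMDiffAt_extChartAt_symm_self x) contDiffAt_fst.contMDiffAt
    · exact ContMDiffAt.comp (I' := 𝓘(𝕜, E')) (extChartAt I x x, extChartAt I' y y)
        (contMDiffAt_extChartAt_symm_self y) contDiffAt_snd.contMDiffAt
  refine ContMDiffAt.comp (g := fun p : M × M' => f p.1 p.2)
    (extChartAt I x x, extChartAt I' y y) ?_ h1
  simpa using hf

end Calculus

end QuasiPoisson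

end

noncomputable section

namespace QuasiPoisson

open Set Filter Topology VectorField

section Calculus

variable {𝕜 : Type*} [NontriviallyNormedField 𝕜]
  {E : Type*} [NormedAddCommGroup E] [NormedSpace 𝕜 E]
  {E' : Type*} [NormedAddCommGroup E'] [NormedSpace 𝕜 E']
  {F : Type*} [NormedAddCommGroup F] [NormedSpace 𝕜 F]
  {H : Type*} [TopologicalSpace H] {I : ModelWithCorners 𝕜 E H}
  {M : Type*} [TopologicalSpace M] [ChartedSpace H M]
  {H' : Type*} [TopologicalSpace H'] {I' : ModelWithCorners 𝕜 E' H'}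
  {M' : Type*} [TopologicalSpace M'] [ChartedSpace H' M']
  {n m : WithTop ℕ∞}

theorem eventually_mdifferentiableAt [IsManifold I 1 M] {f : M → F} {x : M}
    (hf : ContMDiffAt I 𝓘(𝕜, F) n f x) (hn : 1 ≤ n) :
    ∀ᶠ y in 𝓝 x, MDifferentiableAt I 𝓘(𝕜, F) f y := by
  filter_upwards [(contMDiffAt_iff_contMDiffAt_nhds (by simp)).1 (hf.of_le hn)] with y hy using
    hy.mdifferentiableAt (by simp)

theorem mpullbackWithin_extChartAt_symm_self [IsManifold I 1 M] (W : Π y : M, TangentSpace I y)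
    (x : M) : (mpullbackWithin 𝓘(𝕜, E) I (extChartAt I x).symm W (range I) (extChartAt I x x) : E) =
      W x := by
  rw [mpullbackWithin_apply]
  have := mfderivWithin_extChartAt_symm_inverse_apply (I := I) (x := x) (W x)
  have e3 : (extChartAt I x).symm (extChartAt I x x) = x := extChartAt_to_inv x
  refine Eq.trans ?_ this
  exact congrArg (mfderivWithin 𝓘(𝕜, E) I (extChartAt I x).symm (range I) (extChartAt I x x) :
    E →L[𝕜] E).inverse (congrArg (fun y => (W y : E)) e3)

variable [I.Boundaryless]

theorem contMDiffAt_chartDeriv [IsManifold I n M] [IsManifold I' 1 M'] {f : M' → M → F} {x : M'} {y : M}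
    (hf : ContMDiffAt (I'.prod I) 𝓘(𝕜, F) n (fun p : M' × M => f p.1 p.2) (x, y))
    (hmn : m + 1 ≤ n) (Y : E) : ContMDiffAt I' 𝓘(𝕜, F) m (fun u => chartDeriv I (f u) y Y) x := by
  simp only [chartDeriv_eq_fderiv]
  have h1 : ContMDiffAt (I'.prod 𝓘(𝕜, E)) 𝓘(𝕜, F) n
      (Function.uncurry fun (u : M') (v : E) => f u ((extChartAt I y).symm v))
      (x, extChartAt I y y) := by
    refine ContMDiffAt.comp (I' := I'.prod I) (g := fun p : M' × M => f p.1 p.2)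
      (x, extChartAt I y y) ?_ (ContMDiffAt.prodMk contMDiffAt_fst
        (ContMDiffAt.comp (I' := 𝓘(𝕜, E)) (x, extChartAt I y y)
        (contMDiffAt_extChartAt_symm_self y) contMDiffAt_snd))
    simpa using hf
  have h2 := ContMDiffAt.mfderiv_apply (m := m) (x₀ := x)
    (fun (u : M') (v : E) => f u ((extChartAt I y).symm v)) (fun _ => extChartAt I y y) id
    (fun _ => Y) h1 contMDiffAt_const contMDiffAt_id contMDiffAt_const hmn
  simpa only [inTangentCoordinates_model_space, mfderiv_eq_fderiv, id_eq] using h2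

theorem chartDeriv_apply_field [CompleteSpace E] [IsManifold I 1 M] [IsManifold I n M] {u : M → F} {x : M}
    (hu : ContMDiffAt I 𝓘(𝕜, F) n u x) (hn : 2 ≤ n) {W : Π y : M, TangentSpace I y}
    (hW : MDifferentiableAt I I.tangent (fun y => (⟨y, W y⟩ : TangentBundle I M)) x) (X : E) :
    chartDeriv I (fun y => chartDeriv I u y (W y)) x X =
      (fderiv 𝕜 (fderiv 𝕜 fun v => u ((extChartAt I x).symm v)) (extChartAt I x x) X) (W x) +
      fderiv 𝕜 (fun v => u ((extChartAt I x).symm v)) (extChartAt I x x)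
        (fderiv 𝕜 (mpullbackWithin 𝓘(𝕜, E) I (extChartAt I x).symm W (range I))
          (extChartAt I x x) X) := by
  have : IsManifold I 2 M := IsManifold.of_le hn
  set φ := extChartAt I x with hφ
  set W' : E → E := mpullbackWithin 𝓘(𝕜, E) I φ.symm W (range I) with hW'
  have hWd : DifferentiableAt 𝕜 W' (φ x) := by
    rw [← mdifferentiableWithinAt_univ] at hW
    have := hW.differentiableWithinAt_mpullbackWithin_vectorField
    have hr : (extChartAt I x).symm ⁻¹' univ ∩ range I = univ := by simp [I.range_eq_univ]
    rw [hr] at this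
    exact differentiableWithinAt_univ.1 this
  have hu' : ContDiffAt 𝕜 n (fun v => u (φ.symm v)) (φ x) := by
    rw [← contMDiffAt_iff_contDiffAt]
    refine ContMDiffAt.comp (I' := I) (φ x) ?_ (contMDiffAt_extChartAt_symm_self x)
    simpa [hφ] using hu
  have hdd : DifferentiableAt 𝕜 (fderiv 𝕜 fun v => u (φ.symm v)) (φ x) :=
    (hu'.fderiv_right (m := 1) (by rw [one_add_one_eq_two]; exact hn)).differentiableAt (by simp)
  have hev : (fun v => chartDeriv I u (φ.symm v) (W (φ.symm v))) =ᶠ[𝓝 (φ x)]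
      fun v => fderiv 𝕜 (fun v => u (φ.symm v)) v (W' v) := by
    have h1 : ∀ᶠ v in 𝓝 (φ x), MDifferentiableAt I 𝓘(𝕜, F) u (φ.symm v) := by
      have hc : Tendsto φ.symm (𝓝 (φ x)) (𝓝 x) := by
        have := continuousAt_extChartAt_symm (I := I) x
        simpa [ContinuousAt, hφ] using this
      exact hc.eventually (eventually_mdifferentiableAt hu (le_trans (by norm_num) hn))
    filter_upwards [h1, extChartAt_target_mem_nhds (I := I) x] with v hv hvt
    have hinv := isInvertible_mfderivWithin_extChartAt_symm (I := I) hvt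
    have hφd : MDifferentiableAt 𝓘(𝕜, E) I φ.symm v :=
      ((contMDiffOn_extChartAt_symm (I := I) (n := 1) x).contMDiffAt
        ((isOpen_extChartAt_target x).mem_nhds hvt)).mdifferentiableAt (by simp)
    have hc := mfderiv_comp v (g := u) (f := φ.symm) hv hφd
    rw [mfderiv_eq_fderiv] at hc
    have hc' := DFunLike.congr_fun hc (W' v)
    refine Eq.trans ?_ hc'.symm
    have e1 : mfderiv 𝓘(𝕜, E) I φ.symm v = mfderivWithin 𝓘(𝕜, E) I φ.symm (range I) v := by
      rw [I.range_eq_univ, mfderivWithin_univ]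
    have e2 : (mfderiv 𝓘(𝕜, E) I φ.symm v) (W' v) = W (φ.symm v) := by
      rw [e1]
      obtain ⟨e, he⟩ := hinv
      rw [hW', mpullbackWithin_apply, ← he, ContinuousLinearMap.inverse_equiv]
      exact e.apply_symm_apply _
    exact congrArg (chartDeriv I u (φ.symm v)) e2.symm
  have hWx : W' (φ x) = W x := mpullbackWithin_extChartAt_symm_self W x
  rw [chartDeriv_eq_fderiv, hev.fderiv_eq, fderiv_clm_apply hdd hWd]
  rw [hWx, add_comm]
  rfl

theorem chartDeriv_mlieBracket [CompleteSpace E] [IsManifold I 1 M] [IsManifold I n M] {u : M → F} {x : M}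
    (hu : ContMDiffAt I 𝓘(𝕜, F) n u x) (hn : minSmoothness 𝕜 2 ≤ n)
    {V W : Π y : M, TangentSpace I y}
    (hV : MDifferentiableAt I I.tangent (fun y => (⟨y, V y⟩ : TangentBundle I M)) x)
    (hW : MDifferentiableAt I I.tangent (fun y => (⟨y, W y⟩ : TangentBundle I M)) x) :
    chartDeriv I u x (mlieBracket I V W x) =
      chartDeriv I (fun y => chartDeriv I u y (W y)) x (V x) -
        chartDeriv I (fun y => chartDeriv I u y (V y)) x (W x) := by
  have h2 : (2 : WithTop ℕ∞) ≤ n := le_minSmoothness.trans hn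
  have hu' : ContDiffAt 𝕜 n (fun v => u ((extChartAt I x).symm v)) (extChartAt I x x) := by
    rw [← contMDiffAt_iff_contDiffAt]
    refine ContMDiffAt.comp (I' := I) (extChartAt I x x) ?_ (contMDiffAt_extChartAt_symm_self x)
    simpa using hu
  have hs := hu'.isSymmSndFDerivAt hn (V x) (W x)
  have hb : (mlieBracket I V W x : E) =
      fderiv 𝕜 (mpullbackWithin 𝓘(𝕜, E) I (extChartAt I x).symm W (range I))
          (extChartAt I x x) (V x) -
      fderiv 𝕜 (mpullbackWithin 𝓘(𝕜, E) I (extChartAt I x).symm V (range I))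
          (extChartAt I x x) (W x) := by
    have hr : (extChartAt I x).symm ⁻¹' univ ∩ range I = univ := by simp [I.range_eq_univ]
    have e1 := mlieBracketWithin_apply (I := I) (V := V) (W := W) (s := univ) (x₀ := x)
    rw [mlieBracketWithin_univ, mfderiv_extChartAt_self, hr] at e1
    refine e1.trans ((DFunLike.congr_fun (ContinuousLinearMap.inverse_id (R := 𝕜) (M := E))
      _).trans ((congrFun (lieBracketWithin_univ (𝕜 := 𝕜) (E := E)) _).trans ?_))
    exact congrArg₂ (fun a b : E => a - b)
      (congrArg _ (mpullbackWithin_extChartAt_symm_self V x))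
      (congrArg _ (mpullbackWithin_extChartAt_symm_self W x))
  set D := fderiv 𝕜 (fun v => u ((extChartAt I x).symm v)) (extChartAt I x x) with hD
  refine ((DFunLike.congr_fun (chartDeriv_eq_fderiv (I := I) u x) _).trans (congrArg D hb)).trans
    ((D.map_sub _ _).trans (Eq.symm ((congrArg₂ (fun a b : F => a - b)
      (chartDeriv_apply_field hu h2 hW (V x)) (chartDeriv_apply_field hu h2 hV (W x))).trans ?_)))
  rw [hs]
  exact add_sub_add_left_eq_sub _ _ _

end Calculus

section TangentSpaces

variable {𝕜 : Type*} [NontriviallyNormedField 𝕜]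
  {E : Type*} [NormedAddCommGroup E] [NormedSpace 𝕜 E]
  {E' : Type*} [NormedAddCommGroup E'] [NormedSpace 𝕜 E']
  {F : Type*} [NormedAddCommGroup F] [NormedSpace 𝕜 F]
  {H : Type*} [TopologicalSpace H] {I : ModelWithCorners 𝕜 E H}
  {M : Type*} [TopologicalSpace M] [ChartedSpace H M]
  {H' : Type*} [TopologicalSpace H'] {I' : ModelWithCorners 𝕜 E' H'}
  {M' : Type*} [TopologicalSpace M'] [ChartedSpace H' M']
  {n m : WithTop ℕ∞}

/-- The derivative of a vector valued map, as a continuous linear map on the tangent space. -/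
def tderiv (I : ModelWithCorners 𝕜 E H) (f : M → F) (x : M) : TangentSpace I x →L[𝕜] F :=
  (chartDeriv I f x : E →L[𝕜] F)

theorem tderiv_congr {f g : M → F} {x : M} (h : f =ᶠ[𝓝 x] g) : tderiv I f x = tderiv I g x :=
  h.mfderiv_eq

theorem tderiv_comp {f : M' → F} {φ : M → M'} {x : M}
    (hf : MDifferentiableAt I' 𝓘(𝕜, F) f (φ x)) (hφ : MDifferentiableAt I I' φ x) :
    tderiv I (fun y => f (φ y)) x = (tderiv I' f (φ x)).comp (mfderiv I I' φ x) :=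
  mfderiv_comp x hf hφ

theorem contMDiffAt_tderiv [I.Boundaryless] [IsManifold I n M] [IsManifold I' 1 M']
    {f : M' → M → F} {x : M'} {y : M}
    (hf : ContMDiffAt (I'.prod I) 𝓘(𝕜, F) n (fun p : M' × M => f p.1 p.2) (x, y))
    (hmn : m + 1 ≤ n) (Y : TangentSpace I y) :
    ContMDiffAt I' 𝓘(𝕜, F) m (fun u => tderiv I (f u) y Y) x :=
  contMDiffAt_chartDeriv hf hmn Y

theorem tderiv_mlieBracket [I.Boundaryless] [CompleteSpace E] [IsManifold I 1 M] [IsManifold I n M]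
    {u : M → F} {x : M}
    (hu : ContMDiffAt I 𝓘(𝕜, F) n u x) (hn : minSmoothness 𝕜 2 ≤ n)
    {V W : Π y : M, TangentSpace I y}
    (hV : MDifferentiableAt I I.tangent (fun y => (⟨y, V y⟩ : TangentBundle I M)) x)
    (hW : MDifferentiableAt I I.tangent (fun y => (⟨y, W y⟩ : TangentBundle I M)) x) :
    tderiv I u x (mlieBracket I V W x) =
      tderiv I (fun y => tderiv I u y (W y)) x (V x) -
        tderiv I (fun y => tderiv I u y (V y)) x (W x) :=
  chartDeriv_mlieBracket hu hn hV hW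

theorem tderiv_tderiv_comm [I.Boundaryless] [I'.Boundaryless] [IsManifold I n M]
    [IsManifold I' n M'] {f : M → M' → F} {x : M} {y : M'}
    (hf : ContMDiffAt (I.prod I') 𝓘(𝕜, F) n (fun p : M × M' => f p.1 p.2) (x, y))
    (hn : minSmoothness 𝕜 2 ≤ n) (X : TangentSpace I x) (Y : TangentSpace I' y) :
    tderiv I (fun u => tderiv I' (fun v => f u v) y Y) x X =
      tderiv I' (fun v => tderiv I (fun u => f u v) x X) y Y :=
  chartDeriv_chartDeriv_comm hf hn X Y

end TangentSpaces

end QuasiPoisson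

end

noncomputable section

namespace QuasiPoisson

open Set Filter Topology VectorField

section Motions

variable {𝕜 : Type*} [NontriviallyNormedField 𝕜]
  {E : Type*} [NormedAddCommGroup E] [NormedSpace 𝕜 E]
  {E' : Type*} [NormedAddCommGroup E'] [NormedSpace 𝕜 E']
  {F : Type*} [NormedAddCommGroup F] [NormedSpace 𝕜 F]
  {H : Type*} [TopologicalSpace H] {J : ModelWithCorners 𝕜 E H}
  {G : Type*} [TopologicalSpace G] [ChartedSpace H G] [Group G]
  {H' : Type*} [TopologicalSpace H'] {I : ModelWithCorners 𝕜 E' H'}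
  {M : Type*} [TopologicalSpace M] [ChartedSpace H' M]
  {n k : WithTop ℕ∞}

theorem one_le_of_minSmoothness_le (hk : minSmoothness 𝕜 2 ≤ k) : 1 ≤ k :=
  le_trans (by norm_num) (le_minSmoothness.trans hk : (2 : WithTop ℕ∞) ≤ k)

theorem ne_zero_of_minSmoothness_le (hk : minSmoothness 𝕜 2 ≤ k) : k ≠ 0 :=
  (lt_of_lt_of_le (by norm_num) (one_le_of_minSmoothness_le hk)).ne'

/-- The commutator of left invariant vector fields at the identity, on functions. -/
theorem tderiv_lie [CompleteSpace E] [J.Boundaryless] [LieGroup J (minSmoothness 𝕜 3) G]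
    [LieGroup J k G] (hk : minSmoothness 𝕜 2 ≤ k) {u : G → F} (hu : ContMDiffAt J 𝓘(𝕜, F) k u 1)
    (X Y : GroupLieAlgebra J G) :
    tderiv J u 1 ⁅X, Y⁆ =
      tderiv J (fun h => tderiv J (fun g => u (h * g)) 1 Y) 1 X -
        tderiv J (fun h => tderiv J (fun g => u (h * g)) 1 X) 1 Y := by
  have hk1 : 1 ≤ k := one_le_of_minSmoothness_le hk
  have : IsManifold J 1 G := IsManifold.of_le hk1
  have hev : ∀ X : GroupLieAlgebra J G, (fun h => tderiv J (fun g => u (h * g)) 1 X) =ᶠ[𝓝 1]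
      fun h => tderiv J u h (mulInvariantVectorField X h) := fun X => by
    filter_upwards [eventually_mdifferentiableAt hu hk1] with h hh
    have h1 : MDifferentiableAt J J (fun g => h * g) 1 :=
      (contMDiff_mul_left (I := J) (n := k) (a := h)).contMDiffAt.mdifferentiableAt
        (ne_zero_of_minSmoothness_le hk)
    have h2 : MDifferentiableAt J 𝓘(𝕜, F) u (h * 1) := by rwa [mul_one]
    rw [tderiv_comp h2 h1, mul_one]
    rfl
  have hone : ∀ X : GroupLieAlgebra J G, mulInvariantVectorField X (1 : G) = X := fun X => by
    have : (fun g : G => 1 * g) = id := by ext g; simp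
    have h : mfderiv J J (fun g : G => 1 * g) 1 = mfderiv J J id (1 : G) := by rw [this]
    rw [mfderiv_id] at h
    exact DFunLike.congr_fun h X
  have h := tderiv_mlieBracket hu hk (mdifferentiableAt_mulInvariantVectorField (I := J) X)
    (mdifferentiableAt_mulInvariantVectorField (I := J) Y)
  rw [tderiv_congr (hev X), tderiv_congr (hev Y)]
  rw [GroupLieAlgebra.bracket_def]
  refine h.trans (congrArg₂ (fun a b : F => a - b) ?_ ?_)
  · exact congrArg _ (hone X)
  · exact congrArg _ (hone Y)

/-- The velocity at the identity of the curve `a m` through `m`. -/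
def velocity (J : ModelWithCorners 𝕜 E H) (I : ModelWithCorners 𝕜 E' H') (a : M → G → M) (m : M) :
    GroupLieAlgebra J G →L[𝕜] TangentSpace I m :=
  (mfderiv J I (a m) 1 : E →L[𝕜] E')

/-- The derivative of a function `f` along the vector field `m ↦ d/dt a(m, exp (tX))`. -/
def along (J : ModelWithCorners 𝕜 E H) (I : ModelWithCorners 𝕜 E' H') (a : M → G → M)
    (X : GroupLieAlgebra J G) (f : M → 𝕜) (m : M) : 𝕜 :=
  tderiv I f m (velocity J I a m X)

/-- A family of curves of class `C^n` through the points of `M`, parametrized by `G`. -/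
structure IsMotion (J : ModelWithCorners 𝕜 E H) (I : ModelWithCorners 𝕜 E' H') (n : WithTop ℕ∞)
    (a : M → G → M) : Prop where
  contMDiff : ContMDiff (I.prod J) I n (fun p : M × G => a p.1 p.2)
  map_one : ∀ m, a m 1 = m

variable {a b : M → G → M}

theorem IsMotion.of_le (ha : IsMotion J I n a) (hkn : k ≤ n) : IsMotion J I k a :=
  ⟨ha.contMDiff.of_le hkn, ha.map_one⟩

theorem IsMotion.contMDiff_right (ha : IsMotion J I n a) (m : M) : ContMDiff J I n (a m) :=
  ha.contMDiff.comp (contMDiff_const.prodMk contMDiff_id)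

theorem IsMotion.tendsto (ha : IsMotion J I n a) (m : M) : Tendsto (a m) (𝓝 1) (𝓝 m) := by
  have h := (ha.contMDiff_right m).continuous.continuousAt (x := 1)
  rwa [ContinuousAt, ha.map_one] at h

theorem IsMotion.contMDiffAt_comp (ha : IsMotion J I k a) {f : M → F} {x : M}
    (hf : ContMDiffAt I 𝓘(𝕜, F) k f x) :
    ContMDiffAt (I.prod J) 𝓘(𝕜, F) k (fun p : M × G => f (a p.1 p.2)) (x, 1) := by
  refine ContMDiffAt.comp (x, (1 : G)) (g := f) ?_ ha.contMDiff.contMDiffAt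
  rwa [ha.map_one]

theorem IsMotion.along_eq (ha : IsMotion J I k a) (hk : k ≠ 0) {f : M → 𝕜} {m : M}
    (hf : MDifferentiableAt I 𝓘(𝕜, 𝕜) f m) (X : GroupLieAlgebra J G) :
    along J I a X f m = tderiv J (fun g => f (a m g)) 1 X := by
  have h1 : MDifferentiableAt I 𝓘(𝕜, 𝕜) f (a m 1) := by rwa [ha.map_one]
  rw [tderiv_comp h1 ((ha.contMDiff_right m).contMDiffAt.mdifferentiableAt hk), ha.map_one]
  rfl

theorem IsMotion.contMDiffAt_comp_comp (ha : IsMotion J I k a) (hb : IsMotion J I k b)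
    {f : M → F} {x : M} (hf : ContMDiffAt I 𝓘(𝕜, F) k f x) :
    ContMDiffAt (J.prod J) 𝓘(𝕜, F) k (fun p : G × G => f (b (a x p.1) p.2)) (1, 1) := by
  have h1 : ContMDiff (J.prod J) (I.prod J) k (fun p : G × G => (a x p.1, p.2)) :=
    ((ha.contMDiff_right x).comp contMDiff_fst).prodMk contMDiff_snd
  refine ContMDiffAt.comp ((1 : G), (1 : G)) (g := fun p : M × G => f (b p.1 p.2)) ?_
    h1.contMDiffAt
  rw [ha.map_one]
  exact hb.contMDiffAt_comp hf

variable [IsManifold I 1 M]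

theorem IsMotion.along_eventuallyEq (ha : IsMotion J I k a) (hk : 1 ≤ k) {f : M → 𝕜} {x : M}
    (hf : ContMDiffAt I 𝓘(𝕜, 𝕜) k f x) (X : GroupLieAlgebra J G) :
    along J I a X f =ᶠ[𝓝 x] fun m => tderiv J (fun g => f (a m g)) 1 X := by
  filter_upwards [eventually_mdifferentiableAt hf hk] with m hm
  exact ha.along_eq (lt_of_lt_of_le (by norm_num) hk).ne' hm X

theorem IsMotion.contMDiffAt_along [J.Boundaryless] [IsManifold J n G] (ha : IsMotion J I n a)
    (hkn : k + 1 ≤ n)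
    {f : M → 𝕜} {x : M} (hf : ContMDiffAt I 𝓘(𝕜, 𝕜) n f x) (X : GroupLieAlgebra J G) :
    ContMDiffAt I 𝓘(𝕜, 𝕜) k (along J I a X f) x :=
  ContMDiffAt.congr_of_eventuallyEq (contMDiffAt_tderiv (ha.contMDiffAt_comp hf) hkn X)
    (ha.along_eventuallyEq (le_trans le_add_self hkn) hf X)

variable [J.Boundaryless]

theorem IsMotion.along_along [IsManifold J k G] (ha : IsMotion J I k a) (hb : IsMotion J I k b)
    (hk : minSmoothness 𝕜 2 ≤ k) {f : M → 𝕜} {x : M} (hf : ContMDiffAt I 𝓘(𝕜, 𝕜) k f x)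
    (X Y : GroupLieAlgebra J G) : along J I a X (along J I b Y f) x =
      tderiv J (fun h => tderiv J (fun g => f (b (a x h) g)) 1 Y) 1 X := by
  have h2 : (1 : WithTop ℕ∞) + 1 ≤ k := by
    rw [one_add_one_eq_two]
    exact le_minSmoothness.trans hk
  rw [ha.along_eq (ne_zero_of_minSmoothness_le hk)
    ((hb.contMDiffAt_along h2 hf Y).mdifferentiableAt (by simp))]
  exact DFunLike.congr_fun (tderiv_congr ((ha.tendsto x).eventually
    (p := fun m => along J I b Y f m = _) (hb.along_eventuallyEq (one_le_of_minSmoothness_le hk) hf Y))) X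

/-- The vector fields of two commuting families of curves commute. -/
theorem IsMotion.along_comm [IsManifold J k G] (ha : IsMotion J I k a) (hb : IsMotion J I k b)
    (hab : ∀ m g h, b (a m g) h = a (b m h) g)
    (hk : minSmoothness 𝕜 2 ≤ k) {f : M → 𝕜} {x : M} (hf : ContMDiffAt I 𝓘(𝕜, 𝕜) k f x)
    (X Y : GroupLieAlgebra J G) :
    along J I a X (along J I b Y f) x = along J I b Y (along J I a X f) x := by
  rw [ha.along_along hb hk hf, hb.along_along ha hk hf,
    tderiv_tderiv_comm (ha.contMDiffAt_comp_comp hb hf) hk]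
  simp only [hab]

variable [CompleteSpace E] [LieGroup J (minSmoothness 𝕜 3) G] [LieGroup J k G]

theorem IsMotion.along_lie_right (ha : IsMotion J I k a) (haa : ∀ m g h, a (a m g) h = a m (g * h))
    (hk : minSmoothness 𝕜 2 ≤ k) {f : M → 𝕜} {x : M} (hf : ContMDiffAt I 𝓘(𝕜, 𝕜) k f x)
    (X Y : GroupLieAlgebra J G) :
    along J I a X (along J I a Y f) x - along J I a Y (along J I a X f) x =
      along J I a ⁅X, Y⁆ f x := by
  have hu : ContMDiffAt J 𝓘(𝕜, 𝕜) k (fun g => f (a x g)) 1 :=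
    ContMDiffAt.comp (1 : G) (by rwa [ha.map_one]) (ha.contMDiff_right x).contMDiffAt
  rw [ha.along_along ha hk hf, ha.along_along ha hk hf,
    ha.along_eq (ne_zero_of_minSmoothness_le hk)
      (hf.mdifferentiableAt (ne_zero_of_minSmoothness_le hk)), tderiv_lie hk hu]
  simp only [haa]

theorem IsMotion.along_lie_left (ha : IsMotion J I k a) (haa : ∀ m g h, a (a m g) h = a m (h * g))
    (hk : minSmoothness 𝕜 2 ≤ k) {f : M → 𝕜} {x : M} (hf : ContMDiffAt I 𝓘(𝕜, 𝕜) k f x)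
    (X Y : GroupLieAlgebra J G) :
    along J I a X (along J I a Y f) x - along J I a Y (along J I a X f) x =
      -along J I a ⁅X, Y⁆ f x := by
  have hu : ContMDiffAt J 𝓘(𝕜, 𝕜) k (fun g => f (a x g)) 1 :=
    ContMDiffAt.comp (1 : G) (by rwa [ha.map_one]) (ha.contMDiff_right x).contMDiffAt
  have hcomm := tderiv_tderiv_comm (f := fun h g => f (a (a x h) g))
    (ha.contMDiffAt_comp_comp ha hf) hk
  rw [ha.along_along ha hk hf, ha.along_along ha hk hf,
    hcomm X Y, hcomm Y X,
    ha.along_eq (ne_zero_of_minSmoothness_le hk)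
      (hf.mdifferentiableAt (ne_zero_of_minSmoothness_le hk)), tderiv_lie hk hu]
  simp only [haa, neg_sub]

end Motions

end QuasiPoisson

end

noncomputable section

namespace QuasiPoisson

open Set Filter Topology

section Germs

variable {𝕜 : Type*} [NontriviallyNormedField 𝕜]
  {E : Type*} [NormedAddCommGroup E] [NormedSpace 𝕜 E]
  {E' : Type*} [NormedAddCommGroup E'] [NormedSpace 𝕜 E']
  {H : Type*} [TopologicalSpace H] {J : ModelWithCorners 𝕜 E H}
  {G : Type*} [TopologicalSpace G] [ChartedSpace H G] [Group G]
  {H' : Type*} [TopologicalSpace H'] {I : ModelWithCorners 𝕜 E' H'}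
  {M : Type*} [TopologicalSpace M] [ChartedSpace H' M]
  {n : WithTop ℕ∞} {x : M}

/-- The algebra of functions which are of class `C^n` at `x`. -/
def funAt (I : ModelWithCorners 𝕜 E' H') (n : WithTop ℕ∞) (x : M) : Subalgebra 𝕜 (M → 𝕜) where
  carrier := {f | ContMDiffAt I 𝓘(𝕜, 𝕜) n f x}
  mul_mem' hf hg := ContMDiffAt.mul hf hg
  add_mem' hf hg := ContMDiffAt.add hf hg
  algebraMap_mem' _ := contMDiffAt_const

/-- The ideal of functions vanishing near `x`. -/
def nullAt (I : ModelWithCorners 𝕜 E' H') (n : WithTop ℕ∞) (x : M) : Ideal (funAt I n x) where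
  carrier := {f | f.1 =ᶠ[𝓝 x] 0}
  add_mem' hf hg := by simpa using EventuallyEq.add hf hg
  zero_mem' := EventuallyEq.rfl
  smul_mem' c f hf := by
    have := (EventuallyEq.refl (𝓝 x) c.1).mul hf
    simpa using this

/-- The algebra of germs at `x` of functions of class `C^n` at `x`. -/
def GermAlg (I : ModelWithCorners 𝕜 E' H') (n : WithTop ℕ∞) (x : M) : Type _ :=
  funAt I n x ⧸ nullAt I n x

instance : CommRing (GermAlg I n x) :=
  inferInstanceAs (CommRing (funAt I n x ⧸ nullAt I n x))

instance : Algebra 𝕜 (GermAlg I n x) :=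
  inferInstanceAs (Algebra 𝕜 (funAt I n x ⧸ nullAt I n x))

/-- The germ of a function. -/
def germ (f : M → 𝕜) (hf : ContMDiffAt I 𝓘(𝕜, 𝕜) n f x) : GermAlg I n x :=
  Ideal.Quotient.mk (nullAt I n x) ⟨f, hf⟩

theorem germ_eq_germ {f g : M → 𝕜} {hf : ContMDiffAt I 𝓘(𝕜, 𝕜) n f x}
    {hg : ContMDiffAt I 𝓘(𝕜, 𝕜) n g x} : germ f hf = germ g hg ↔ f =ᶠ[𝓝 x] g := by
  refine Iff.trans (Ideal.Quotient.eq (I := nullAt I n x)) ?_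
  change f - g =ᶠ[𝓝 x] 0 ↔ _
  constructor
  · intro h
    filter_upwards [h] with y hy using sub_eq_zero.1 hy
  · intro h
    filter_upwards [h] with y hy using sub_eq_zero.2 hy

theorem exists_germ (u : GermAlg I n x) :
    ∃ (f : M → 𝕜) (hf : ContMDiffAt I 𝓘(𝕜, 𝕜) n f x), germ f hf = u := by
  obtain ⟨⟨f, hf⟩, rfl⟩ := Ideal.Quotient.mk_surjective u
  exact ⟨f, hf, rfl⟩

theorem germ_add {f g : M → 𝕜} (hf : ContMDiffAt I 𝓘(𝕜, 𝕜) n f x)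
    (hg : ContMDiffAt I 𝓘(𝕜, 𝕜) n g x) : germ f hf + germ g hg = germ (f + g) (hf.add hg) := rfl

theorem germ_mul {f g : M → 𝕜} (hf : ContMDiffAt I 𝓘(𝕜, 𝕜) n f x)
    (hg : ContMDiffAt I 𝓘(𝕜, 𝕜) n g x) : germ f hf * germ g hg = germ (f * g) (hf.mul hg) := rfl

theorem contMDiffAt_const_smul (c : 𝕜) {f : M → 𝕜} (hf : ContMDiffAt I 𝓘(𝕜, 𝕜) n f x) :
    ContMDiffAt I 𝓘(𝕜, 𝕜) n (c • f) x := (funAt I n x).smul_mem hf c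

theorem germ_smul (c : 𝕜) {f : M → 𝕜} (hf : ContMDiffAt I 𝓘(𝕜, 𝕜) n f x) :
    c • germ f hf = germ (c • f) (contMDiffAt_const_smul c hf) := rfl

/-- The value of a germ. -/
def evalGerm (I : ModelWithCorners 𝕜 E' H') (n : WithTop ℕ∞) (x : M) : GermAlg I n x →ₐ[𝕜] 𝕜 :=
  Ideal.Quotient.liftₐ (nullAt I n x) ((Pi.evalAlgHom 𝕜 (fun _ : M => 𝕜) x).comp (funAt I n x).val)
    fun _ hf => EventuallyEq.eq_of_nhds hf

@[simp]
theorem evalGerm_germ {f : M → 𝕜} (hf : ContMDiffAt I 𝓘(𝕜, 𝕜) n f x) :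
    evalGerm I n x (germ f hf) = f x := rfl

variable {a b : M → G → M}

theorem along_congr {f g : M → 𝕜} (h : f =ᶠ[𝓝 x] g) (X : GroupLieAlgebra J G) :
    along J I a X f =ᶠ[𝓝 x] along J I a X g := by
  filter_upwards [h.eventuallyEq_nhds] with y hy
  rw [along, along, tderiv_congr hy]

theorem along_add_right {f g : M → 𝕜} (hf : MDifferentiableAt I 𝓘(𝕜, 𝕜) f x)
    (hg : MDifferentiableAt I 𝓘(𝕜, 𝕜) g x) (X : GroupLieAlgebra J G) :
    along J I a X (f + g) x = along J I a X f x + along J I a X g x :=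
  DFunLike.congr_fun (mfderiv_add hf hg) _

theorem along_smul_right (c : 𝕜) {f : M → 𝕜} (hf : MDifferentiableAt I 𝓘(𝕜, 𝕜) f x)
    (X : GroupLieAlgebra J G) : along J I a X (c • f) x = c * along J I a X f x :=
  DFunLike.congr_fun (const_smul_mfderiv hf c) _

theorem along_mul {f g : M → 𝕜} (hf : MDifferentiableAt I 𝓘(𝕜, 𝕜) f x)
    (hg : MDifferentiableAt I 𝓘(𝕜, 𝕜) g x) (X : GroupLieAlgebra J G) :
    along J I a X (f * g) x = f x * along J I a X g x + along J I a X f x * g x := by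
  have h : along J I a X (f * g) x = f x * along J I a X g x + g x * along J I a X f x :=
    DFunLike.congr_fun (hf.hasMFDerivAt.mul hg.hasMFDerivAt).mfderiv (velocity J I a x X)
  rw [h, mul_comm (g x)]

theorem along_add_left (X Y : GroupLieAlgebra J G) (f : M → 𝕜) :
    along J I a (X + Y) f = along J I a X f + along J I a Y f := by
  ext y
  simp only [along, map_add, Pi.add_apply]

theorem along_smul_left (c : 𝕜) (X : GroupLieAlgebra J G) (f : M → 𝕜) :
    along J I a (c • X) f = c • along J I a X f := by
  ext y
  simp only [along, map_smul, Pi.smul_apply]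

theorem minSmoothness_two_ne_infty : minSmoothness 𝕜 2 ≠ ∞ := by
  simp

theorem eventually_contMDiffAt [IsManifold I n M] {f : M → 𝕜} (hn : minSmoothness 𝕜 2 ≤ n)
    (hf : ContMDiffAt I 𝓘(𝕜, 𝕜) n f x) :
    ∀ᶠ y in 𝓝 x, ContMDiffAt I 𝓘(𝕜, 𝕜) (minSmoothness 𝕜 2) f y := by
  have : IsManifold I (minSmoothness 𝕜 2) M := IsManifold.of_le hn
  exact (contMDiffAt_iff_contMDiffAt_nhds minSmoothness_two_ne_infty).1 (hf.of_le hn)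

variable [IsManifold I 1 M] [J.Boundaryless]

/-- The derivative of a germ of functions along a family of curves. -/
def alongGermFun [IsManifold J n G] (ha : IsMotion J I n a) (hn : n + 1 ≤ n)
    (X : GroupLieAlgebra J G) (u : GermAlg I n x) : GermAlg I n x :=
  germ (along J I a X (exists_germ u).choose)
    (ha.contMDiffAt_along hn (exists_germ u).choose_spec.choose X)

theorem alongGermFun_germ [IsManifold J n G] (ha : IsMotion J I n a) (hn : n + 1 ≤ n)
    (X : GroupLieAlgebra J G) {f : M → 𝕜} (hf : ContMDiffAt I 𝓘(𝕜, 𝕜) n f x) :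
    alongGermFun ha hn X (germ f hf) = germ (along J I a X f) (ha.contMDiffAt_along hn hf X) :=
  germ_eq_germ.2 (along_congr (germ_eq_germ.1 (exists_germ (germ f hf)).choose_spec.choose_spec) X)

/-- The action of a family of curves on germs of functions. -/
def alongGerm [IsManifold J n G] (ha : IsMotion J I n a) (hn : n + 1 ≤ n) (x : M) :
    GroupLieAlgebra J G →ₗ[𝕜] GermAlg I n x →ₗ[𝕜] GermAlg I n x :=
  LinearMap.mk₂ 𝕜 (alongGermFun ha hn)
    (fun X Y u => by
      obtain ⟨f, hf, rfl⟩ := exists_germ u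
      rw [alongGermFun_germ, alongGermFun_germ, alongGermFun_germ, germ_add, germ_eq_germ]
      exact Eventually.of_forall fun y => congrFun (along_add_left X Y f) y)
    (fun c X u => by
      obtain ⟨f, hf, rfl⟩ := exists_germ u
      rw [alongGermFun_germ, alongGermFun_germ, germ_smul, germ_eq_germ]
      exact Eventually.of_forall fun y => congrFun (along_smul_left c X f) y)
    (fun X u v => by
      obtain ⟨f, hf, rfl⟩ := exists_germ u
      obtain ⟨g, hg, rfl⟩ := exists_germ v
      rw [germ_add, alongGermFun_germ, alongGermFun_germ, alongGermFun_germ, germ_add,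
        germ_eq_germ]
      filter_upwards [eventually_mdifferentiableAt hf (le_trans le_add_self hn),
        eventually_mdifferentiableAt hg (le_trans le_add_self hn)] with y hf hg
      exact along_add_right hf hg X)
    (fun c X u => by
      obtain ⟨f, hf, rfl⟩ := exists_germ u
      rw [germ_smul, alongGermFun_germ, alongGermFun_germ, germ_smul, germ_eq_germ]
      filter_upwards [eventually_mdifferentiableAt hf (le_trans le_add_self hn)] with y hf
      exact along_smul_right c hf X)

theorem alongGerm_germ [IsManifold J n G] (ha : IsMotion J I n a) (hn : n + 1 ≤ n)
    (X : GroupLieAlgebra J G) {f : M → 𝕜} (hf : ContMDiffAt I 𝓘(𝕜, 𝕜) n f x) :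
    alongGerm ha hn x X (germ f hf) = germ (along J I a X f) (ha.contMDiffAt_along hn hf X) :=
  alongGermFun_germ ha hn X hf

theorem isLeibniz_alongGerm [IsManifold J n G] (ha : IsMotion J I n a) (hn : n + 1 ≤ n)
    (X : GroupLieAlgebra J G) : Algebraic.IsLeibniz (alongGerm ha hn x X) := fun u v => by
  obtain ⟨f, hf, rfl⟩ := exists_germ u
  obtain ⟨g, hg, rfl⟩ := exists_germ v
  rw [germ_mul, alongGerm_germ, alongGerm_germ, alongGerm_germ, germ_mul, germ_mul, germ_add,
    germ_eq_germ]
  filter_upwards [eventually_mdifferentiableAt hf (le_trans le_add_self hn),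
    eventually_mdifferentiableAt hg (le_trans le_add_self hn)] with y hf hg
  rw [along_mul hf hg, add_comm]
  rfl

variable [IsManifold I n M]

theorem alongGerm_comm [IsManifold J n G] (ha : IsMotion J I n a) (hb : IsMotion J I n b)
    (hab : ∀ m g h, b (a m g) h = a (b m h) g) (hn : n + 1 ≤ n) (hn' : minSmoothness 𝕜 2 ≤ n)
    (X Y : GroupLieAlgebra J G) : alongGerm ha hn x X ∘ₗ alongGerm hb hn x Y =
      alongGerm hb hn x Y ∘ₗ alongGerm ha hn x X := by
  refine LinearMap.ext fun u => ?_
  obtain ⟨f, hf, rfl⟩ := exists_germ u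
  simp only [LinearMap.comp_apply, alongGerm_germ, germ_eq_germ]
  have : IsManifold J (minSmoothness 𝕜 2) G := IsManifold.of_le hn'
  filter_upwards [eventually_contMDiffAt hn' hf] with y hy
  exact (ha.of_le hn').along_comm (hb.of_le hn') hab le_rfl hy X Y

variable [CompleteSpace E] [LieGroup J (minSmoothness 𝕜 3) G] [LieGroup J n G]

theorem alongGerm_lie_right (ha : IsMotion J I n a) (haa : ∀ m g h, a (a m g) h = a m (g * h))
    (hn : n + 1 ≤ n) (hn' : minSmoothness 𝕜 2 ≤ n) (X Y : GroupLieAlgebra J G) :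
    alongGerm ha hn x X ∘ₗ alongGerm ha hn x Y - alongGerm ha hn x Y ∘ₗ alongGerm ha hn x X =
      alongGerm ha hn x ⁅X, Y⁆ := by
  refine LinearMap.ext fun u => ?_
  obtain ⟨f, hf, rfl⟩ := exists_germ u
  rw [LinearMap.sub_apply, sub_eq_iff_eq_add]
  simp only [LinearMap.comp_apply, alongGerm_germ, germ_add, germ_eq_germ]
  have : LieGroup J (minSmoothness 𝕜 2) G := LieGroup.of_le hn'
  filter_upwards [eventually_contMDiffAt hn' hf] with y hy
  exact sub_eq_iff_eq_add.1 ((ha.of_le hn').along_lie_right haa le_rfl hy X Y)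

theorem alongGerm_lie_left (ha : IsMotion J I n a) (haa : ∀ m g h, a (a m g) h = a m (h * g))
    (hn : n + 1 ≤ n) (hn' : minSmoothness 𝕜 2 ≤ n) (X Y : GroupLieAlgebra J G) :
    alongGerm ha hn x X ∘ₗ alongGerm ha hn x Y - alongGerm ha hn x Y ∘ₗ alongGerm ha hn x X =
      -alongGerm ha hn x ⁅X, Y⁆ := by
  refine LinearMap.ext fun u => ?_
  obtain ⟨f, hf, rfl⟩ := exists_germ u
  rw [LinearMap.sub_apply, LinearMap.neg_apply, sub_eq_iff_eq_add, ← sub_eq_neg_add,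
    eq_sub_iff_add_eq]
  simp only [LinearMap.comp_apply, alongGerm_germ, germ_add, germ_eq_germ]
  have : LieGroup J (minSmoothness 𝕜 2) G := LieGroup.of_le hn'
  filter_upwards [eventually_contMDiffAt hn' hf] with y hy
  have h := (ha.of_le hn').along_lie_left haa le_rfl hy X Y
  rw [sub_eq_iff_eq_add, ← sub_eq_neg_add, eq_sub_iff_add_eq] at h
  exact h

end Germs

end QuasiPoisson

end

noncomputable section

namespace QuasiPoisson

open Set Filter Topology

section Germs

variable {𝕜 : Type*} [NontriviallyNormedField 𝕜]
  {E : Type*} [NormedAddCommGroup E] [NormedSpace 𝕜 E]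
  {E' : Type*} [NormedAddCommGroup E'] [NormedSpace 𝕜 E']
  {H : Type*} [TopologicalSpace H] {J : ModelWithCorners 𝕜 E H}
  {G : Type*} [TopologicalSpace G] [ChartedSpace H G] [Group G]
  {H' : Type*} [TopologicalSpace H'] {I : ModelWithCorners 𝕜 E' H'}
  {M : Type*} [TopologicalSpace M] [ChartedSpace H' M]
  {n : WithTop ℕ∞} {x : M}

/-- The operator `Q` on germs at `x` is the one given by the field of 2-tensors `P`. -/
def IsGermOf (n : WithTop ℕ∞) (x : M) (P : TensorField₂ I M)
    (Q : GermAlg I n x →ₗ[𝕜] GermAlg I n x →ₗ[𝕜] GermAlg I n x) : Prop :=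
  ∀ (f h : M → 𝕜) (hf : ContMDiffAt I 𝓘(𝕜, 𝕜) n f x) (hh : ContMDiffAt I 𝓘(𝕜, 𝕜) n h x),
    ∃ hc : ContMDiffAt I 𝓘(𝕜, 𝕜) n (bidiff P f h) x, Q (germ f hf) (germ h hh) = germ _ hc

variable {P P' : TensorField₂ I M} {Q Q' : GermAlg I n x →ₗ[𝕜] GermAlg I n x →ₗ[𝕜] GermAlg I n x}

theorem bidiff_add (f h : M → 𝕜) : bidiff (P + P') f h = bidiff P f h + bidiff P' f h := by
  ext y
  simp only [bidiff, Pi.add_apply, map_add]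

theorem bidiff_smul (c : 𝕜) (f h : M → 𝕜) : bidiff (c • P) f h = c • bidiff P f h := by
  ext y
  simp only [bidiff, Pi.smul_apply, map_smul]

theorem IsGermOf.add (hP : IsGermOf n x P Q) (hP' : IsGermOf n x P' Q') :
    IsGermOf n x (P + P') (Q + Q') := fun f h hf hh => by
  obtain ⟨hc, e⟩ := hP f h hf hh
  obtain ⟨hc', e'⟩ := hP' f h hf hh
  refine ⟨bidiff_add (P := P) (P' := P') f h ▸ hc.add hc', ?_⟩
  rw [LinearMap.add_apply, LinearMap.add_apply, e, e', germ_add, germ_eq_germ, bidiff_add]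

theorem IsGermOf.smul (hP : IsGermOf n x P Q) (c : 𝕜) : IsGermOf n x (c • P) (c • Q) :=
  fun f h hf hh => by
  obtain ⟨hc, e⟩ := hP f h hf hh
  refine ⟨bidiff_smul (P := P) c f h ▸ contMDiffAt_const_smul c hc, ?_⟩
  rw [LinearMap.smul_apply, LinearMap.smul_apply, e, germ_smul, germ_eq_germ, bidiff_smul]

theorem IsGermOf.sub (hP : IsGermOf n x P Q) (hP' : IsGermOf n x P' Q') :
    IsGermOf n x (P - P') (Q - Q') := by
  have h := hP.add (hP'.smul (-1))
  have e : Q + (-1 : 𝕜) • Q' = Q - Q' := LinearMap.ext₂ fun u v => by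
    simp [sub_eq_add_neg]
  rwa [neg_one_smul, ← sub_eq_add_neg, e] at h

theorem IsGermOf.schouten (hP : IsGermOf n x P Q) {f g h : M → 𝕜}
    (hf : ContMDiffAt I 𝓘(𝕜, 𝕜) n f x) (hg : ContMDiffAt I 𝓘(𝕜, 𝕜) n g x)
    (hh : ContMDiffAt I 𝓘(𝕜, 𝕜) n h x) : schouten P P f g h x =
      evalGerm I n x (Algebraic.schouten Q Q (germ f hf) (germ g hg) (germ h hh)) := by
  have key : ∀ {f g h : M → 𝕜} (hf : ContMDiffAt I 𝓘(𝕜, 𝕜) n f x)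
    (hg : ContMDiffAt I 𝓘(𝕜, 𝕜) n g x) (hh : ContMDiffAt I 𝓘(𝕜, 𝕜) n h x),
    bidiff P f (bidiff P g h) x =
      evalGerm I n x (Q (germ f hf) (Q (germ g hg) (germ h hh))) := fun {f g h} hf hg hh => by
    obtain ⟨hc, e⟩ := hP g h hg hh
    obtain ⟨hc', e'⟩ := hP f _ hf hc
    rw [e, e', evalGerm_germ]
  simp only [QuasiPoisson.schouten, Algebraic.schouten, map_add, ← key]

theorem evalGerm_triop {L : Type*} [AddCommGroup L] [Module 𝕜 L]
    {S : L →ₗ[𝕜] GermAlg I n x →ₗ[𝕜] GermAlg I n x} {s : L →ₗ[𝕜] TangentSpace I x}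
    (hS : ∀ (X : L) (f : M → 𝕜) (hf : ContMDiffAt I 𝓘(𝕜, 𝕜) n f x),
      evalGerm I n x (S X (germ f hf)) = diff I f x (s X)) (φ : L ⊗[𝕜] (L ⊗[𝕜] L))
    {f g h : M → 𝕜} (hf : ContMDiffAt I 𝓘(𝕜, 𝕜) n f x) (hg : ContMDiffAt I 𝓘(𝕜, 𝕜) n g x)
    (hh : ContMDiffAt I 𝓘(𝕜, 𝕜) n h x) :
    evalGerm I n x (Algebraic.triop S φ (germ f hf) (germ g hg) (germ h hh)) =
      tridiffAt x (TensorProduct.map s (TensorProduct.map s s) φ) f g h := by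
  rw [Algebraic.triop, tridiffAt]
  induction φ with
  | zero => simp only [map_zero]
  | add φ ψ hφ hψ => simp only [map_add, hφ, hψ]
  | tmul X φ =>
    simp only [TensorProduct.map_tmul, LinearMap.mul'_apply, LinearMap.comp_apply, map_mul,
      LinearMap.flip_apply, hS, TensorProduct.dualDistrib_apply]
    congr 1
    induction φ with
    | zero => simp only [map_zero]
    | add φ ψ hφ hψ => simp only [map_add, hφ, hψ]
    | tmul Y Z =>
      simp only [TensorProduct.map_tmul, LinearMap.mul'_apply, map_mul,
        LinearMap.flip_apply, hS, TensorProduct.dualDistrib_apply]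

variable {a b : M → G → M}

/-- The field of 2-tensors given by two families of curves and a 2-tensor on the Lie algebra. -/
def motionTensor (I : ModelWithCorners 𝕜 E' H') (a b : M → G → M)
    (T : GroupLieAlgebra J G ⊗[𝕜] GroupLieAlgebra J G) : TensorField₂ I M := fun q =>
  TensorProduct.map (velocity J I a q).toLinearMap (velocity J I b q).toLinearMap T

theorem bidiff_motionTensor_tmul (X Y : GroupLieAlgebra J G) (f h : M → 𝕜) :
    bidiff (motionTensor I a b (X ⊗ₜ Y)) f h = along J I a X f * along J I b Y h := by
  ext y
  simp only [bidiff, motionTensor, TensorProduct.map_tmul, TensorProduct.dualDistrib_apply]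
  rfl

variable [IsManifold I 1 M] [J.Boundaryless] [IsManifold J n G]

theorem isGermOf_motionTensor (ha : IsMotion J I n a) (hb : IsMotion J I n b) (hn : n + 1 ≤ n)
    (T : GroupLieAlgebra J G ⊗[𝕜] GroupLieAlgebra J G) :
    IsGermOf n x (motionTensor I a b T)
      (Algebraic.biop (alongGerm ha hn x) (alongGerm hb hn x) T) := by
  induction T with
  | zero =>
    have h0 : motionTensor I a b (0 : GroupLieAlgebra J G ⊗[𝕜] GroupLieAlgebra J G) = 0 := by
      ext1 y
      simp only [motionTensor, map_zero, Pi.zero_apply]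
    intro f h hf hh
    have h1 : bidiff (0 : TensorField₂ I M) f h = 0 := by
      ext y
      simp only [bidiff, Pi.zero_apply, map_zero]
    rw [h0, h1]
    refine ⟨contMDiffAt_const, ?_⟩
    simp only [Algebraic.biop, LinearMap.mk₂_apply, map_zero]
    rfl
  | add T T' hT hT' =>
    have h0 : motionTensor I a b (T + T') = motionTensor I a b T + motionTensor I a b T' := by
      ext1 y
      simp only [motionTensor, map_add, Pi.add_apply]
    have h1 : Algebraic.biop (alongGerm ha hn x) (alongGerm hb hn x) (T + T') =
        Algebraic.biop (alongGerm ha hn x) (alongGerm hb hn x) T +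
          Algebraic.biop (alongGerm ha hn x) (alongGerm hb hn x) T' :=
      LinearMap.ext₂ fun f h => Algebraic.biop_add _ _ _ _ _ _
    rw [h0, h1]
    exact hT.add hT'
  | tmul X Y =>
    intro f h hf hh
    rw [bidiff_motionTensor_tmul]
    refine ⟨(ha.contMDiffAt_along hn hf X).mul (hb.contMDiffAt_along hn hh Y), ?_⟩
    rw [Algebraic.biop_tmul, alongGerm_germ, alongGerm_germ, germ_mul]

end Germs

end QuasiPoisson

end

noncomputable section

namespace QuasiPoisson

open Set Filter Topology

section Infinitesimal

variable {K : Type*} [Field K] {L : Type*} [LieRing L] [LieAlgebra K L]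

/-- The action of a Lie algebra element on 2-tensors. -/
def lieTensor (X : L) (T : L ⊗[K] L) : L ⊗[K] L :=
  LinearMap.rTensor L (LieModule.toEnd K L L X) T + LinearMap.lTensor L (LieModule.toEnd K L L X) T

namespace Algebraic

variable {B : Type*} [CommRing B] [Algebra K B]

theorem biop_lieTensor (S T : L →ₗ[K] B →ₗ[K] B) (X : L) (H : L ⊗[K] L) (f h : B) :
    biop S T (lieTensor X H) f h = biop (S ∘ₗ LieModule.toEnd K L L X) T H f h +
      biop S (T ∘ₗ LieModule.toEnd K L L X) H f h := by
  rw [lieTensor, biop_add]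
  obtain ⟨s, rfl⟩ := TensorProduct.exists_finset H
  simp only [map_sum, LinearMap.rTensor_tmul, LinearMap.lTensor_tmul, biop_sum,
    LinearMap.comp_apply]

theorem isLieInvariant_iff {S T : L →ₗ[K] B →ₗ[K] B} {H : L ⊗[K] L} :
    IsLieInvariant S T H ↔ ∀ X f h, biop S T (lieTensor X H) f h = 0 := by
  simp only [IsLieInvariant, biop_lieTensor]

theorem isLieInvariant_of_biop_eq {l r : L →ₗ[K] B →ₗ[K] B} {H : L ⊗[K] L}
    (hl : ∀ X, IsLeibniz (l X)) (hll : ∀ X Y, l X ∘ₗ l Y - l Y ∘ₗ l X = l ⁅X, Y⁆)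
    (hlr : ∀ X Y, l X ∘ₗ r Y = r Y ∘ₗ l X) (hH : ∀ f h, biop l l H f h = biop r r H f h) :
    IsLieInvariant l l H := by
  intro X f h
  have e := congrArg (l X) (hH f h)
  have e1 := hH (l X f) h
  have e2 := hH f (l X h)
  obtain ⟨s, rfl⟩ := TensorProduct.exists_finset H
  have hll' : ∀ Y u, l ⁅X, Y⁆ u = l X (l Y u) - l Y (l X u) := fun Y u => by
    rw [← hll]; rfl
  have hlr' : ∀ Y u, l X (r Y u) = r Y (l X u) := fun Y u => LinearMap.congr_fun (hlr X Y) u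
  simp only [biop_sum, map_sum, LinearMap.comp_apply, LieModule.toEnd_apply_apply, hl X _ _,
    Finset.sum_add_distrib, hlr', hll', sub_mul, mul_sub, Finset.sum_sub_distrib] at e e1 e2 ⊢
  linear_combination e - e1 - e2

end Algebraic

end Infinitesimal

section Germs

variable {𝕜 : Type*} [NontriviallyNormedField 𝕜]
  {E : Type*} [NormedAddCommGroup E] [NormedSpace 𝕜 E]
  {E' : Type*} [NormedAddCommGroup E'] [NormedSpace 𝕜 E']
  {H : Type*} [TopologicalSpace H] {J : ModelWithCorners 𝕜 E H}
  {G : Type*} [TopologicalSpace G] [ChartedSpace H G] [Group G]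
  {H' : Type*} [TopologicalSpace H'] {I : ModelWithCorners 𝕜 E' H'}
  {M : Type*} [TopologicalSpace M] [ChartedSpace H' M]
  {n : WithTop ℕ∞} {x : M}

theorem IsGermOf.unique {P : TensorField₂ I M}
    {Q Q' : GermAlg I n x →ₗ[𝕜] GermAlg I n x →ₗ[𝕜] GermAlg I n x}
    (h : IsGermOf n x P Q) (h' : IsGermOf n x P Q') : Q = Q' := by
  refine LinearMap.ext₂ fun u v => ?_
  obtain ⟨f, hf, rfl⟩ := exists_germ u
  obtain ⟨g, hg, rfl⟩ := exists_germ v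
  obtain ⟨_, e⟩ := h f g hf hg
  obtain ⟨_, e'⟩ := h' f g hf hg
  rw [e, e']

theorem bidiff_motionTensor {a b : M → G → M} (T : GroupLieAlgebra J G ⊗[𝕜] GroupLieAlgebra J G)
    (f h : M → 𝕜) (y : M) : bidiff (motionTensor I a b T) f h y =
      TensorProduct.dualDistrib 𝕜 _ _ ((diff I f y ∘ₗ (velocity J I a y).toLinearMap) ⊗ₜ
        (diff I h y ∘ₗ (velocity J I b y).toLinearMap)) T := by
  rw [bidiff, motionTensor]
  induction T with
  | zero => simp only [map_zero]
  | add T T' hT hT' => simp only [map_add, hT, hT']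
  | tmul X Y => rfl

theorem tderiv_extChartAt [IsManifold I 1 M] (X : TangentSpace I x) :
    tderiv I (extChartAt I x) x X = (X : E') :=
  DFunLike.congr_fun (mfderiv_extChartAt_self (I := I) (x := x)) X

theorem exists_tderiv_eq [IsManifold I 1 M] [IsManifold I n M] (hn : 1 ≤ n)
    (ℓ : TangentSpace I x →L[𝕜] 𝕜) :
    ∃ u : M → 𝕜, ContMDiffAt I 𝓘(𝕜, 𝕜) n u x ∧ tderiv I u x = ℓ := by
  have hφ : ContMDiffAt I 𝓘(𝕜, E') n (extChartAt I x) x := contMDiffAt_extChartAt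
  let m : E' →L[𝕜] 𝕜 := ℓ
  refine ⟨fun y => m (extChartAt I x y), m.contMDiff.contMDiffAt.comp x hφ, ?_⟩
  have h := mfderiv_comp x (g := m) m.differentiableAt.mdifferentiableAt
    (hφ.mdifferentiableAt (lt_of_lt_of_le (by norm_num) hn).ne')
  rw [mfderiv_eq_fderiv, m.fderiv] at h
  refine ContinuousLinearMap.ext fun X => ?_
  refine (DFunLike.congr_fun h (X : E')).trans ?_
  exact congrArg ℓ (tderiv_extChartAt X)

end Germs

section Group

variable {𝕜 : Type*} [NontriviallyNormedField 𝕜]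
  {E : Type*} [NormedAddCommGroup E] [NormedSpace 𝕜 E]
  {E' : Type*} [NormedAddCommGroup E'] [NormedSpace 𝕜 E']
  {H : Type*} [TopologicalSpace H] {J : ModelWithCorners 𝕜 E H}
  {G : Type*} [TopologicalSpace G] [ChartedSpace H G] [Group G]
  {H' : Type*} [TopologicalSpace H'] {I : ModelWithCorners 𝕜 E' H'}
  {M : Type*} [TopologicalSpace M] [ChartedSpace H' M]
  {n : WithTop ℕ∞} {x : M} [LieGroup J n G]

variable (J n) in
theorem isMotion_mul : IsMotion J J n (fun q g : G => q * g) :=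
  ⟨contMDiff_mul J n, mul_one⟩

variable (J n) in
theorem isMotion_mul_swap : IsMotion J J n (fun q g : G => g * q) :=
  ⟨contMDiff_snd.mul contMDiff_fst, one_mul⟩

variable (J) in
theorem leftMap_eq_rightMap_comp_adMap (hn : n ≠ 0) (q : G) :
    leftMap J q = rightMap J q ∘ₗ adMap J q := by
  have h1 : MDifferentiableAt J J (fun g : G => g * q) (q * 1 * q⁻¹) :=
    (contMDiff_mul_right (I := J) (n := n) (a := q)).contMDiffAt.mdifferentiableAt hn
  have h2 : MDifferentiableAt J J (fun g : G => q * g * q⁻¹) 1 :=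
    (((contMDiff_mul_left (I := J) (n := n) (a := q)).mul contMDiff_const).contMDiffAt
      (x := (1 : G))).mdifferentiableAt hn
  have h := mfderiv_comp (1 : G) h1 h2
  have e : (fun g : G => g * q) ∘ (fun g : G => q * g * q⁻¹) = fun g => q * g := by
    ext g
    simp
  have e1 : q * 1 * q⁻¹ = 1 := by simp
  rw [e] at h
  refine LinearMap.ext fun X => (DFunLike.congr_fun h X).trans ?_
  have e2 : (mfderiv J J (fun g : G => g * q) (q * 1 * q⁻¹) : E →L[𝕜] E) =
      mfderiv J J (fun g : G => g * q) 1 := by rw [e1]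
  exact DFunLike.congr_fun e2 _

theorem map_comp_apply {A B C A' B' C' : Type*} [AddCommGroup A] [Module 𝕜 A] [AddCommGroup B]
    [Module 𝕜 B] [AddCommGroup C] [Module 𝕜 C] [AddCommGroup A'] [Module 𝕜 A'] [AddCommGroup B']
    [Module 𝕜 B'] [AddCommGroup C'] [Module 𝕜 C'] (f : B →ₗ[𝕜] C) (g : A →ₗ[𝕜] B)
    (f' : B' →ₗ[𝕜] C') (g' : A' →ₗ[𝕜] B') (T : A ⊗[𝕜] A') :
    TensorProduct.map (f ∘ₗ g) (f' ∘ₗ g') T = TensorProduct.map f f' (TensorProduct.map g g' T) :=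
  LinearMap.congr_fun (TensorProduct.map_comp f f' g g') T

theorem IsAdInvSymm.map_leftMap {T : GroupLieAlgebra J G ⊗[𝕜] GroupLieAlgebra J G}
    (hT : IsAdInvSymm J T) (hn : n ≠ 0) (q : G) :
    TensorProduct.map (leftMap J q) (leftMap J q) T =
      TensorProduct.map (rightMap J q) (rightMap J q) T := by
  rw [leftMap_eq_rightMap_comp_adMap J hn q, map_comp_apply, hT.ad_inv]

variable [J.Boundaryless] [CompleteSpace E] [LieGroup J (minSmoothness 𝕜 3) G]

theorem IsAdInvSymm.dualDistrib_lieTensor {T : GroupLieAlgebra J G ⊗[𝕜] GroupLieAlgebra J G}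
    (hT : IsAdInvSymm J T) (hn : n + 1 ≤ n) (hn' : minSmoothness 𝕜 2 ≤ n)
    (X : GroupLieAlgebra J G) (ℓ ℓ' : GroupLieAlgebra J G →L[𝕜] 𝕜) :
    TensorProduct.dualDistrib 𝕜 _ _ (ℓ.toLinearMap ⊗ₜ ℓ'.toLinearMap) (lieTensor X T) = 0 := by
  have h1 : 1 ≤ n := one_le_of_minSmoothness_le hn'
  have : IsManifold J 1 G := IsManifold.of_le h1
  have ha := isMotion_mul (G := G) J n
  have hb := isMotion_mul_swap (G := G) J n
  have hbi : Algebraic.biop (alongGerm ha hn 1) (alongGerm ha hn 1) T =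
      Algebraic.biop (alongGerm hb hn 1) (alongGerm hb hn 1) T := by
    refine (isGermOf_motionTensor ha ha hn T).unique ?_
    have e : motionTensor J (fun q g : G => q * g) (fun q g : G => q * g) T =
        motionTensor J (fun q g : G => g * q) (fun q g : G => g * q) T := by
      ext1 q
      exact hT.map_leftMap (ne_zero_of_minSmoothness_le hn') q
    rw [e]
    exact isGermOf_motionTensor hb hb hn T
  have hinv := Algebraic.isLieInvariant_iff.1 (Algebraic.isLieInvariant_of_biop_eq
    (isLeibniz_alongGerm ha hn) (alongGerm_lie_right ha mul_assoc hn hn')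
    (alongGerm_comm ha hb (fun m g h => (mul_assoc h m g).symm) hn hn')
    (fun f h => LinearMap.congr_fun₂ hbi f h)) X
  obtain ⟨u, hu, eu⟩ := exists_tderiv_eq h1 ℓ
  obtain ⟨v, hv, ev⟩ := exists_tderiv_eq h1 ℓ'
  obtain ⟨hc, e⟩ := isGermOf_motionTensor ha ha hn (lieTensor X T) u v hu hv
  have e0 := congrArg (evalGerm J n 1) (e.symm.trans (hinv (germ u hu) (germ v hv)))
  rw [evalGerm_germ, map_zero, bidiff_motionTensor] at e0
  have hv1 : (velocity J J (fun q g : G => q * g) 1).toLinearMap = LinearMap.id := by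
    have h : (fun g : G => 1 * g) = id := by ext g; simp
    have h' : mfderiv J J (fun g : G => 1 * g) 1 = mfderiv J J id (1 : G) := by rw [h]
    rw [mfderiv_id] at h'
    exact LinearMap.ext fun X => DFunLike.congr_fun h' X
  rw [hv1, LinearMap.comp_id, LinearMap.comp_id] at e0
  have eu' : diff J u 1 = ℓ.toLinearMap := congrArg ContinuousLinearMap.toLinearMap eu
  have ev' : diff J v 1 = ℓ'.toLinearMap := congrArg ContinuousLinearMap.toLinearMap ev
  rwa [eu', ev'] at e0

theorem IsAdInvSymm.isLieInvariant_alongGerm [IsManifold I 1 M]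
    {T : GroupLieAlgebra J G ⊗[𝕜] GroupLieAlgebra J G}
    (hT : IsAdInvSymm J T) {a b : M → G → M} (ha : IsMotion J I n a) (hb : IsMotion J I n b)
    (hn : n + 1 ≤ n) (hn' : minSmoothness 𝕜 2 ≤ n) :
    Algebraic.IsLieInvariant (alongGerm ha hn x) (alongGerm hb hn x) T := by
  refine Algebraic.isLieInvariant_iff.2 fun X u v => ?_
  obtain ⟨f, hf, rfl⟩ := exists_germ u
  obtain ⟨g, hg, rfl⟩ := exists_germ v
  obtain ⟨hc, e⟩ := isGermOf_motionTensor ha hb hn (lieTensor X T) f g hf hg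
  rw [e]
  refine (germ_eq_germ (hg := contMDiffAt_const (c := (0 : 𝕜)))).2
    (Eventually.of_forall fun y => ?_)
  rw [bidiff_motionTensor]
  exact hT.dualDistrib_lieTensor hn hn' X ((tderiv I f y).comp (velocity J I a y))
    ((tderiv I g y).comp (velocity J I b y))

end Group

end QuasiPoisson

end

noncomputable section

namespace QuasiPoisson

section Curves

variable {𝕜 : Type*} [NontriviallyNormedField 𝕜]
  {E : Type*} [NormedAddCommGroup E] [NormedSpace 𝕜 E]
  {E' : Type*} [NormedAddCommGroup E'] [NormedSpace 𝕜 E']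
  {E'' : Type*} [NormedAddCommGroup E''] [NormedSpace 𝕜 E'']
  {H : Type*} [TopologicalSpace H] {J : ModelWithCorners 𝕜 E H}
  {G : Type*} [TopologicalSpace G] [ChartedSpace H G] [Group G]
  {H' : Type*} [TopologicalSpace H'] {I : ModelWithCorners 𝕜 E' H'}
  {M : Type*} [TopologicalSpace M] [ChartedSpace H' M]
  {H'' : Type*} [TopologicalSpace H''] {I' : ModelWithCorners 𝕜 E'' H''}
  {M' : Type*} [TopologicalSpace M'] [ChartedSpace H'' M']
  {n : WithTop ℕ∞}

/-- The derivative at the identity of a map `c : G → M` with `c 1 = p`. -/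
def derivAtOne (J : ModelWithCorners 𝕜 E H) (I : ModelWithCorners 𝕜 E' H') (c : G → M) (p : M) :
    GroupLieAlgebra J G →ₗ[𝕜] TangentSpace I p :=
  (mfderiv J I c 1 : E →L[𝕜] E').toLinearMap

theorem dmap_comp_derivAtOne (hn : n ≠ 0) {F : M → M'} {c : G → M} {p : M} (hp : c 1 = p)
    (hF : ContMDiff I I' n F) (hc : ContMDiff J I n c) :
    dmap I I' F p ∘ₗ derivAtOne J I c p = derivAtOne J I' (fun g => F (c g)) (F p) := by
  subst hp
  exact (congrArg ContinuousLinearMap.toLinearMap (mfderiv_comp (1 : G)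
    (hF.contMDiffAt.mdifferentiableAt hn) (hc.contMDiffAt.mdifferentiableAt hn))).symm

theorem derivAtOne_comp (hn : n ≠ 0) {c : G → M} {s : G → G} {p : M} (hs : s 1 = 1)
    (hc : ContMDiff J I n c) (hs' : ContMDiff J J n s) :
    derivAtOne J I (fun g => c (s g)) p = derivAtOne J I c p ∘ₗ derivAtOne J J s 1 := by
  have h := mfderiv_comp (1 : G) (hc.contMDiffAt.mdifferentiableAt hn)
    (hs'.contMDiffAt.mdifferentiableAt hn)
  have e : (mfderiv J I c (s 1) : E →L[𝕜] E') = mfderiv J I c 1 := by rw [hs]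
  refine LinearMap.ext fun X => (DFunLike.congr_fun h X).trans ?_
  exact DFunLike.congr_fun e _

theorem derivAtOne_const (m p : M) : derivAtOne J I (fun _ : G => m) p = 0 :=
  congrArg ContinuousLinearMap.toLinearMap (mfderiv_const (I := J) (I' := I) (c := m) (x := (1 : G)))

theorem derivAtOne_id : derivAtOne J J (fun g : G => g) 1 = LinearMap.id :=
  congrArg ContinuousLinearMap.toLinearMap (mfderiv_id (I := J) (x := (1 : G)))

theorem derivAtOne_prodMk (hn : n ≠ 0) {c d : G → M} (p : M × M)
    (hc : ContMDiff J I n c) (hd : ContMDiff J I n d) :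
    derivAtOne J (I.prod I) (fun g => (c g, d g)) p =
      inl I p ∘ₗ derivAtOne J I c p.1 + inr I p ∘ₗ derivAtOne J I d p.2 := by
  refine LinearMap.ext fun X => (DFunLike.congr_fun (mfderiv_prodMk (x := (1 : G))
    (hc.contMDiffAt.mdifferentiableAt hn) (hd.contMDiffAt.mdifferentiableAt hn)) X).trans ?_
  refine Prod.ext ?_ ?_
  · exact (add_zero _).symm
  · exact (zero_add _).symm

theorem derivAtOne_comp_inl (hn : n ≠ 0) {f : G × G → M} (p : M)
    (hf : ContMDiff (J.prod J) I n f) : derivAtOne (J.prod J) I f p ∘ₗ inl J (1 : G × G) =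
      derivAtOne J I (fun g => f (g, 1)) p := by
  have hi : ContMDiff J (J.prod J) n (fun g : G => (g, (1 : G))) :=
    contMDiff_id.prodMk contMDiff_const
  have h := mfderiv_comp (1 : G) (g := f) (hf.contMDiffAt.mdifferentiableAt hn)
    (hi.contMDiffAt.mdifferentiableAt hn)
  have e := derivAtOne_prodMk hn (1 : G × G) (contMDiff_id (I := J) (M := G) (n := n))
    (contMDiff_const (c := (1 : G)))
  rw [derivAtOne_const, LinearMap.comp_zero, add_zero] at e
  refine LinearMap.ext fun X => Eq.symm ((DFunLike.congr_fun h X).trans ?_)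
  have e' := DFunLike.congr_fun (e.trans (congrArg _ derivAtOne_id)) X
  exact congrArg (mfderiv (J.prod J) I f 1 : E × E →L[𝕜] E') e'

theorem derivAtOne_comp_inr (hn : n ≠ 0) {f : G × G → M} (p : M)
    (hf : ContMDiff (J.prod J) I n f) : derivAtOne (J.prod J) I f p ∘ₗ inr J (1 : G × G) =
      derivAtOne J I (fun g => f (1, g)) p := by
  have hi : ContMDiff J (J.prod J) n (fun g : G => ((1 : G), g)) :=
    contMDiff_const.prodMk contMDiff_id
  have h := mfderiv_comp (1 : G) (g := f) (hf.contMDiffAt.mdifferentiableAt hn)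
    (hi.contMDiffAt.mdifferentiableAt hn)
  have e := derivAtOne_prodMk hn (1 : G × G) (contMDiff_const (c := (1 : G)))
    (contMDiff_id (I := J) (M := G) (n := n))
  rw [derivAtOne_const, LinearMap.comp_zero, zero_add] at e
  refine LinearMap.ext fun X => Eq.symm ((DFunLike.congr_fun h X).trans ?_)
  have e' := DFunLike.congr_fun (e.trans (congrArg _ derivAtOne_id)) X
  exact congrArg (mfderiv (J.prod J) I f 1 : E × E →L[𝕜] E') e'

end Curves

section Group

variable {𝕜 : Type*} [NontriviallyNormedField 𝕜]
  {E : Type*} [NormedAddCommGroup E] [NormedSpace 𝕜 E]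
  {H : Type*} [TopologicalSpace H] {J : ModelWithCorners 𝕜 E H}
  {G : Type*} [TopologicalSpace G] [ChartedSpace H G] [Group G]
  {n : WithTop ℕ∞} [LieGroup J n G]

theorem contMDiff_conj (q : G) : ContMDiff J J n (fun g : G => q * g * q⁻¹) :=
  (contMDiff_const.mul contMDiff_id).mul contMDiff_const

theorem derivAtOne_inv (hn : n ≠ 0) :
    derivAtOne J J (fun g : G => g⁻¹) 1 = -LinearMap.id := by
  have hp : ContMDiff J (J.prod J) n (fun g : G => (g, g⁻¹)) :=
    contMDiff_id.prodMk (contMDiff_inv J n)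
  have hm : ContMDiff (J.prod J) J n (fun p : G × G => p.1 * p.2) := contMDiff_mul J n
  have h : dmap (J.prod J) J (fun p : G × G => p.1 * p.2) 1 ∘ₗ
      derivAtOne J (J.prod J) (fun g : G => (g, g⁻¹)) 1 = derivAtOne J J (fun g => g * g⁻¹) 1 := by
    exact dmap_comp_derivAtOne hn (by simp) hm hp
  have e0 : (fun g : G => g * g⁻¹) = fun _ => 1 := by ext g; simp
  have hid : ContMDiff J J n (fun g : G => g) := contMDiff_id
  rw [derivAtOne_prodMk hn 1 hid (contMDiff_inv J n), e0, derivAtOne_const,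
    LinearMap.comp_add, ← LinearMap.comp_assoc, ← LinearMap.comp_assoc] at h
  have h1 : dmap (J.prod J) J (fun p : G × G => p.1 * p.2) 1 ∘ₗ inl J (1 : G × G) =
      LinearMap.id := by
    refine (derivAtOne_comp_inl hn 1 hm).trans ?_
    simp only [mul_one]
    exact derivAtOne_id
  have h2 : dmap (J.prod J) J (fun p : G × G => p.1 * p.2) 1 ∘ₗ inr J (1 : G × G) =
      LinearMap.id := by
    refine (derivAtOne_comp_inr hn 1 hm).trans ?_
    simp only [one_mul]
    exact derivAtOne_id
  refine LinearMap.ext fun X => (neg_eq_of_add_eq_zero_right (a := X) ?_).symm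
  refine Eq.trans (congrArg₂ (fun a b : E => a + b) ?_ ?_) (DFunLike.congr_fun h X)
  · exact ((DFunLike.congr_fun h1 _).trans (DFunLike.congr_fun derivAtOne_id X)).symm
  · exact (DFunLike.congr_fun h2 _).symm

theorem derivAtOne_mul_conj (hn : n ≠ 0) (x q : G) :
    derivAtOne J J (fun g : G => q * (x * g * x⁻¹)) q = leftMap J q ∘ₗ adMap J x :=
  derivAtOne_comp hn (c := fun g => q * g) (by simp) contMDiff_mul_left (contMDiff_conj (n := n) x)

theorem derivAtOne_conj_mul (hn : n ≠ 0) (x q : G) :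
    derivAtOne J J (fun g : G => x * g * x⁻¹ * q) q = rightMap J q ∘ₗ adMap J x :=
  derivAtOne_comp hn (c := fun g => g * q) (by simp) contMDiff_mul_right (contMDiff_conj (n := n) x)

theorem adMap_mul (hn : n ≠ 0) (x y : G) : adMap J (x * y) = adMap J x ∘ₗ adMap J y := by
  refine Eq.trans ?_ (derivAtOne_comp hn (c := fun g => x * g * x⁻¹) (by simp)
    (contMDiff_conj (n := n) x) (contMDiff_conj (J := J) (n := n) y))
  have e : (fun g : G => x * y * g * (x * y)⁻¹) = fun g => x * (y * g * y⁻¹) * x⁻¹ := by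
    ext g
    group
  rw [← e]
  rfl

theorem adMap_one : adMap J (1 : G) = LinearMap.id := by
  refine Eq.trans ?_ derivAtOne_id
  have e : (fun g : G => 1 * g * 1⁻¹) = fun g => g := by
    ext g
    group
  rw [← e]
  rfl

theorem derivAtOne_mul_inv (hn : n ≠ 0) (q : G) :
    derivAtOne J J (fun g : G => q * g⁻¹) q = -leftMap J q := by
  have h := derivAtOne_comp hn (c := fun g : G => q * g) (s := fun g => g⁻¹) (p := q) (by simp)
    (contMDiff_mul_left (I := J) (n := n)) (contMDiff_inv J n)
  rw [h, derivAtOne_inv hn, LinearMap.comp_neg, LinearMap.comp_id]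
  rfl

theorem derivAtOne_inv_mul (hn : n ≠ 0) (q : G) :
    derivAtOne J J (fun g : G => g⁻¹ * q) q = -rightMap J q := by
  have h := derivAtOne_comp hn (c := fun g : G => g * q) (s := fun g => g⁻¹) (p := q) (by simp)
    (contMDiff_mul_right (I := J) (n := n)) (contMDiff_inv J n)
  rw [h, derivAtOne_inv hn, LinearMap.comp_neg, LinearMap.comp_id]
  rfl

end Group

end QuasiPoisson

end

noncomputable section

namespace QuasiPoisson

open Set Filter Topology

section Double

variable {𝕜 : Type*} [NontriviallyNormedField 𝕜]
  {E : Type*} [NormedAddCommGroup E] [NormedSpace 𝕜 E]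
  {H : Type*} [TopologicalSpace H] {J : ModelWithCorners 𝕜 E H}
  {G : Type*} [TopologicalSpace G] [ChartedSpace H G] [Group G]
  {n : WithTop ℕ∞}

/-- Right translation of the first component. -/
def moveLeft₁ (q : G × G) (g : G) : G × G := (q.1 * g, q.2)

/-- Left translation of the first component. -/
def moveRight₁ (q : G × G) (g : G) : G × G := (g * q.1, q.2)

/-- Right translation of the second component. -/
def moveLeft₂ (q : G × G) (g : G) : G × G := (q.1, q.2 * g)

/-- Left translation of the second component. -/
def moveRight₂ (q : G × G) (g : G) : G × G := (q.1, g * q.2)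

section

variable [LieGroup J n G]

variable (J n) in
theorem isMotion_moveLeft₁ : IsMotion J (J.prod J) n (moveLeft₁ : G × G → G → G × G) :=
  ⟨(contMDiff_fst.fst.mul contMDiff_snd).prodMk contMDiff_fst.snd, fun q => by simp [moveLeft₁]⟩

variable (J n) in
theorem isMotion_moveRight₁ : IsMotion J (J.prod J) n (moveRight₁ : G × G → G → G × G) :=
  ⟨(contMDiff_snd.mul contMDiff_fst.fst).prodMk contMDiff_fst.snd, fun q => by simp [moveRight₁]⟩

variable (J n) in
theorem isMotion_moveLeft₂ : IsMotion J (J.prod J) n (moveLeft₂ : G × G → G → G × G) :=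
  ⟨contMDiff_fst.fst.prodMk (contMDiff_fst.snd.mul contMDiff_snd), fun q => by simp [moveLeft₂]⟩

variable (J n) in
theorem isMotion_moveRight₂ : IsMotion J (J.prod J) n (moveRight₂ : G × G → G → G × G) :=
  ⟨contMDiff_fst.fst.prodMk (contMDiff_snd.mul contMDiff_fst.snd), fun q => by simp [moveRight₂]⟩

theorem velocity_moveLeft₁ (hn : n ≠ 0) (q : G × G) :
    (velocity J (J.prod J) moveLeft₁ q).toLinearMap = inl J q ∘ₗ leftMap J q.1 := by
  refine (derivAtOne_prodMk hn q (contMDiff_mul_left (I := J) (n := n)) contMDiff_const).trans ?_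
  rw [derivAtOne_const, LinearMap.comp_zero, add_zero]
  rfl

theorem velocity_moveRight₁ (hn : n ≠ 0) (q : G × G) :
    (velocity J (J.prod J) moveRight₁ q).toLinearMap = inl J q ∘ₗ rightMap J q.1 := by
  refine (derivAtOne_prodMk hn q (contMDiff_mul_right (I := J) (n := n)) contMDiff_const).trans ?_
  rw [derivAtOne_const, LinearMap.comp_zero, add_zero]
  rfl

theorem velocity_moveLeft₂ (hn : n ≠ 0) (q : G × G) :
    (velocity J (J.prod J) moveLeft₂ q).toLinearMap = inr J q ∘ₗ leftMap J q.2 := by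
  refine (derivAtOne_prodMk hn q contMDiff_const (contMDiff_mul_left (I := J) (n := n))).trans ?_
  rw [derivAtOne_const, LinearMap.comp_zero, zero_add]
  rfl

theorem velocity_moveRight₂ (hn : n ≠ 0) (q : G × G) :
    (velocity J (J.prod J) moveRight₂ q).toLinearMap = inr J q ∘ₗ rightMap J q.2 := by
  refine (derivAtOne_prodMk hn q contMDiff_const (contMDiff_mul_right (I := J) (n := n))).trans ?_
  rw [derivAtOne_const, LinearMap.comp_zero, zero_add]
  rfl

theorem fund_doubleAct_comp_inl (hn : n ≠ 0) (q : G × G) :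
    fund (J.prod J) (J.prod J) doubleAct q ∘ₗ inl J (1 : G × G) =
      inr J q ∘ₗ leftMap J q.2 - inl J q ∘ₗ rightMap J q.1 := by
  have hc : ContMDiff (J.prod J) (J.prod J) n (fun p : G × G => doubleAct p q) :=
    ((contMDiff_fst.mul contMDiff_const).mul (contMDiff_snd.inv)).prodMk
      ((contMDiff_snd.mul contMDiff_const).mul (contMDiff_fst.inv))
  have h := derivAtOne_comp_inl hn q hc
  have e : (fun g : G => doubleAct (g, 1) q) = fun g => (g * q.1, q.2 * g⁻¹) := by
    ext g <;> simp [doubleAct]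
  have h2 : ContMDiff J J n (fun g : G => q.2 * g⁻¹) := contMDiff_const.mul (contMDiff_inv J n)
  rw [e, derivAtOne_prodMk hn q contMDiff_mul_right h2, derivAtOne_mul_inv hn] at h
  refine (LinearMap.neg_comp _ _).trans ((congrArg Neg.neg h).trans ?_)
  rw [LinearMap.comp_neg, neg_add, neg_neg, neg_add_eq_sub]
  rfl

theorem fund_doubleAct_comp_inr (hn : n ≠ 0) (q : G × G) :
    fund (J.prod J) (J.prod J) doubleAct q ∘ₗ inr J (1 : G × G) =
      inl J q ∘ₗ leftMap J q.1 - inr J q ∘ₗ rightMap J q.2 := by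
  have hc : ContMDiff (J.prod J) (J.prod J) n (fun p : G × G => doubleAct p q) :=
    ((contMDiff_fst.mul contMDiff_const).mul (contMDiff_snd.inv)).prodMk
      ((contMDiff_snd.mul contMDiff_const).mul (contMDiff_fst.inv))
  have h := derivAtOne_comp_inr hn q hc
  have e : (fun g : G => doubleAct (1, g) q) = fun g => (q.1 * g⁻¹, g * q.2) := by
    ext g <;> simp [doubleAct]
  have h2 : ContMDiff J J n (fun g : G => q.1 * g⁻¹) := contMDiff_const.mul (contMDiff_inv J n)
  rw [e, derivAtOne_prodMk hn q h2 contMDiff_mul_right, derivAtOne_mul_inv hn] at h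
  refine (LinearMap.neg_comp _ _).trans ((congrArg Neg.neg h).trans ?_)
  rw [LinearMap.comp_neg, neg_add, neg_neg, ← sub_eq_add_neg]
  rfl

theorem doubleBivector_eq_motionTensor (hn : n ≠ 0)
    (T : GroupLieAlgebra J G ⊗[𝕜] GroupLieAlgebra J G) :
    doubleBivector T = (1 / 2 : 𝕜) •
      ((motionTensor (J.prod J) moveLeft₁ moveRight₂ T -
        motionTensor (J.prod J) moveRight₂ moveLeft₁ T) +
      (motionTensor (J.prod J) moveRight₁ moveLeft₂ T -
        motionTensor (J.prod J) moveLeft₂ moveRight₁ T)) := by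
  ext1 q
  simp only [doubleBivector, motionTensor, Pi.smul_apply, Pi.add_apply, Pi.sub_apply,
    velocity_moveLeft₁ hn, velocity_moveRight₁ hn, velocity_moveLeft₂ hn, velocity_moveRight₂ hn]

variable [J.Boundaryless] [IsManifold (J.prod J) 1 (G × G)]

theorem isGermOf_doubleBivector (hn : n + 1 ≤ n) (hn0 : n ≠ 0)
    (T : GroupLieAlgebra J G ⊗[𝕜] GroupLieAlgebra J G) (q : G × G) :
    IsGermOf n q (doubleBivector T) ((1 / 2 : 𝕜) •
      ((Algebraic.biop (alongGerm (isMotion_moveLeft₁ J n) hn q)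
          (alongGerm (isMotion_moveRight₂ J n) hn q) T -
        Algebraic.biop (alongGerm (isMotion_moveRight₂ J n) hn q)
          (alongGerm (isMotion_moveLeft₁ J n) hn q) T) +
      (Algebraic.biop (alongGerm (isMotion_moveRight₁ J n) hn q)
          (alongGerm (isMotion_moveLeft₂ J n) hn q) T -
        Algebraic.biop (alongGerm (isMotion_moveLeft₂ J n) hn q)
          (alongGerm (isMotion_moveRight₁ J n) hn q) T))) := by
  rw [doubleBivector_eq_motionTensor hn0]
  exact (((isGermOf_motionTensor _ _ hn T).sub (isGermOf_motionTensor _ _ hn T)).add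
    ((isGermOf_motionTensor _ _ hn T).sub (isGermOf_motionTensor _ _ hn T))).smul _

theorem IsAdInvSymm.biop_moveLeft₁ {T : GroupLieAlgebra J G ⊗[𝕜] GroupLieAlgebra J G}
    (hT : IsAdInvSymm J T) (hn : n + 1 ≤ n) (hn0 : n ≠ 0) (q : G × G) :
    Algebraic.biop (alongGerm (isMotion_moveLeft₁ J n) hn q)
        (alongGerm (isMotion_moveLeft₁ J n) hn q) T =
      Algebraic.biop (alongGerm (isMotion_moveRight₁ J n) hn q)
        (alongGerm (isMotion_moveRight₁ J n) hn q) T := by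
  refine (isGermOf_motionTensor _ _ hn T).unique ?_
  have e : motionTensor (J.prod J) moveLeft₁ moveLeft₁ T =
      motionTensor (J.prod J) moveRight₁ moveRight₁ T := by
    ext1 p
    simp only [motionTensor, velocity_moveLeft₁ hn0, velocity_moveRight₁ hn0]
    rw [map_comp_apply, map_comp_apply, hT.map_leftMap hn0]
  rw [e]
  exact isGermOf_motionTensor _ _ hn T

theorem IsAdInvSymm.biop_moveLeft₂ {T : GroupLieAlgebra J G ⊗[𝕜] GroupLieAlgebra J G}
    (hT : IsAdInvSymm J T) (hn : n + 1 ≤ n) (hn0 : n ≠ 0) (q : G × G) :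
    Algebraic.biop (alongGerm (isMotion_moveLeft₂ J n) hn q)
        (alongGerm (isMotion_moveLeft₂ J n) hn q) T =
      Algebraic.biop (alongGerm (isMotion_moveRight₂ J n) hn q)
        (alongGerm (isMotion_moveRight₂ J n) hn q) T := by
  refine (isGermOf_motionTensor _ _ hn T).unique ?_
  have e : motionTensor (J.prod J) moveLeft₂ moveLeft₂ T =
      motionTensor (J.prod J) moveRight₂ moveRight₂ T := by
    ext1 p
    simp only [motionTensor, velocity_moveLeft₂ hn0, velocity_moveRight₂ hn0]
    rw [map_comp_apply, map_comp_apply, hT.map_leftMap hn0]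
  rw [e]
  exact isGermOf_motionTensor _ _ hn T

end

end Double

end QuasiPoisson

end

noncomputable section

namespace QuasiPoisson

open Set Filter Topology

section Homomorphisms

variable {𝕜 : Type*} [NontriviallyNormedField 𝕜]
  {E : Type*} [NormedAddCommGroup E] [NormedSpace 𝕜 E]
  {E' : Type*} [NormedAddCommGroup E'] [NormedSpace 𝕜 E']
  {F : Type*} [NormedAddCommGroup F] [NormedSpace 𝕜 F]
  {H : Type*} [TopologicalSpace H] {J : ModelWithCorners 𝕜 E H}
  {G : Type*} [TopologicalSpace G] [ChartedSpace H G] [Group G]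
  {H' : Type*} [TopologicalSpace H'] {I : ModelWithCorners 𝕜 E' H'}
  {M : Type*} [TopologicalSpace M] [ChartedSpace H' M]
  {K : Type*} [TopologicalSpace K] [ChartedSpace H' K] [Group K]
  {k : WithTop ℕ∞}

theorem tderiv_comp_derivAtOne {v : M → F} {c : G → M} {p : M} (hp : c 1 = p)
    (hv : MDifferentiableAt I 𝓘(𝕜, F) v p) (hc : MDifferentiableAt J I c 1)
    (X : GroupLieAlgebra J G) :
    tderiv J (fun g => v (c g)) 1 X = tderiv I v p (derivAtOne J I c p X) := by
  subst hp
  exact DFunLike.congr_fun (tderiv_comp hv hc) X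

variable [J.Boundaryless] [I.Boundaryless] [CompleteSpace E] [CompleteSpace E']
  [LieGroup J (minSmoothness 𝕜 3) G] [LieGroup J k G] [LieGroup I (minSmoothness 𝕜 3) K]
  [LieGroup I k K]

/-- The derivative at the identity of a homomorphism of Lie groups is a homomorphism of Lie
algebras. -/
theorem derivAtOne_lie (hk : minSmoothness 𝕜 2 ≤ k) (π : K →* G) (hπ : ContMDiff I J k π)
    (X Y : GroupLieAlgebra I K) :
    (derivAtOne I J π 1 ⁅X, Y⁆ : GroupLieAlgebra J G) =
      ⁅(derivAtOne I J π 1 X : GroupLieAlgebra J G), derivAtOne I J π 1 Y⁆ := by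
  have hk1 : 1 ≤ k := one_le_of_minSmoothness_le hk
  have hk0 : k ≠ 0 := ne_zero_of_minSmoothness_le hk
  have : IsManifold J 1 G := IsManifold.of_le hk1
  have hu : ContMDiffAt J 𝓘(𝕜, E) k (extChartAt J (1 : G)) 1 := contMDiffAt_extChartAt
  generalize hu' : (extChartAt J (1 : G) : G → E) = u at hu
  have hπd : MDifferentiableAt I J π 1 := hπ.contMDiffAt.mdifferentiableAt hk0
  have hw : ∀ Z : GroupLieAlgebra J G, MDifferentiableAt J 𝓘(𝕜, E)
      (fun h => tderiv J (fun g => u (h * g)) 1 Z) 1 := fun Z => by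
    refine (contMDiffAt_tderiv (m := 1) (n := k) (f := fun h g => u (h * g)) ?_ ?_
      Z).mdifferentiableAt (by simp)
    · refine ContMDiffAt.comp ((1 : G), (1 : G)) (g := u) ?_ (contMDiff_mul J k).contMDiffAt
      rwa [mul_one]
    · rw [one_add_one_eq_two]
      exact le_minSmoothness.trans hk
  have hstep : ∀ Z W : GroupLieAlgebra I K,
      tderiv I (fun h => tderiv I (fun g => u (π (h * g))) 1 Z) 1 W =
        tderiv J (fun h => tderiv J (fun g => u (h * g)) 1 (derivAtOne I J π 1 Z)) 1
          (derivAtOne I J π 1 W) := fun Z W => by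
    rw [← tderiv_comp_derivAtOne (map_one π) (hw _) hπd]
    refine DFunLike.congr_fun (tderiv_congr ?_) W
    have ht : Tendsto π (𝓝 1) (𝓝 1) := by
      simpa only [ContinuousAt, map_one] using hπ.continuous.continuousAt (x := (1 : K))
    filter_upwards [ht.eventually (eventually_mdifferentiableAt hu hk1)] with h hh
    simp only [map_mul]
    refine tderiv_comp_derivAtOne (v := fun g => u (π h * g)) (map_one π) ?_ hπd Z
    refine MDifferentiableAt.comp (1 : G) (g := u) ?_
      ((contMDiff_mul_left (I := J) (n := k) (a := π h)).contMDiffAt.mdifferentiableAt hk0)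
    rwa [mul_one]
  have hd : MDifferentiableAt J 𝓘(𝕜, E) u 1 := hu.mdifferentiableAt hk0
  have hc : ContMDiffAt I 𝓘(𝕜, E) k (fun g => u (π g)) 1 :=
    ContMDiffAt.comp (1 : K) (g := u) (by rwa [map_one]) hπ.contMDiffAt
  have h1 := tderiv_lie hk hc X Y
  rw [hstep, hstep, ← tderiv_lie hk hu, tderiv_comp_derivAtOne (map_one π) hd hπd, ← hu'] at h1
  have hid : ∀ Z : TangentSpace J (1 : G), (tderiv J (extChartAt J (1 : G)) 1 Z : E) = Z :=
    fun Z => tderiv_extChartAt Z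
  exact (hid _).symm.trans (h1.trans (hid _))

end Homomorphisms

section Double

variable {𝕜 : Type*} [NontriviallyNormedField 𝕜]
  {E : Type*} [NormedAddCommGroup E] [NormedSpace 𝕜 E] [CompleteSpace E]
  {H : Type*} [TopologicalSpace H] {J : ModelWithCorners 𝕜 E H} [J.Boundaryless]
  {G : Type*} [TopologicalSpace G] [ChartedSpace H G] [Group G]
  {k : WithTop ℕ∞} [LieGroup J (minSmoothness 𝕜 3) G] [LieGroup J k G]

theorem inl_lie_inl (hk : minSmoothness 𝕜 2 ≤ k) (X Y : GroupLieAlgebra J G) :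
    (⁅(inl J (1 : G × G) X : GroupLieAlgebra (J.prod J) (G × G)), inl J (1 : G × G) Y⁆ :
      GroupLieAlgebra (J.prod J) (G × G)) = inl J (1 : G × G) ⁅X, Y⁆ := by
  have hk0 : k ≠ 0 := ne_zero_of_minSmoothness_le hk
  have hid : ContMDiff J J k (fun g : G => g) := contMDiff_id
  have h := derivAtOne_lie (I := J) (J := J.prod J) hk (MonoidHom.inl G G) (hid.prodMk contMDiff_const) X Y
  have e : derivAtOne J (J.prod J) (MonoidHom.inl G G) 1 = inl J (1 : G × G) := by
    refine (derivAtOne_prodMk hk0 1 hid contMDiff_const).trans ?_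
    rw [derivAtOne_const, LinearMap.comp_zero, add_zero]
    exact congrArg (fun l => inl J (1 : G × G) ∘ₗ l) derivAtOne_id
  rw [e] at h
  exact h.symm

theorem inr_lie_inr (hk : minSmoothness 𝕜 2 ≤ k) (X Y : GroupLieAlgebra J G) :
    (⁅(inr J (1 : G × G) X : GroupLieAlgebra (J.prod J) (G × G)), inr J (1 : G × G) Y⁆ :
      GroupLieAlgebra (J.prod J) (G × G)) = inr J (1 : G × G) ⁅X, Y⁆ := by
  have hk0 : k ≠ 0 := ne_zero_of_minSmoothness_le hk
  have hid : ContMDiff J J k (fun g : G => g) := contMDiff_id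
  have h := derivAtOne_lie (I := J) (J := J.prod J) hk (MonoidHom.inr G G) (contMDiff_const.prodMk hid) X Y
  have e : derivAtOne J (J.prod J) (MonoidHom.inr G G) 1 = inr J (1 : G × G) := by
    refine (derivAtOne_prodMk hk0 1 contMDiff_const hid).trans ?_
    rw [derivAtOne_const, LinearMap.comp_zero, zero_add]
    exact congrArg (fun l => inr J (1 : G × G) ∘ₗ l) derivAtOne_id
  rw [e] at h
  exact h.symm

theorem inl_lie_inr (hk : minSmoothness 𝕜 2 ≤ k) (X Y : GroupLieAlgebra J G) :
    (⁅(inl J (1 : G × G) X : GroupLieAlgebra (J.prod J) (G × G)), inr J (1 : G × G) Y⁆ :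
      GroupLieAlgebra (J.prod J) (G × G)) = 0 := by
  have h1 := derivAtOne_lie hk (MonoidHom.fst G G) (contMDiff_fst (I := J) (J := J))
    (inl J (1 : G × G) X) (inr J (1 : G × G) Y)
  have h2 := derivAtOne_lie hk (MonoidHom.snd G G) (contMDiff_snd (I := J) (J := J))
    (inl J (1 : G × G) X) (inr J (1 : G × G) Y)
  have e1 : derivAtOne (J.prod J) J (MonoidHom.fst G G) 1 = LinearMap.fst 𝕜 E E :=
    congrArg ContinuousLinearMap.toLinearMap (mfderiv_fst (I := J) (I' := J) (x := (1 : G × G)))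
  have e2 : derivAtOne (J.prod J) J (MonoidHom.snd G G) 1 = LinearMap.snd 𝕜 E E :=
    congrArg ContinuousLinearMap.toLinearMap (mfderiv_snd (I := J) (I' := J) (x := (1 : G × G)))
  rw [e1] at h1
  rw [e2] at h2
  exact Prod.ext (h1.trans (lie_zero (X : GroupLieAlgebra J G)))
    (h2.trans (zero_lie (Y : GroupLieAlgebra J G)))

end Double

end QuasiPoisson

end

noncomputable section

namespace QuasiPoisson

theorem map_cartanElement_map_add_map {K : Type*} [Field K] {L L' : Type*} [LieRing L]
    [LieAlgebra K L] [LieRing L'] [LieAlgebra K L'] {V : Type*} [AddCommGroup V] [Module K V]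
    {i j : L →ₗ[K] L'} (hi : ∀ X Y, ⁅i X, i Y⁆ = i ⁅X, Y⁆)
    (hj : ∀ X Y, ⁅j X, j Y⁆ = j ⁅X, Y⁆) (hij : ∀ X Y, ⁅i X, j Y⁆ = 0)
    {F : L' →ₗ[K] V} {A B : L →ₗ[K] V} (hA : F ∘ₗ i = A) (hB : F ∘ₗ j = B) (H : L ⊗[K] L) :
    TensorProduct.map F (TensorProduct.map F F)
        (cartanElement (TensorProduct.map i i H + TensorProduct.map j j H)) =
      TensorProduct.map A (TensorProduct.map A A) (cartanElement H) +
        TensorProduct.map B (TensorProduct.map B B) (cartanElement H) := by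
  subst hA hB
  rw [cartanElement_map_add_map hi hj hij, map_add]
  simp only [TensorProduct.map_comp, LinearMap.comp_apply]

section Double

variable {𝕜 : Type*} [NontriviallyNormedField 𝕜]
  {E : Type*} [NormedAddCommGroup E] [NormedSpace 𝕜 E]
  {H : Type*} [TopologicalSpace H] {J : ModelWithCorners 𝕜 E H}
  {G : Type*} [TopologicalSpace G] [ChartedSpace H G] [Group G]
  {n : WithTop ℕ∞}
  {T : GroupLieAlgebra J G ⊗[𝕜] GroupLieAlgebra J G}

theorem dmap_comp_velocity {F : G × G → G × G} {a : G × G → G → G × G} (hn : n ≠ 0)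
    (ha : IsMotion J (J.prod J) n a) (hF : ContMDiff (J.prod J) (J.prod J) n F) (q : G × G)
    {c d : G → G} (hc : ContMDiff J J n c) (hd : ContMDiff J J n d)
    (hcd : ∀ g, F (a q g) = (c g, d g)) :
    dmap (J.prod J) (J.prod J) F q ∘ₗ (velocity J (J.prod J) a q).toLinearMap =
      inl J (F q) ∘ₗ derivAtOne J J c (F q).1 + inr J (F q) ∘ₗ derivAtOne J J d (F q).2 := by
  rw [← derivAtOne_prodMk hn _ hc hd, ← funext hcd]
  exact dmap_comp_derivAtOne hn (ha.map_one q) hF (ha.contMDiff_right q)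

theorem comm_doubleBivector (hT : IsAdInvSymm J T) (q : G × G) :
    TensorProduct.comm 𝕜 _ _ (doubleBivector T q) = -doubleBivector T q := by
  have h : ∀ A B : GroupLieAlgebra J G →ₗ[𝕜] TangentSpace (J.prod J) q,
      TensorProduct.comm 𝕜 _ _ (TensorProduct.map A B T) = TensorProduct.map B A T := fun A B => by
    conv_rhs => rw [← hT.symm]
    exact (TensorProduct.map_comm B A T).symm
  simp only [doubleBivector, map_smul, map_add, map_sub, h]
  rw [← smul_neg]
  congr 1
  abel

variable [LieGroup J n G]

/-- Replacing a tensor by its image under the adjoint action. -/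
theorem IsAdInvSymm.map_comp_adMap {V W : Type*} [AddCommGroup V] [Module 𝕜 V] [AddCommGroup W]
    [Module 𝕜 W] (hT : IsAdInvSymm J T) (A : GroupLieAlgebra J G →ₗ[𝕜] V)
    (B : GroupLieAlgebra J G →ₗ[𝕜] W) (x : G) :
    TensorProduct.map (A ∘ₗ adMap J x) (B ∘ₗ adMap J x) T = TensorProduct.map A B T := by
  rw [map_comp_apply, hT.ad_inv]

theorem contMDiff_doubleAct : ContMDiff ((J.prod J).prod (J.prod J)) (J.prod J) n
    (fun p : (G × G) × (G × G) => doubleAct p.1 p.2) :=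
  ((contMDiff_fst.fst.mul contMDiff_snd.fst).mul contMDiff_fst.snd.inv).prodMk
    ((contMDiff_fst.snd.mul contMDiff_snd.snd).mul contMDiff_fst.fst.inv)

theorem isManifoldAction_doubleAct :
    IsManifoldAction (J.prod J) (J.prod J) n (doubleAct : G × G → G × G → G × G) where
  one_act q := by simp [doubleAct]
  mul_act p p' q := by simp [doubleAct, mul_assoc]
  contMDiff := contMDiff_doubleAct

theorem isInvariant_doubleBivector (hT : IsAdInvSymm J T) (hn : n ≠ 0) :
    IsInvariant doubleAct (doubleBivector T) := by
  rintro p q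
  have hF : ContMDiff (J.prod J) (J.prod J) n (fun q : G × G => doubleAct p q) :=
    contMDiff_doubleAct.comp (contMDiff_const.prodMk contMDiff_id)
  have hL : ∀ x y : G, ContMDiff J J n (fun g => y * (x * g * x⁻¹)) := fun x y =>
    contMDiff_const.mul (contMDiff_conj x)
  have hR : ∀ x y : G, ContMDiff J J n (fun g => x * g * x⁻¹ * y) := fun x y =>
    (contMDiff_conj x).mul contMDiff_const
  have hL₁ := dmap_comp_velocity hn (isMotion_moveLeft₁ J n) hF q (hL p.2 (doubleAct p q).1)
    contMDiff_const (d := fun _ => (doubleAct p q).2)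
    (fun g => by simp [doubleAct, moveLeft₁, mul_assoc])
  have hR₁ := dmap_comp_velocity hn (isMotion_moveRight₁ J n) hF q (hR p.1 (doubleAct p q).1)
    contMDiff_const (d := fun _ => (doubleAct p q).2)
    (fun g => by simp [doubleAct, moveRight₁, mul_assoc])
  have hL₂ := dmap_comp_velocity hn (isMotion_moveLeft₂ J n) hF q contMDiff_const
    (c := fun _ => (doubleAct p q).1) (hL p.1 (doubleAct p q).2)
    (fun g => by simp [doubleAct, moveLeft₂, mul_assoc])
  have hR₂ := dmap_comp_velocity hn (isMotion_moveRight₂ J n) hF q contMDiff_const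
    (c := fun _ => (doubleAct p q).1) (hR p.2 (doubleAct p q).2)
    (fun g => by simp [doubleAct, moveRight₂, mul_assoc])
  simp only [derivAtOne_const, LinearMap.comp_zero, add_zero, zero_add, derivAtOne_mul_conj hn,
    derivAtOne_conj_mul hn, velocity_moveLeft₁ hn, velocity_moveRight₁ hn, velocity_moveLeft₂ hn,
    velocity_moveRight₂ hn] at hL₁ hR₁ hL₂ hR₂
  change TensorProduct.map (dmap (J.prod J) (J.prod J) (fun q : G × G => doubleAct p q) q)
    (dmap (J.prod J) (J.prod J) (fun q : G × G => doubleAct p q) q) _ = _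
  simp only [doubleBivector, map_smul, map_add, map_sub, ← map_comp_apply, hL₁, hR₁, hL₂, hR₂]
  simp only [← LinearMap.comp_assoc, hT.map_comp_adMap]

variable [J.Boundaryless]

theorem IsAdInvSymm.isBivectorField_doubleBivector (hT : IsAdInvSymm J T) (hn : n + 1 ≤ n)
    (hn' : minSmoothness 𝕜 2 ≤ n) :
    IsBivectorField n (doubleBivector T) where
  skew := comm_doubleBivector hT
  admissible q f h hf hh := by
    have : IsManifold (J.prod J) 1 (G × G) := IsManifold.of_le (one_le_of_minSmoothness_le hn')
    exact (isGermOf_doubleBivector hn (ne_zero_of_minSmoothness_le hn') T q f h hf hh).1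

theorem evalGerm_alongGerm_sub [IsManifold (J.prod J) 1 (G × G)] {a b : G × G → G → G × G}
    (ha : IsMotion J (J.prod J) n a) (hb : IsMotion J (J.prod J) n b) (hn : n + 1 ≤ n) {q : G × G}
    (X : GroupLieAlgebra J G) (f : G × G → 𝕜) (hf : ContMDiffAt (J.prod J) 𝓘(𝕜, 𝕜) n f q) :
    evalGerm (J.prod J) n q ((alongGerm ha hn q - alongGerm hb hn q) X (germ f hf)) =
      diff (J.prod J) f q (((velocity J (J.prod J) a q).toLinearMap -
        (velocity J (J.prod J) b q).toLinearMap) X) := by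
  rw [LinearMap.sub_apply, LinearMap.sub_apply, map_sub, alongGerm_germ, alongGerm_germ,
    evalGerm_germ, evalGerm_germ, LinearMap.sub_apply, map_sub]
  rfl

variable [CompleteSpace E] [LieGroup J (minSmoothness 𝕜 3) G]

theorem IsAdInvSymm.schouten_eq_evalGerm [CharZero 𝕜] [IsManifold (J.prod J) 1 (G × G)]
    (hT : IsAdInvSymm J T) (hn : n + 1 ≤ n)
    (hn' : minSmoothness 𝕜 2 ≤ n) (q : G × G) {f g h : G × G → 𝕜}
    (hf : ContMDiffAt (J.prod J) 𝓘(𝕜, 𝕜) n f q) (hg : ContMDiffAt (J.prod J) 𝓘(𝕜, 𝕜) n g q)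
    (hh : ContMDiffAt (J.prod J) 𝓘(𝕜, 𝕜) n h q) :
    schouten (doubleBivector T) (doubleBivector T) f g h q = evalGerm (J.prod J) n q
      (Algebraic.triop (alongGerm (isMotion_moveLeft₂ J n) hn q -
          alongGerm (isMotion_moveRight₁ J n) hn q) (cartanElement T)
          (germ f hf) (germ g hg) (germ h hh) +
        Algebraic.triop (alongGerm (isMotion_moveLeft₁ J n) hn q -
          alongGerm (isMotion_moveRight₂ J n) hn q) (cartanElement T)
          (germ f hf) (germ g hg) (germ h hh)) := by
  have hn0 := ne_zero_of_minSmoothness_le hn'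
  have hL₁ := isMotion_moveLeft₁ (G := G) J n
  have hR₁ := isMotion_moveRight₁ (G := G) J n
  have hL₂ := isMotion_moveLeft₂ (G := G) J n
  have hR₂ := isMotion_moveRight₂ (G := G) J n
  refine ((isGermOf_doubleBivector hn hn0 T q).schouten hf hg hh).trans
    (congrArg (evalGerm (J.prod J) n q) ?_)
  exact Algebraic.schouten_double (isLeibniz_alongGerm hL₁ hn) (isLeibniz_alongGerm hR₁ hn)
    (isLeibniz_alongGerm hL₂ hn) (isLeibniz_alongGerm hR₂ hn)
    (alongGerm_lie_right hL₁ (fun m g h => by simp [moveLeft₁, mul_assoc]) hn hn')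
    (alongGerm_lie_left hR₁ (fun m g h => by simp [moveRight₁, mul_assoc]) hn hn')
    (alongGerm_lie_right hL₂ (fun m g h => by simp [moveLeft₂, mul_assoc]) hn hn')
    (alongGerm_lie_left hR₂ (fun m g h => by simp [moveRight₂, mul_assoc]) hn hn')
    (alongGerm_comm hL₁ hR₁ (fun m g h => by simp [moveLeft₁, moveRight₁, mul_assoc]) hn hn')
    (alongGerm_comm hL₂ hR₂ (fun m g h => by simp [moveLeft₂, moveRight₂, mul_assoc]) hn hn')
    (alongGerm_comm hL₁ hL₂ (fun m g h => rfl) hn hn')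
    (alongGerm_comm hL₁ hR₂ (fun m g h => rfl) hn hn')
    (alongGerm_comm hR₁ hL₂ (fun m g h => rfl) hn hn')
    (alongGerm_comm hR₁ hR₂ (fun m g h => rfl) hn hn')
    hT.symm (hT.isLieInvariant_alongGerm hR₂ hL₁ hn hn')
    (hT.isLieInvariant_alongGerm hR₁ hL₂ hn hn')
    (fun f h => LinearMap.congr_fun₂ (hT.biop_moveLeft₁ hn hn0 q) f h)
    (fun f h => LinearMap.congr_fun₂ (hT.biop_moveLeft₂ hn hn0 q) f h) _ _ _

theorem map_fund_cartanElement_doubleTensor (hn' : minSmoothness 𝕜 2 ≤ n) (q : G × G) :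
    TensorProduct.map (fund (J.prod J) (J.prod J) doubleAct q)
        (TensorProduct.map (fund (J.prod J) (J.prod J) doubleAct q)
          (fund (J.prod J) (J.prod J) doubleAct q)) (cartanElement (doubleTensor T)) =
      TensorProduct.map (inr J q ∘ₗ leftMap J q.2 - inl J q ∘ₗ rightMap J q.1)
        (TensorProduct.map (inr J q ∘ₗ leftMap J q.2 - inl J q ∘ₗ rightMap J q.1)
          (inr J q ∘ₗ leftMap J q.2 - inl J q ∘ₗ rightMap J q.1)) (cartanElement T) +
      TensorProduct.map (inl J q ∘ₗ leftMap J q.1 - inr J q ∘ₗ rightMap J q.2)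
        (TensorProduct.map (inl J q ∘ₗ leftMap J q.1 - inr J q ∘ₗ rightMap J q.2)
          (inl J q ∘ₗ leftMap J q.1 - inr J q ∘ₗ rightMap J q.2)) (cartanElement T) := by
  have hn0 := ne_zero_of_minSmoothness_le hn'
  exact map_cartanElement_map_add_map (L' := GroupLieAlgebra (J.prod J) (G × G))
    (inl_lie_inl hn') (inr_lie_inr hn') (inl_lie_inr hn')
    (fund_doubleAct_comp_inl hn0 q) (fund_doubleAct_comp_inr hn0 q) T

theorem IsAdInvSymm.schouten_doubleBivector [CharZero 𝕜] (hT : IsAdInvSymm J T) (hn : n + 1 ≤ n)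
    (hn' : minSmoothness 𝕜 2 ≤ n) (q : G × G) {f g h : G × G → 𝕜}
    (hf : ContMDiffAt (J.prod J) 𝓘(𝕜, 𝕜) n f q) (hg : ContMDiffAt (J.prod J) 𝓘(𝕜, 𝕜) n g q)
    (hh : ContMDiffAt (J.prod J) 𝓘(𝕜, 𝕜) n h q) :
    schouten (doubleBivector T) (doubleBivector T) f g h q =
      tridiffAt q (TensorProduct.map (fund (J.prod J) (J.prod J) doubleAct q)
        (TensorProduct.map (fund (J.prod J) (J.prod J) doubleAct q)
          (fund (J.prod J) (J.prod J) doubleAct q)) (cartanElement (doubleTensor T))) f g h := by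
  have hn0 := ne_zero_of_minSmoothness_le hn'
  have : IsManifold (J.prod J) 1 (G × G) := IsManifold.of_le (one_le_of_minSmoothness_le hn')
  rw [map_fund_cartanElement_doubleTensor hn', hT.schouten_eq_evalGerm hn hn' q hf hg hh, map_add,
    evalGerm_triop (evalGerm_alongGerm_sub _ _ hn) _ hf hg hh,
    evalGerm_triop (evalGerm_alongGerm_sub _ _ hn) _ hf hg hh, velocity_moveLeft₁ hn0,
    velocity_moveRight₁ hn0, velocity_moveLeft₂ hn0, velocity_moveRight₂ hn0]
  exact (map_add (TensorProduct.dualDistrib 𝕜 _ _ _) _ _).symm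

theorem IsAdInvSymm.isQuasiPoisson_doubleBivector [CharZero 𝕜] (hT : IsAdInvSymm J T)
    (hn : n + 1 ≤ n) (hn' : minSmoothness 𝕜 2 ≤ n) :
    IsQuasiPoisson n doubleAct (doubleTensor T) (doubleBivector T) where
  bivector := hT.isBivectorField_doubleBivector hn hn'
  invariant := isInvariant_doubleBivector hT (ne_zero_of_minSmoothness_le hn')
  schouten_eq q _ _ _ := hT.schouten_doubleBivector hn hn' q

end Double

end QuasiPoisson

end

noncomputable section

namespace QuasiPoisson

section Momentum

variable {𝕜 : Type*} [NontriviallyNormedField 𝕜]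
  {E : Type*} [NormedAddCommGroup E] [NormedSpace 𝕜 E]
  {H : Type*} [TopologicalSpace H] {J : ModelWithCorners 𝕜 E H}
  {G : Type*} [TopologicalSpace G] [ChartedSpace H G] [Group G]
  {n : WithTop ℕ∞} [LieGroup J n G]
  {T : GroupLieAlgebra J G ⊗[𝕜] GroupLieAlgebra J G}

/-- The identity of tensors behind the momentum property of the double: `l₁, r₁` and `l₂, r₂` are
the left and right translations at the two components of the moment, `L₁, R₁, L₂, R₂` those on the
double. -/
theorem momentum_identity {V W : Type*} [AddCommGroup V] [Module 𝕜 V] [AddCommGroup W]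
    [Module 𝕜 W] (hT : IsAdInvSymm J T) (hn : n ≠ 0) {x y : G}
    {l₁ r₁ : GroupLieAlgebra J G →ₗ[𝕜] V} {l₂ r₂ : GroupLieAlgebra J G →ₗ[𝕜] V}
    {L₁ R₁ L₂ R₂ : GroupLieAlgebra J G →ₗ[𝕜] W} (hl₁ : l₁ = r₁ ∘ₗ adMap J (x * y))
    (hl₂ : l₂ = r₂ ∘ₗ adMap J (x⁻¹ * y⁻¹)) (hL₁ : L₁ = R₁ ∘ₗ adMap J x)
    (hL₂ : L₂ = R₂ ∘ₗ adMap J y) :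
    TensorProduct.map (r₁ ∘ₗ adMap J x - r₂) R₂ T - TensorProduct.map (r₁ ∘ₗ adMap J x - l₂) L₁ T +
      (TensorProduct.map (r₁ - r₂ ∘ₗ adMap J x⁻¹) L₂ T -
        TensorProduct.map (l₁ - r₂ ∘ₗ adMap J x⁻¹) R₁ T) =
      TensorProduct.map (l₁ + r₁) (L₂ - R₁) T + TensorProduct.map (l₂ + r₂) (L₁ - R₂) T := by
  have e1 : TensorProduct.map (r₁ ∘ₗ adMap J x) R₂ T = TensorProduct.map l₁ L₂ T := by
    rw [hl₁, hL₂, adMap_mul hn, ← LinearMap.comp_assoc, hT.map_comp_adMap]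
  have e2 : TensorProduct.map (r₁ ∘ₗ adMap J x) L₁ T = TensorProduct.map r₁ R₁ T := by
    rw [hL₁, hT.map_comp_adMap]
  have e3 : TensorProduct.map (r₂ ∘ₗ adMap J x⁻¹) R₁ T = TensorProduct.map r₂ L₁ T := by
    rw [← hT.map_comp_adMap r₂ L₁ x⁻¹, hL₁, LinearMap.comp_assoc, ← adMap_mul hn, mul_inv_cancel,
      adMap_one, LinearMap.comp_id]
  have e4 : TensorProduct.map (r₂ ∘ₗ adMap J x⁻¹) L₂ T = TensorProduct.map l₂ R₂ T := by
    rw [← hT.map_comp_adMap _ L₂ y⁻¹, hL₂, hl₂, LinearMap.comp_assoc, LinearMap.comp_assoc,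
      ← adMap_mul hn, ← adMap_mul hn, mul_inv_cancel, adMap_one, LinearMap.comp_id]
  have hsl : ∀ (a b : GroupLieAlgebra J G →ₗ[𝕜] V) (c : GroupLieAlgebra J G →ₗ[𝕜] W),
      TensorProduct.map (a - b) c T = TensorProduct.map a c T - TensorProduct.map b c T :=
    fun a b c => LinearMap.congr_fun
      (LinearMap.map_sub₂ (TensorProduct.mapBilinear (.id 𝕜) _ _ V W) a b c) T
  have hsr : ∀ (a : GroupLieAlgebra J G →ₗ[𝕜] V) (b c : GroupLieAlgebra J G →ₗ[𝕜] W),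
      TensorProduct.map a (b - c) T = TensorProduct.map a b T - TensorProduct.map a c T :=
    fun a b c => LinearMap.congr_fun
      ((TensorProduct.mapBilinear (.id 𝕜) _ _ V W a).map_sub b c) T
  simp only [hsl, hsr, TensorProduct.map_add_left, LinearMap.add_apply, e1, e2, e3, e4]
  abel

theorem contMDiff_doubleMoment :
    ContMDiff (J.prod J) (J.prod J) n (doubleMoment : G × G → G × G) :=
  (contMDiff_fst.mul contMDiff_snd).prodMk (contMDiff_fst.inv.mul contMDiff_snd.inv)

theorem derivAtOne_mul_inv_conj (hn : n ≠ 0) (x q : G) :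
    derivAtOne J J (fun g : G => x * g⁻¹ * x⁻¹ * q) q = -(rightMap J q ∘ₗ adMap J x) := by
  have h := derivAtOne_comp hn (c := fun g : G => x * g * x⁻¹ * q) (s := fun g => g⁻¹) (p := q)
    (by simp) ((contMDiff_conj (J := J) (n := n) x).mul contMDiff_const) (contMDiff_inv J n)
  rw [h, derivAtOne_inv hn, LinearMap.comp_neg, LinearMap.comp_id, derivAtOne_conj_mul hn]

variable (q : G × G)

theorem dmap_doubleMoment_left₁ (hn : n ≠ 0) :
    dmap (J.prod J) (J.prod J) doubleMoment q ∘ₗ (inl J q ∘ₗ leftMap J q.1) =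
      (inl J (doubleMoment q) ∘ₗ rightMap J (doubleMoment q).1) ∘ₗ adMap J q.1 -
        inr J (doubleMoment q) ∘ₗ rightMap J (doubleMoment q).2 := by
  have h := dmap_comp_velocity hn (isMotion_moveLeft₁ J n) contMDiff_doubleMoment q
    (c := fun g => q.1 * g * q.1⁻¹ * (doubleMoment q).1) (d := fun g => g⁻¹ * (doubleMoment q).2)
    ((contMDiff_conj _).mul contMDiff_const) ((contMDiff_inv J n).mul contMDiff_const)
    (fun g => by simp [doubleMoment, moveLeft₁, mul_assoc])
  rw [derivAtOne_conj_mul hn, derivAtOne_inv_mul hn, velocity_moveLeft₁ hn, LinearMap.comp_neg,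
    ← sub_eq_add_neg] at h
  exact h

theorem dmap_doubleMoment_right₁ (hn : n ≠ 0) :
    dmap (J.prod J) (J.prod J) doubleMoment q ∘ₗ (inl J q ∘ₗ rightMap J q.1) =
      inl J (doubleMoment q) ∘ₗ rightMap J (doubleMoment q).1 -
        (inr J (doubleMoment q) ∘ₗ rightMap J (doubleMoment q).2) ∘ₗ adMap J q.1⁻¹ := by
  have h := dmap_comp_velocity hn (isMotion_moveRight₁ J n) contMDiff_doubleMoment q
    (c := fun g => g * (doubleMoment q).1)
    (d := fun g => q.1⁻¹ * g⁻¹ * q.1⁻¹⁻¹ * (doubleMoment q).2)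
    contMDiff_mul_right
    (((contMDiff_const.mul (contMDiff_inv J n)).mul contMDiff_const).mul contMDiff_const)
    (fun g => by simp [doubleMoment, moveRight₁, mul_assoc])
  rw [derivAtOne_mul_inv_conj hn, velocity_moveRight₁ hn, LinearMap.comp_neg,
    ← sub_eq_add_neg] at h
  exact h

theorem dmap_doubleMoment_left₂ (hn : n ≠ 0) :
    dmap (J.prod J) (J.prod J) doubleMoment q ∘ₗ (inr J q ∘ₗ leftMap J q.2) =
      inl J (doubleMoment q) ∘ₗ leftMap J (doubleMoment q).1 -
        (inr J (doubleMoment q) ∘ₗ rightMap J (doubleMoment q).2) ∘ₗ adMap J q.1⁻¹ := by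
  have h := dmap_comp_velocity hn (isMotion_moveLeft₂ J n) contMDiff_doubleMoment q
    (c := fun g => (doubleMoment q).1 * g)
    (d := fun g => q.1⁻¹ * g⁻¹ * q.1⁻¹⁻¹ * (doubleMoment q).2)
    contMDiff_mul_left
    (((contMDiff_const.mul (contMDiff_inv J n)).mul contMDiff_const).mul contMDiff_const)
    (fun g => by simp [doubleMoment, moveLeft₂, mul_assoc])
  rw [derivAtOne_mul_inv_conj hn, velocity_moveLeft₂ hn, LinearMap.comp_neg,
    ← sub_eq_add_neg] at h
  exact h

theorem dmap_doubleMoment_right₂ (hn : n ≠ 0) :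
    dmap (J.prod J) (J.prod J) doubleMoment q ∘ₗ (inr J q ∘ₗ rightMap J q.2) =
      (inl J (doubleMoment q) ∘ₗ rightMap J (doubleMoment q).1) ∘ₗ adMap J q.1 -
        inr J (doubleMoment q) ∘ₗ leftMap J (doubleMoment q).2 := by
  have h := dmap_comp_velocity hn (isMotion_moveRight₂ J n) contMDiff_doubleMoment q
    (c := fun g => q.1 * g * q.1⁻¹ * (doubleMoment q).1) (d := fun g => (doubleMoment q).2 * g⁻¹)
    ((contMDiff_conj _).mul contMDiff_const) (contMDiff_const.mul (contMDiff_inv J n))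
    (fun g => by simp [doubleMoment, moveRight₂, mul_assoc])
  rw [derivAtOne_conj_mul hn, derivAtOne_mul_inv hn, velocity_moveRight₂ hn, LinearMap.comp_neg,
    ← sub_eq_add_neg] at h
  exact h

theorem leftMap_prod (hn : n ≠ 0) :
    leftMap (J.prod J) q ∘ₗ inl J (1 : G × G) = inl J q ∘ₗ leftMap J q.1 := by
  refine (derivAtOne_comp_inl hn q (contMDiff_mul_left (I := J.prod J) (n := n) (a := q))).trans ?_
  refine Eq.trans ?_ (velocity_moveLeft₁ hn q)
  have e : (fun g : G => q * (g, 1)) = moveLeft₁ q := by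
    ext g <;> simp [moveLeft₁]
  rw [e]
  rfl

theorem leftMap_prod' (hn : n ≠ 0) :
    leftMap (J.prod J) q ∘ₗ inr J (1 : G × G) = inr J q ∘ₗ leftMap J q.2 := by
  refine (derivAtOne_comp_inr hn q (contMDiff_mul_left (I := J.prod J) (n := n) (a := q))).trans ?_
  refine Eq.trans ?_ (velocity_moveLeft₂ hn q)
  have e : (fun g : G => q * (1, g)) = moveLeft₂ q := by
    ext g <;> simp [moveLeft₂]
  rw [e]
  rfl

theorem rightMap_prod (hn : n ≠ 0) :
    rightMap (J.prod J) q ∘ₗ inl J (1 : G × G) = inl J q ∘ₗ rightMap J q.1 := by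
  refine (derivAtOne_comp_inl hn q (contMDiff_mul_right (I := J.prod J) (n := n) (a := q))).trans ?_
  refine Eq.trans ?_ (velocity_moveRight₁ hn q)
  have e : (fun g : G => (g, 1) * q) = moveRight₁ q := by
    ext g <;> simp [moveRight₁]
  rw [e]
  rfl

theorem rightMap_prod' (hn : n ≠ 0) :
    rightMap (J.prod J) q ∘ₗ inr J (1 : G × G) = inr J q ∘ₗ rightMap J q.2 := by
  refine (derivAtOne_comp_inr hn q (contMDiff_mul_right (I := J.prod J) (n := n) (a := q))).trans ?_
  refine Eq.trans ?_ (velocity_moveRight₂ hn q)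
  have e : (fun g : G => (1, g) * q) = moveRight₂ q := by
    ext g <;> simp [moveRight₂]
  rw [e]
  rfl

theorem map_smul_add_map_doubleTensor {L L' V W : Type*} [AddCommGroup L] [Module 𝕜 L]
    [AddCommGroup L'] [Module 𝕜 L'] [AddCommGroup V] [Module 𝕜 V] [AddCommGroup W] [Module 𝕜 W]
    {i j : L →ₗ[𝕜] L'} {l r : L' →ₗ[𝕜] V} {F : L' →ₗ[𝕜] W}
    {l₁ r₁ l₂ r₂ : L →ₗ[𝕜] V} {A B : L →ₗ[𝕜] W} (hl₁ : l ∘ₗ i = l₁) (hr₁ : r ∘ₗ i = r₁)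
    (hl₂ : l ∘ₗ j = l₂) (hr₂ : r ∘ₗ j = r₂) (hA : F ∘ₗ i = A) (hB : F ∘ₗ j = B) (c : 𝕜)
    (T : L ⊗[𝕜] L) :
    TensorProduct.map (c • (l + r)) F (TensorProduct.map i i T + TensorProduct.map j j T) =
      c • (TensorProduct.map (l₁ + r₁) A T + TensorProduct.map (l₂ + r₂) B T) := by
  subst hl₁ hr₁ hl₂ hr₂ hA hB
  rw [TensorProduct.map_smul_left, LinearMap.smul_apply, map_add, ← map_comp_apply,
    ← map_comp_apply]
  simp only [LinearMap.add_comp]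

theorem map_smul_sub {U U' V : Type*} [AddCommGroup U] [Module 𝕜 U] [AddCommGroup U'] [Module 𝕜 U']
    [AddCommGroup V] [Module 𝕜 V] {D : U →ₗ[𝕜] V} {L₁ R₁ L₂ R₂ : U' →ₗ[𝕜] U}
    {a b c d : U' →ₗ[𝕜] V} (ha : D ∘ₗ L₁ = a) (hb : D ∘ₗ R₂ = b) (hc : D ∘ₗ R₁ = c)
    (hd : D ∘ₗ L₂ = d) (k : 𝕜) (T : U' ⊗[𝕜] U') :
    TensorProduct.map D LinearMap.id (k • ((TensorProduct.map L₁ R₂ T - TensorProduct.map R₂ L₁ T) +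
        (TensorProduct.map R₁ L₂ T - TensorProduct.map L₂ R₁ T))) =
      k • ((TensorProduct.map a R₂ T - TensorProduct.map b L₁ T) +
        (TensorProduct.map c L₂ T - TensorProduct.map d R₁ T)) := by
  subst ha hb hc hd
  simp only [map_smul, map_add, map_sub, ← map_comp_apply, LinearMap.id_comp]

theorem IsAdInvSymm.isMomentumMap_doubleMoment (hT : IsAdInvSymm J T) (hn : n ≠ 0) :
    IsMomentumMap n doubleAct (doubleTensor T) (doubleBivector T) (doubleMoment : G × G → G × G)
    where
  contMDiff := contMDiff_doubleMoment
  equivariant p q := by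
    ext <;> simp [doubleAct, doubleMoment, mul_assoc]
  momentum q := by
    have key := momentum_identity hT hn (x := q.1) (y := q.2)
      (l₁ := inl J (doubleMoment q) ∘ₗ leftMap J (doubleMoment q).1)
      (r₁ := inl J (doubleMoment q) ∘ₗ rightMap J (doubleMoment q).1)
      (l₂ := inr J (doubleMoment q) ∘ₗ leftMap J (doubleMoment q).2)
      (r₂ := inr J (doubleMoment q) ∘ₗ rightMap J (doubleMoment q).2)
      (L₁ := inl J q ∘ₗ leftMap J q.1) (R₁ := inl J q ∘ₗ rightMap J q.1)
      (L₂ := inr J q ∘ₗ leftMap J q.2) (R₂ := inr J q ∘ₗ rightMap J q.2)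
      (congrArg (fun l => inl J (doubleMoment q) ∘ₗ l)
        (leftMap_eq_rightMap_comp_adMap J hn (doubleMoment q).1))
      (congrArg (fun l => inr J (doubleMoment q) ∘ₗ l)
        (leftMap_eq_rightMap_comp_adMap J hn (doubleMoment q).2))
      (congrArg (fun l => inl J q ∘ₗ l) (leftMap_eq_rightMap_comp_adMap J hn q.1))
      (congrArg (fun l => inr J q ∘ₗ l) (leftMap_eq_rightMap_comp_adMap J hn q.2))
    have h1 := map_smul_sub (dmap_doubleMoment_left₁ q hn) (dmap_doubleMoment_right₂ q hn)
      (dmap_doubleMoment_right₁ q hn) (dmap_doubleMoment_left₂ q hn) (1 / 2) T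
    have h2 := map_smul_add_map_doubleTensor (leftMap_prod (doubleMoment q) hn)
      (rightMap_prod (doubleMoment q) hn) (leftMap_prod' (doubleMoment q) hn)
      (rightMap_prod' (doubleMoment q) hn) (fund_doubleAct_comp_inl hn q)
      (fund_doubleAct_comp_inr hn q) (1 / 2) T
    exact h1.trans ((congrArg ((1 / 2 : 𝕜) • ·) key).trans h2.symm)

end Momentum

theorem add_one_le_of_minSmoothness_infty_le {𝕜 : Type*} [NontriviallyNormedField 𝕜]
    {n : WithTop ℕ∞} (hn : minSmoothness 𝕜 ∞ ≤ n) : n + 1 ≤ n := by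
  have h : (∞ : WithTop ℕ∞) ≤ n := le_minSmoothness.trans hn
  induction n with
  | top => exact le_top
  | coe m =>
    have : m = ⊤ := top_le_iff.1 (WithTop.coe_le_coe.1 h)
    subst this
    exact le_rfl

end QuasiPoisson

end

open QuasiPoisson in
theorem theorem6 :
    -- smooth and analytic Lie groups
    (∀ {𝕜 : Type*} [NontriviallyNormedField 𝕜] [CharZero 𝕜]
      {E : Type*} [NormedAddCommGroup E] [NormedSpace 𝕜 E] [FiniteDimensional 𝕜 E]
      [CompleteSpace E]
      {HG : Type*} [TopologicalSpace HG] (J : ModelWithCorners 𝕜 E HG) [J.Boundaryless]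
      -- `n` is `∞` or `ω` if `𝕜` is `ℝ` or `ℂ`, and `ω` otherwise
      (n : WithTop ℕ∞) (_ : minSmoothness 𝕜 ∞ ≤ n)
      -- the second `LieGroup` hypothesis follows from the first; it makes the Lie algebra available
      {G : Type*} [TopologicalSpace G] [ChartedSpace HG G] [Group G] [LieGroup J n G]
      [LieGroup J (minSmoothness 𝕜 3) G]
      (H : GroupLieAlgebra J G ⊗[𝕜] GroupLieAlgebra J G) (_ : IsAdInvSymm J H),
      IsManifoldAction (J.prod J) (J.prod J) n (doubleAct : G × G → G × G → G × G) ∧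
      IsQuasiPoisson n doubleAct (doubleTensor H) (doubleBivector H) ∧
      IsMomentumMap n doubleAct (doubleTensor H) (doubleBivector H) doubleMoment) ∧
    -- affine algebraic groups
    (∀ {K : Type*} [Field K] [CharZero K]
      {A : Type*} [CommRing A] [HopfAlgebra K A] [Algebra.FiniteType K A]
      (H : Algebraic.lieAlg K A ⊗[K] Algebraic.lieAlg K A) (_ : Algebraic.IsAdInvSymm H),
      Algebraic.IsAction (Algebraic.doubleAct K A) ∧
      Algebraic.IsQuasiPoisson (Algebraic.doubleAct K A) (Algebraic.doubleTensor H)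
        (Algebraic.doubleBivector H) ∧
      Algebraic.IsMomentumMap (Algebraic.doubleAct K A) (Algebraic.doubleTensor H)
        (Algebraic.doubleBivector H) (Algebraic.doubleMoment K A)) := by
  refine ⟨fun {𝕜} _ _ {E} _ _ _ _ {HG} _ J _ n hn {G} _ _ _ _ _ H hH => ?_,
    fun {K} _ _ {A} _ _ _ H hH => ⟨Algebraic.isAction_doubleAct,
      hH.isQuasiPoisson_doubleBivector, hH.isMomentumMap_doubleMoment⟩⟩
  have hn' : minSmoothness 𝕜 2 ≤ n := (minSmoothness_monotone (WithTop.coe_le_coe.2 le_top)).trans hn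
  exact ⟨isManifoldAction_doubleAct,
    hH.isQuasiPoisson_doubleBivector (add_one_le_of_minSmoothness_infty_le hn) hn',
    hH.isMomentumMap_doubleMoment (ne_zero_of_minSmoothness_le hn')⟩
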